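/- A partial linear extension (ple) of a finite poset $P$ is a linear extension of a subposet of $P$. A function $w$ that assigns a weight $w(M)\in[0,1]$ to each ple $M$ of $P$ is a fractional local realizer of $P$ if, for all $u,v\in P$ (not necessarily distinct): $\sum\{w(M): u\le v \text{ in } M\}\ge 1$ whenever $u\le v$ in $P$, and $\sum\{w(M): u>v\text{ in }M\}\ge 1$ whenever $u,v$ are incomparable in $P$. The fractional local dimension $\operatorname{fldim}(P)$ is the minimum, over all fractional local realizers $w$, of $\max_{u\in P}\sum\{w(M): u\in M\}$. For $2\le d<n$ let $P(1,d;n)$ be the poset of all $1$-element and all $d$-element subsets of $\{1,\dots,n\}$, ordered by inclusion, and let $$\operatorname{FLD}(d)=\lim_{n\to\infty}\operatorname{fldim}(P(1,d;n)).$$ Let $d\ge 2$ be an integer. Let $\beta$ be the unique number in $(0,1)$ with $(1-\beta)^d=\beta$, and put $$r(x)=\frac{1}{d+1}\Bigl[(d+1)x-d\,x^{(d+1)/d}-(1-x)^{d+1}\Bigr]\ (\beta\le x\le 1),\qquad g(x)=\frac{(d+1)r(x)-x}{(d+1)r(x)-x^2}\ (\beta\le x<1).$$ Let $x_{\mathrm{bst}}$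 be the unique point of $[\beta,1)$ at which $g$ attains its maximum, let $x_{\mathrm{bal}}$ be the unique point of $[\beta,1]$ with $r(x_{\mathrm{bal}})=x_{\mathrm{bal}}^2/2$, and set $$c_{\mathrm{bal}}=\frac{x_{\mathrm{bal}}}{r(x_{\mathrm{bal}})},\qquad c_{\mathrm{bst}}=2+\frac{(d-1)(x_{\mathrm{bst}}-x_{\mathrm{bst}}^2)}{(d+1)r(x_{\mathrm{bst}})-x_{\mathrm{bst}}^2}.$$ Theorem 2. For every $d\ge2$ the numbers $\beta$, $x_{\mathrm{bst}}$, $x_{\mathrm{bal}}$ exist and are uniquely determined, and the limit $\operatorname{FLD}(d)$ exists. If $d\in\{2,3\}$, then $\operatorname{FLD}(d)=c_{\mathrm{bal}}$. If $d\ge4$, then $\operatorname{FLD}(d)=c_{\mathrm{bst}}=\min\{c_{\mathrm{bal}},c_{\mathrm{bst}}\}$. In particular $\operatorname{FLD}(d)<d+1$ for all $d\ge2$. -/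

import Mathlib

open Filter Topology Set

noncomputable section

/-- A partial linear extension of a poset `α`: a linear extension of the subposet on a
set `support`. The relation `le` is the linear order; it holds only between elements of
`support`. -/
structure PartialLinExt (α : Type*) [PartialOrder α] where
  support : Set α
  le : α → α → Prop
  mem_of_le : ∀ u v, le u v → u ∈ support ∧ v ∈ support
  le_refl : ∀ u ∈ support, le u u
  le_trans : ∀ u v t, le u v → le v t → le u t
  le_antisymm : ∀ u v, le u v → le v u → u = v
  le_total : ∀ u ∈ support, ∀ v ∈ support, le u v ∨ le v u
  extends_le : ∀ u ∈ support, ∀ v ∈ support, u ≤ v → le u v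

/-- The strict order of a partial linear extension. -/
def PartialLinExt.lt {α : Type*} [PartialOrder α] (M : PartialLinExt α) (u v : α) : Prop :=
  M.le u v ∧ u ≠ v

/-- A finite poset has only finitely many partial linear extensions. -/
instance PartialLinExt.instFinite {α : Type*} [PartialOrder α] [Finite α] :
    Finite (PartialLinExt α) :=
  Finite.of_injective
    (fun M : PartialLinExt α => ((M.support, M.le) : Set α × (α → α → Prop)))
    (by
      rintro ⟨s, l, _, _, _, _, _, _⟩ ⟨s', l', _, _, _, _, _, _⟩ h
      simp only [Prod.mk.injEq] at h
      obtain ⟨rfl, rfl⟩ := h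
      rfl)

instance PartialLinExt.instFintype {α : Type*} [PartialOrder α] [Finite α] :
    Fintype (PartialLinExt α) := Fintype.ofFinite _

/-- `∑ {w(M) : M a partial linear extension with property p}`. -/
def weightSum {α : Type*} [PartialOrder α] [Finite α] (w : PartialLinExt α → ℝ)
    (p : PartialLinExt α → Prop) : ℝ :=
  open Classical in ∑ M : PartialLinExt α with p M, w M

/-- A local weight function: real weights between `0` and `1`. -/
def IsLocalWeight {α : Type*} [PartialOrder α] (w : PartialLinExt α → ℝ) : Prop :=
  ∀ M, 0 ≤ w M ∧ w M ≤ 1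

/-- The local measure of a point `u`. -/
def pointMeasure {α : Type*} [PartialOrder α] [Finite α] (w : PartialLinExt α → ℝ) (u : α) : ℝ :=
  weightSum w (fun M => u ∈ M.support)

/-- The local measure of a poset: the maximum over its (finitely many) points. -/
def posetMeasure {α : Type*} [PartialOrder α] [Finite α] (w : PartialLinExt α → ℝ) : ℝ :=
  ⨆ u : α, pointMeasure w u

/-- Fractional local realizers. -/
def IsFractionalLocalRealizer {α : Type*} [PartialOrder α] [Finite α]
    (w : PartialLinExt α → ℝ) : Prop :=
  IsLocalWeight w ∧
  (∀ u v : α, u ≤ v → 1 ≤ weightSum w (fun M => M.le u v)) ∧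
  (∀ u v : α, ¬ u ≤ v → ¬ v ≤ u → 1 ≤ weightSum w (fun M => M.lt v u))

/-- The fractional local dimension of a finite poset. -/
def fldim (α : Type*) [PartialOrder α] [Finite α] : ℝ :=
  sInf {c : ℝ | ∃ w : PartialLinExt α → ℝ, IsFractionalLocalRealizer w ∧ posetMeasure w = c}

/-- The poset of all `1`-element and `d`-element subsets of an `n`-element set, ordered by
inclusion (the order that a subtype inherits from `Finset (Fin n)`). -/
abbrev SubsetPoset (d n : ℕ) : Type := {s : Finset (Fin n) // s.card = 1 ∨ s.card = d}

/-- The limit of `fldim(1,d;n)` as `n → ∞`. -/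
def FLD (d : ℕ) : ℝ := limUnder atTop (fun n : ℕ => fldim (SubsetPoset d n))

/-- `β` is a fixed point of `(1 - x)^d` in `(0,1)`. -/
def IsBeta (d : ℕ) (β : ℝ) : Prop := 0 < β ∧ β < 1 ∧ (1 - β) ^ d = β

/-- The function `r` on `[β,1]`. -/
def rFun (d : ℕ) (x : ℝ) : ℝ :=
  1 / ((d : ℝ) + 1) *
    (((d : ℝ) + 1) * x - d * x ^ (((d : ℝ) + 1) / d) - (1 - x) ^ (d + 1))

/-- The function `g`; its denominator is positive on `[β,1)` and vanishes at `1`. -/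
def gFun (d : ℕ) (x : ℝ) : ℝ :=
  (((d : ℝ) + 1) * rFun d x - x) / (((d : ℝ) + 1) * rFun d x - x ^ 2)

/-- `x` maximizes `g` over `[β,1)`, the part of `[β,1]` on which the quotient is defined. -/
def IsXBst (d : ℕ) (β x : ℝ) : Prop := x ∈ Ico β 1 ∧ IsMaxOn (gFun d) (Ico β 1) x

/-- `x` solves `r(x) = x²/2` in `[β,1]`. -/
def IsXBal (d : ℕ) (β x : ℝ) : Prop := x ∈ Icc β 1 ∧ rFun d x = x ^ 2 / 2

/-- `x / r(x)`, which is `c_bal` at `x = x_bal`. -/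
def cBalAt (d : ℕ) (x : ℝ) : ℝ := x / rFun d x

/-- `2 + (d-1)(x-x²) / ((d+1) r(x) - x²)`, which is `c_bst` at `x = x_bst`. -/
def cBstAt (d : ℕ) (x : ℝ) : ℝ :=
  2 + ((d : ℝ) - 1) * (x - x ^ 2) / (((d : ℝ) + 1) * rFun d x - x ^ 2)

end

/-! The fractional local dimension is the value of a linear program on which the symmetric group
acts, so only three statistics of a partial linear extension matter: the proportions p of points and
q of d-sets that it contains, and the proportion ρ of (d-set, point) pairs with the d-set below the
point. In the limit one needs ∫ρ ≥ 1, ∫p² ≥ 2 and ∫q² ≥ 2 (two points, or two d-sets, are needed in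
both orders), and max(∫p, ∫q) is minimised. A d-set below the i-th highest point avoids the i
highest points, so ρ ≤ ∫_0^p min(q, (1-t)^d) dt, which equals r(x) when p = q = x ≥ β
(`revCount_le_sum`, `sum_min_le_integral_bound`).

Upper bound: threshold extensions of the colexicographic order attain p = q = x and ρ = r(x). Weight
W on these and weight V on full extensions (p = q = 1, ρ = 1/(d+1)) give a realizer if W r(x) +
V/(d+1) = 1 and W x² + V = 2, at cost Wx + V (`exists_realizer_of_thresholds`,
`eventually_exists_realizer`).

Lower bound: multipliers with lρ + (a/2)p² + (b/2)q² ≤ αp + α'q for all admissible statistics and α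
+ α' = 1 prove the bound l + a + b (`le_posetMeasure_of_dual`). By `exists_dual` it suffices, with T
= a + b, that l r(y) + T y²/2 - y vanishes together with its derivative at some y and is nonpositive
at 1. `tendsto_fldim` joins the two bounds.

With V = 0 the primal forces r(x) = x²/2 and costs c_bal = 2/x. With V > 0 the dual is tight at 1,
so l = (1-γ)(d+1) and T = 2γ; tangency makes γ the maximum of g, and the value is c_bst. The second
solution is feasible when x_bst ≤ x_bal, which is settled by the sign of g' at x_bal: nonpositive
for d ≥ 4 (`signFun_nonpos`). For d = 2, 3 it is nonnegative, which makes the dual solution for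
c_bal feasible instead. -/

section Family

/-! ### Realizers from weighted families. -/

/-- A finite family of partial linear extensions with nonnegative weights that satisfies the
covering conditions yields a fractional local realizer; truncating the weights at `1` is
harmless. -/
theorem exists_realizer_of_family {α : Type*} [PartialOrder α] [Finite α] [Nonempty α]
    {ι : Type*} [Fintype ι] (c : ι → ℝ) (hc : ∀ i, 0 ≤ c i) (M : ι → PartialLinExt α) (C : ℝ)
    (h1 : ∀ u v : α, u ≤ v → 1 ≤ ∑ i, open Classical in if (M i).le u v then c i else 0)
    (h2 : ∀ u v : α, ¬ u ≤ v → ¬ v ≤ u →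
      1 ≤ ∑ i, open Classical in if (M i).lt v u then c i else 0)
    (h3 : ∀ u : α, ∑ i, (open Classical in if u ∈ (M i).support then c i else 0) ≤ C) :
    ∃ w : PartialLinExt α → ℝ, IsFractionalLocalRealizer w ∧ posetMeasure w ≤ C := by
  classical
  set w' : PartialLinExt α → ℝ := fun N => ∑ i, if M i = N then c i else 0 with hw'
  have hw'0 : ∀ N, 0 ≤ w' N := fun N => Finset.sum_nonneg fun i _ => by
    split_ifs
    · exact hc i
    · exact le_rfl
  have hsum : ∀ p : PartialLinExt α → Prop, weightSum w' p = ∑ i, if p (M i) then c i else 0 := by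
    intro p
    unfold weightSum
    simp only [hw']
    rw [Finset.sum_comm]
    refine Finset.sum_congr rfl fun i _ => ?_
    rw [Finset.sum_ite_eq]
    simp
  -- Truncation loses nothing: either one extension with the property has weight at least 1 and
  -- covers alone, or no weight in the sum changes.
  have key : ∀ p : PartialLinExt α → Prop, 1 ≤ weightSum w' p →
      1 ≤ weightSum (fun N => min 1 (w' N)) p := by
    intro p hp
    unfold weightSum at hp ⊢
    by_cases hex : ∃ N, p N ∧ 1 ≤ w' N
    · obtain ⟨N, hN, hN1⟩ := hex
      calc (1 : ℝ) = min 1 (w' N) := by simp [hN1]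
        _ ≤ _ := Finset.single_le_sum (f := fun N => min 1 (w' N))
          (fun N _ => le_min zero_le_one (hw'0 N)) (by simp [hN])
    · push Not at hex
      refine hp.trans (le_of_eq (Finset.sum_congr rfl fun N hN => ?_))
      exact (min_eq_right (hex N (by simpa using hN)).le).symm
  refine ⟨fun N => min 1 (w' N), ⟨fun N => ⟨le_min zero_le_one (hw'0 N), min_le_left _ _⟩, ?_, ?_⟩,
    ?_⟩
  · intro u v huv
    apply key
    rw [hsum]
    convert h1 u v huv
  · intro u v huv hvu
    apply key
    rw [hsum]
    convert h2 u v huv hvu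
  · refine ciSup_le fun u => ?_
    refine le_trans ?_ (h3 u)
    have := hsum (fun M => u ∈ M.support)
    unfold pointMeasure
    calc weightSum (fun N => min 1 (w' N)) (fun M => u ∈ M.support)
        ≤ weightSum w' (fun M => u ∈ M.support) :=
          Finset.sum_le_sum fun N _ => min_le_right _ _
      _ ≤ _ := by
          rw [this]

theorem weightSum_nonneg {α : Type*} [PartialOrder α] [Finite α] {w : PartialLinExt α → ℝ}
    (hw : ∀ M, 0 ≤ w M) (p : PartialLinExt α → Prop) : 0 ≤ weightSum w p :=
  Finset.sum_nonneg fun M _ => hw M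

theorem pointMeasure_le_posetMeasure {α : Type*} [PartialOrder α] [Finite α]
    (w : PartialLinExt α → ℝ) (u : α) : pointMeasure w u ≤ posetMeasure w :=
  le_ciSup (f := pointMeasure w) (Set.finite_range _).bddAbove u

theorem fldim_le_of_realizer {α : Type*} [PartialOrder α] [Finite α] [Nonempty α]
    {w : PartialLinExt α → ℝ} (hw : IsFractionalLocalRealizer w) : fldim α ≤ posetMeasure w := by
  refine csInf_le ⟨0, ?_⟩ ⟨w, hw, rfl⟩
  rintro c ⟨w', hw', rfl⟩
  obtain ⟨u⟩ := ‹Nonempty α›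
  exact (weightSum_nonneg (fun M => (hw'.1 M).1) _).trans (pointMeasure_le_posetMeasure w' u)

end Family

/-! ### Averaging over the symmetric group. -/

section Orbit

/-- Double counting: by transitivity the sum over `G` is the same from every base point in `X`, and
each `g` permutes `X`. -/
theorem sum_orbit_mul_card {G Y : Type*} [Group G] [Fintype G] [MulAction G Y] (X : Finset Y)
    (hinv : ∀ g : G, ∀ y ∈ X, g • y ∈ X) (htrans : ∀ y ∈ X, ∀ z ∈ X, ∃ g : G, g • y = z)
    (f : Y → ℝ) {x : Y} (hx : x ∈ X) :
    (∑ g : G, f (g • x)) * X.card = Fintype.card G * ∑ y ∈ X, f y := by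
  classical
  have h1 : ∀ y ∈ X, ∑ g : G, f (g • y) = ∑ g : G, f (g • x) := by
    intro y hy
    obtain ⟨h, rfl⟩ := htrans x hx y hy
    simp_rw [← mul_smul]
    exact Fintype.sum_equiv (Equiv.mulRight h) _ _ fun g => rfl
  have h2 : ∀ g : G, ∑ y ∈ X, f (g • y) = ∑ y ∈ X, f y := by
    intro g
    refine Finset.sum_bij (fun y _ => g • y) (fun y hy => hinv g y hy)
      (fun y _ z _ h => smul_left_cancel g h) (fun y hy => ⟨g⁻¹ • y, hinv _ _ hy, by simp⟩)
      fun _ _ => rfl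
  calc (∑ g : G, f (g • x)) * X.card = ∑ y ∈ X, ∑ g : G, f (g • y) := by
        rw [Finset.sum_congr rfl h1]; simp [mul_comm]
    _ = ∑ g : G, ∑ y ∈ X, f (g • y) := Finset.sum_comm
    _ = _ := by simp [h2]

open scoped Pointwise

variable {n : ℕ}

theorem exists_perm_of_fiber_card {α γ : Type*} [Fintype α] [DecidableEq α] [DecidableEq γ]
    (f g : α → γ)
    (h : ∀ c, (Finset.univ.filter fun a => f a = c).card =
      (Finset.univ.filter fun a => g a = c).card) :
    ∃ σ : Equiv.Perm α, ∀ a, g (σ a) = f a := by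
  have hne : ∀ c, Nonempty ({a // f a = c} ≃ {b // g b = c}) := fun c => by
    rw [← Fintype.card_eq, Fintype.card_subtype, Fintype.card_subtype, h c]
  let e := fun c => (hne c).some
  exact ⟨Equiv.ofFiberEquiv e, Equiv.ofFiberEquiv_map e⟩

theorem smul_finset_eq_of_mem_iff (σ : Equiv.Perm (Fin n)) (s t : Finset (Fin n))
    (h : ∀ a, σ a ∈ t ↔ a ∈ s) : σ • s = t := by
  ext b
  rw [Finset.mem_smul_finset]
  constructor
  · rintro ⟨a, ha, rfl⟩
    exact (h a).2 ha
  · intro hb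
    exact ⟨σ⁻¹ b, (h _).1 (by simpa using hb), by simp⟩

/-- `s \ t` and `t \ s` have the same size, so the two-bit membership labels and their swaps have
fibres of equal size. -/
theorem exists_perm_swap (s t : Finset (Fin n)) (h : s.card = t.card) :
    ∃ σ : Equiv.Perm (Fin n), σ • s = t ∧ σ • t = s := by
  obtain ⟨σ, hσ⟩ := exists_perm_of_fiber_card (fun a => (decide (a ∈ s), decide (a ∈ t)))
    (fun a => (decide (a ∈ t), decide (a ∈ s))) (by
      have hst : (s \ t).card = (t \ s).card := by
        have h1 := Finset.card_sdiff_add_card_inter s t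
        have h2 := Finset.card_sdiff_add_card_inter t s
        rw [Finset.inter_comm] at h2
        omega
      have e1 : (Finset.univ.filter fun a => a ∈ s ∧ a ∉ t) = s \ t := by ext; simp
      have e2 : (Finset.univ.filter fun a => a ∈ t ∧ a ∉ s) = t \ s := by ext; simp
      rintro ⟨x, y⟩
      cases x <;> cases y <;> simp only [Prod.mk.injEq, decide_eq_true_eq, decide_eq_false_iff_not]
      · simp only [and_comm]
      · simp only [and_comm (a := _ ∉ s), and_comm (a := _ ∉ t)]
        rw [e1, e2, hst]
      · rw [e1, e2, hst]
      · simp only [and_comm])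
  refine ⟨σ, smul_finset_eq_of_mem_iff _ _ _ fun a => ?_, smul_finset_eq_of_mem_iff _ _ _ fun a => ?_⟩
  · have := congrArg Prod.fst (hσ a)
    simpa using this
  · have := congrArg Prod.snd (hσ a)
    simpa using this

theorem exists_perm_pair {a a' : Fin n} {s s' : Finset (Fin n)} (ha : a ∉ s) (ha' : a' ∉ s')
    (h : s.card = s'.card) : ∃ σ : Equiv.Perm (Fin n), σ a = a' ∧ σ • s = s' := by
  obtain ⟨σ, hσ, -⟩ := exists_perm_swap s s' h
  -- The transposition corrects the image of `a` and preserves `s'`, which contains neither `σ a`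
  -- nor `a'`.
  refine ⟨Equiv.swap (σ a) a' * σ, by simp, ?_⟩
  have hσa : σ a ∉ s' := by
    rw [← hσ]
    intro hm
    rw [Finset.mem_smul_finset] at hm
    obtain ⟨b, hb, hbe⟩ := hm
    have hba : b = a := σ.injective (by simpa using hbe)
    exact ha (hba ▸ hb)
  rw [mul_smul, hσ]
  refine smul_finset_eq_of_mem_iff _ _ _ fun b => ?_
  by_cases h1 : b = σ a
  · subst h1; simp [ha', hσa]
  by_cases h2 : b = a'
  · subst h2; simp [ha', hσa]
  · rw [Equiv.swap_apply_of_ne_of_ne h1 h2]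

/-- The number of permutations that map `U` into `A`. -/
theorem card_perm_subset_mul (A U : Finset (Fin n)) :
    ((Finset.univ.filter fun σ : Equiv.Perm (Fin n) => σ • U ⊆ A).card : ℝ) * n.choose U.card =
      n.factorial * A.card.choose U.card := by
  have := sum_orbit_mul_card (G := Equiv.Perm (Fin n)) (Finset.powersetCard U.card Finset.univ)
    (by simp [Finset.mem_powersetCard])
    (by
      simp only [Finset.mem_powersetCard_univ]
      intro y hy z hz
      obtain ⟨g, hg, -⟩ := exists_perm_swap y z (hy.trans hz.symm)
      exact ⟨g, hg⟩)
    (fun s => if s ⊆ A then 1 else 0) (x := U) (by simp)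
  rw [Finset.card_powersetCard, Fintype.card_perm, Finset.card_univ, Fintype.card_fin,
    Finset.sum_boole, Finset.sum_boole] at this
  rw [this]
  congr 2
  rw [← Finset.card_powersetCard]
  congr 1
  ext s
  simp [Finset.mem_powersetCard, and_comm]

/-- Averaging a function of a non-incident pair over all permutations. -/
theorem sum_perm_pair_mul (d : ℕ) (f : Fin n → Finset (Fin n) → ℝ) {a : Fin n}
    {s : Finset (Fin n)} (ha : a ∉ s) (hs : s.card = d) :
    (∑ σ : Equiv.Perm (Fin n), f (σ a) (σ • s)) * ((n - d : ℝ) * n.choose d) =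
      n.factorial * ∑ t ∈ Finset.powersetCard d Finset.univ, ∑ b ∈ tᶜ, f b t := by
  set X : Finset (Fin n × Finset (Fin n)) :=
    ((Finset.powersetCard d Finset.univ).sigma fun t => tᶜ).map
      ⟨fun x => (x.2, x.1), by rintro ⟨x, y⟩ ⟨z, w⟩ h; simp at h ⊢; tauto⟩ with hX
  have hmem : ∀ x, x ∈ X ↔ x.2.card = d ∧ x.1 ∉ x.2 := by
    rintro ⟨x, y⟩
    rw [hX, Finset.mem_map]
    constructor
    · rintro ⟨⟨p, q⟩, h, he⟩
      obtain ⟨rfl, rfl⟩ : q = x ∧ p = y := Prod.mk.inj (show (q, p) = (x, y) from he)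
      simpa using h
    · intro h
      exact ⟨⟨y, x⟩, by simpa using h, rfl⟩
  have hdn : d ≤ n := by rw [← hs]; simpa using Finset.card_le_univ s
  have hc : (X.card : ℝ) = (n - d : ℝ) * n.choose d := by
    rw [hX, Finset.card_map, Finset.card_sigma]
    rw [Finset.sum_congr rfl (g := fun _ => n - d)]
    · simp [Nat.cast_sub hdn, mul_comm]
    · intro t ht
      rw [Finset.card_compl, (Finset.mem_powersetCard.1 ht).2, Fintype.card_fin]
  have := sum_orbit_mul_card (G := Equiv.Perm (Fin n)) X
    (by
      rintro g ⟨x, y⟩ h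
      rw [hmem] at h ⊢
      refine ⟨by simpa using h.1, ?_⟩
      simpa using fun hh => h.2 ((Finset.smul_mem_smul_finset_iff g).1 hh))
    (by
      rintro ⟨x, y⟩ h ⟨z, w⟩ h'
      rw [hmem] at h h'
      obtain ⟨g, hg1, hg2⟩ := exists_perm_pair h.2 h'.2 (h.1.trans h'.1.symm)
      exact ⟨g, by simp [hg1, hg2]⟩)
    (fun x => f x.1 x.2) (x := (a, s)) (by rw [hmem]; exact ⟨hs, ha⟩)
  rw [hc, Fintype.card_perm, Fintype.card_fin] at this
  simp only [Prod.smul_mk, Equiv.Perm.smul_def] at this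
  rw [this, hX, Finset.sum_map, Finset.sum_sigma]
  rfl

end Orbit

/-! ### Threshold extensions of the colexicographic order. -/

section ColexExtension

open scoped Pointwise

variable {n : ℕ}

/-- The sets kept by the threshold extension: singletons in positions `≥ k` and `d`-sets in
positions `< m`. -/
def ThresholdKept (d k m : ℕ) (s : Finset (Fin n)) : Prop :=
  (s.card = 1 ∧ ∀ a ∈ s, k ≤ (a : ℕ)) ∨ (s.card = d ∧ ∀ a ∈ s, (a : ℕ) < m)

/-- Kept sets, ordered by the colexicographic order after relabelling by `σ`. -/
def thresholdExt (d k m : ℕ) (σ : Equiv.Perm (Fin n)) : PartialLinExt (SubsetPoset d n) where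
  support := {u | ThresholdKept d k m (σ • u.1)}
  le u v := ThresholdKept d k m (σ • u.1) ∧ ThresholdKept d k m (σ • v.1) ∧
    toColex (σ • u.1) ≤ toColex (σ • v.1)
  mem_of_le _ _ h := ⟨h.1, h.2.1⟩
  le_refl _ h := ⟨h, h, le_rfl⟩
  le_trans _ _ _ h h' := ⟨h.1, h'.2.1, h.2.2.trans h'.2.2⟩
  le_antisymm u v h h' := by
    have h1 : σ • u.1 = σ • v.1 := toColex_inj.1 (le_antisymm h.2.2 h'.2.2)
    exact Subtype.ext (smul_left_cancel σ h1)
  le_total u hu v hv := by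
    rcases le_total (toColex (σ • u.1)) (toColex (σ • v.1)) with h | h
    · exact Or.inl ⟨hu, hv, h⟩
    · exact Or.inr ⟨hv, hu, h⟩
  extends_le u hu v hv h := ⟨hu, hv, Finset.Colex.toColex_le_toColex_of_subset
    (Finset.smul_finset_subset_smul_finset h)⟩

/-- The strict order of `thresholdExt`, read off after relabelling. -/
def ThresholdLT (d k m : ℕ) (s t : Finset (Fin n)) : Prop :=
  ThresholdKept d k m s ∧ ThresholdKept d k m t ∧ toColex s < toColex t

theorem thresholdExt_lt_iff {d k m : ℕ} {σ : Equiv.Perm (Fin n)} {u v : SubsetPoset d n} :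
    (thresholdExt d k m σ).lt u v ↔ ThresholdLT d k m (σ • u.1) (σ • v.1) := by
  unfold PartialLinExt.lt ThresholdLT
  have : u ≠ v ↔ toColex (σ • u.1) ≠ toColex (σ • v.1) := by
    rw [Ne, Ne, toColex_inj, smul_left_cancel_iff, Subtype.ext_iff]
  rw [lt_iff_le_and_ne, this]
  simp only [thresholdExt]
  tauto

theorem mem_thresholdExt_iff {d k m : ℕ} {σ : Equiv.Perm (Fin n)} {u : SubsetPoset d n} :
    u ∈ (thresholdExt d k m σ).support ↔ ThresholdKept d k m (σ • u.1) := Iff.rfl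

theorem thresholdKept_singleton {d k m : ℕ} (hd : 2 ≤ d) {a : Fin n} :
    ThresholdKept d k m {a} ↔ k ≤ (a : ℕ) := by
  unfold ThresholdKept
  simp
  omega

theorem thresholdKept_of_card {d k m : ℕ} (hd : 2 ≤ d) {s : Finset (Fin n)} (hs : s.card = d) :
    ThresholdKept d k m s ↔ ∀ a ∈ s, (a : ℕ) < m := by
  unfold ThresholdKept
  simp only [hs, true_and]
  have : d ≠ 1 := by omega
  simp [this]

theorem thresholdKept_full {d : ℕ} {s : Finset (Fin n)} (hs : s.card = 1 ∨ s.card = d) :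
    ThresholdKept d 0 n s := by
  unfold ThresholdKept
  simpa using hs

/-- `#{σ : E σ}` as a real number. -/
noncomputable def permCount (E : Equiv.Perm (Fin n) → Prop) : ℝ :=
  open Classical in ∑ σ : Equiv.Perm (Fin n), if E σ then 1 else 0

theorem permCount_eq_card (E : Equiv.Perm (Fin n) → Prop) [DecidablePred E] :
    permCount E = (Finset.univ.filter E).card := by
  unfold permCount
  rw [← Finset.sum_boole]
  exact Finset.sum_congr rfl fun σ _ => by congr

theorem permCount_mono {E F : Equiv.Perm (Fin n) → Prop} (h : ∀ σ, E σ → F σ) :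
    permCount E ≤ permCount F := by
  classical
  unfold permCount
  refine Finset.sum_le_sum fun σ _ => ?_
  by_cases hE : E σ
  · simp [hE, h σ hE]
  · simp only [hE, if_false]; split_ifs <;> norm_num

theorem permCount_congr {E F : Equiv.Perm (Fin n) → Prop} (h : ∀ σ, E σ ↔ F σ) :
    permCount E = permCount F := by
  have : E = F := funext fun σ => propext (h σ)
  rw [this]

theorem permCount_swap (E : Finset (Fin n) → Finset (Fin n) → Prop) {s t : Finset (Fin n)}
    (h : s.card = t.card) :
    permCount (fun σ : Equiv.Perm (Fin n) => E (σ • s) (σ • t)) = permCount (fun σ : Equiv.Perm (Fin n) => E (σ • t) (σ • s)) := by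
  classical
  obtain ⟨τ, h1, h2⟩ := exists_perm_swap s t h
  unfold permCount
  refine Fintype.sum_equiv (Equiv.mulRight τ⁻¹) _ _ fun σ => ?_
  have e1 : τ⁻¹ • t = s := by rw [← h1, inv_smul_smul]
  have e2 : τ⁻¹ • s = t := by rw [← h2, inv_smul_smul]
  simp [mul_smul, e1, e2]

theorem permCount_add_of_disjoint {E F : Equiv.Perm (Fin n) → Prop} (h : ∀ σ, ¬ (E σ ∧ F σ)) :
    permCount E + permCount F = permCount fun σ : Equiv.Perm (Fin n) => E σ ∨ F σ := by
  classical
  unfold permCount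
  rw [← Finset.sum_add_distrib]
  refine Finset.sum_congr rfl fun σ _ => ?_
  have := h σ
  by_cases hE : E σ <;> by_cases hF : F σ <;> simp_all

theorem permCount_subset_mul (A U : Finset (Fin n)) :
    permCount (fun σ : Equiv.Perm (Fin n) => σ • U ⊆ A) * n.choose U.card = n.factorial * A.card.choose U.card := by
  classical
  rw [← card_perm_subset_mul]
  rw [permCount_eq_card]

theorem permCount_true : permCount (fun _ : Equiv.Perm (Fin n) => True) = n.factorial := by
  simp [permCount, Fintype.card_perm]

/-- A permutation exchanging `s` and `t` turns one order into the other, so each order has half of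
the cases in which both are kept. -/
theorem two_mul_permCount_thresholdLT {d k m : ℕ} {s t : Finset (Fin n)} (hst : s ≠ t)
    (h : s.card = t.card) :
    2 * permCount (fun σ : Equiv.Perm (Fin n) => ThresholdLT d k m (σ • s) (σ • t)) =
      permCount fun σ : Equiv.Perm (Fin n) => ThresholdKept d k m (σ • s) ∧ ThresholdKept d k m (σ • t) := by
  rw [two_mul]
  nth_rewrite 2 [permCount_swap (ThresholdLT d k m) h]
  rw [permCount_add_of_disjoint]
  · refine permCount_congr fun σ => ?_
    have : toColex (σ • s) ≠ toColex (σ • t) := by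
      rwa [Ne, toColex_inj, smul_left_cancel_iff]
    unfold ThresholdLT
    have h3 := lt_or_gt_of_ne this
    tauto
  · rintro σ ⟨h1, h2⟩
    exact lt_asymm h1.2.2 h2.2.2

theorem card_fin_ge (k : ℕ) : (Finset.univ.filter fun a : Fin n => k ≤ (a : ℕ)).card = n - k := by
  have h1 := Fin.card_filter_val_lt (n := n) (m := k)
  have h2 := Finset.card_filter_add_card_filter_not (s := (Finset.univ : Finset (Fin n)))
    (fun a => (a : ℕ) < k)
  simp only [not_lt, Finset.card_univ, Fintype.card_fin] at h2
  omega

theorem card_fin_lt (m : ℕ) (hm : m ≤ n) :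
    (Finset.univ.filter fun a : Fin n => (a : ℕ) < m).card = m := by
  have h1 := Fin.card_filter_val_lt (n := n) (m := m)
  omega

end ColexExtension

/-! ### Counting the relabellings that realize each kind of pair. -/

section FiniteUpper

open scoped Pointwise

variable {n : ℕ}

/-- The number of pairs (point in position `b ≥ k`, `d`-set inside the first `min b m`
positions). -/
def reversedCount (d k m n : ℕ) : ℕ :=
  ∑ b : Fin n, if k ≤ (b : ℕ) then (min (b : ℕ) m).choose d else 0

theorem card_powersetCard_lt (d j : ℕ) (hj : j ≤ n) :
    ((Finset.powersetCard d Finset.univ).filter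
      fun t : Finset (Fin n) => ∀ c ∈ t, (c : ℕ) < j).card = j.choose d := by
  have h := Finset.card_powersetCard d (Finset.univ.filter fun a : Fin n => (a : ℕ) < j)
  rw [card_fin_lt j hj] at h
  rw [← h]
  congr 1
  ext t
  simp only [Finset.mem_filter, Finset.mem_powersetCard, Finset.subset_univ, true_and]
  constructor
  · rintro ⟨h1, h2⟩
    exact ⟨fun c hc => by simpa using h2 c hc, h1⟩
  · rintro ⟨h1, h2⟩
    exact ⟨h2, fun c hc => by simpa using h1 hc⟩

theorem permCount_reversed_mul {d k m : ℕ} (hd : 2 ≤ d) {a : Fin n}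
    {s : Finset (Fin n)} (ha : a ∉ s) (hs : s.card = d) :
    permCount (fun σ : Equiv.Perm (Fin n) => ThresholdLT d k m (σ • s) (σ • {a})) *
      ((n - d : ℝ) * n.choose d) = n.factorial * reversedCount d k m n := by
  classical
  have := sum_perm_pair_mul d (fun b t => if ThresholdLT d k m t {b} then 1 else 0) ha hs
  unfold permCount
  simp only [Finset.smul_finset_singleton, Equiv.Perm.smul_def]
  rw [this]
  congr 1
  have e1 : ∀ t ∈ Finset.powersetCard d (Finset.univ : Finset (Fin n)),
      (∑ b ∈ tᶜ, if ThresholdLT d k m t {b} then (1 : ℝ) else 0) =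
        ∑ b : Fin n, if k ≤ (b : ℕ) ∧ ∀ c ∈ t, (c : ℕ) < min (b : ℕ) m then (1 : ℝ) else 0 := by
    intro t ht
    rw [Finset.mem_powersetCard] at ht
    rw [← Finset.sum_subset (Finset.subset_univ tᶜ)]
    · refine Finset.sum_congr rfl fun b hb => ?_
      congr 1
      unfold ThresholdLT
      rw [thresholdKept_singleton hd, thresholdKept_of_card hd ht.2,
        Finset.Colex.toColex_lt_singleton]
      apply propext
      simp only [lt_min_iff, forall_and, Fin.lt_def]
      tauto
    -- A point of `t` contributes nothing, since it does not come strictly after itself.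
    · intro b _ hb
      rw [if_neg]
      rintro ⟨_, h⟩
      have := h b (by simpa using hb)
      simp at this
  rw [Finset.sum_congr rfl e1, Finset.sum_comm]
  unfold reversedCount
  push_cast
  refine Finset.sum_congr rfl fun b _ => ?_
  by_cases hk : k ≤ (b : ℕ)
  · simp only [hk, true_and, if_true]
    rw [Finset.sum_boole, card_powersetCard_lt]
    exact (min_le_left _ _).trans b.2.le
  · simp [hk]

/-- The loss of `d` allows for kept points that lie inside the `d`-set. -/
theorem permCount_both_mul_ge {d k m : ℕ} (hd : 2 ≤ d) (hm : m ≤ n) {a : Fin n}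
    {s : Finset (Fin n)} (ha : a ∉ s) (hs : s.card = d) :
    (n.factorial : ℝ) * (m.choose d * (n - k - d)) ≤
    permCount (fun σ : Equiv.Perm (Fin n) =>
      ThresholdKept d k m (σ • s) ∧ ThresholdKept d k m (σ • {a})) *
      ((n - d : ℝ) * n.choose d) := by
  classical
  have := sum_perm_pair_mul d
    (fun b t => if ThresholdKept d k m t ∧ ThresholdKept d k m {b} then 1 else 0) ha hs
  unfold permCount
  simp only [Finset.smul_finset_singleton, Equiv.Perm.smul_def]
  rw [this]
  refine mul_le_mul_of_nonneg_left ?_ (Nat.cast_nonneg _)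
  rw [← card_powersetCard_lt d m hm, ← nsmul_eq_mul, ← Finset.sum_const, Finset.sum_filter]
  refine Finset.sum_le_sum fun t ht => ?_
  rw [Finset.mem_powersetCard] at ht
  simp only [thresholdKept_of_card hd ht.2, thresholdKept_singleton hd]
  by_cases h : ∀ c ∈ t, (c : ℕ) < m
  · rw [if_pos h]
    simp only [eq_true h, true_and]
    rw [Finset.sum_boole]
    have h1 : (Finset.univ.filter fun b : Fin n => k ≤ (b : ℕ)) \ t ⊆
        tᶜ.filter fun b : Fin n => k ≤ (b : ℕ) := by
      intro b hb
      simp at hb ⊢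
      tauto
    have h2 := Finset.card_le_card h1
    have h3 := Finset.le_card_sdiff t (Finset.univ.filter fun b : Fin n => k ≤ (b : ℕ))
    rw [card_fin_ge, ht.2] at h3
    have h4 : n ≤ (tᶜ.filter fun b : Fin n => k ≤ (b : ℕ)).card + k + d := by omega
    have h5 : (n : ℝ) ≤ (tᶜ.filter fun b : Fin n => k ≤ (b : ℕ)).card + k + d := by
      exact_mod_cast h4
    linarith
  · rw [if_neg h]
    exact Finset.sum_nonneg fun b _ => by split_ifs <;> norm_num

theorem permCount_forward_mul_ge {d k m : ℕ} (hd : 2 ≤ d) (hm : m ≤ n) {a : Fin n}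
    {s : Finset (Fin n)} (ha : a ∉ s) (hs : s.card = d) :
    (n.factorial : ℝ) * (m.choose d * (n - k - d) - reversedCount d k m n) ≤
    permCount (fun σ : Equiv.Perm (Fin n) => ThresholdLT d k m (σ • {a}) (σ • s)) *
      ((n - d : ℝ) * n.choose d) := by
  have h1 := permCount_both_mul_ge (k := k) hd hm ha hs
  have h2 := permCount_reversed_mul (k := k) (m := m) hd ha hs
  have h3 : permCount (fun σ : Equiv.Perm (Fin n) => ThresholdLT d k m (σ • {a}) (σ • s)) +
      permCount (fun σ : Equiv.Perm (Fin n) => ThresholdLT d k m (σ • s) (σ • {a})) =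
      permCount (fun σ : Equiv.Perm (Fin n) =>
      ThresholdKept d k m (σ • s) ∧ ThresholdKept d k m (σ • {a})) := by
    rw [permCount_add_of_disjoint]
    · refine permCount_congr fun σ => ?_
      have : toColex (σ • {a}) ≠ toColex (σ • s) := by
        rw [Ne, toColex_inj, smul_left_cancel_iff]
        rintro rfl
        simp at ha
      have h3 := lt_or_gt_of_ne this
      unfold ThresholdLT
      tauto
    · rintro σ ⟨h1, h2⟩
      exact lt_asymm h1.2.2 h2.2.2
  rw [← h3] at h1
  linarith

/-- The chance that `i` given elements land in an `m`-subset of an `n`-set decreases with `i`. -/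
theorem choose_mul_choose_le {m n i j : ℕ} (hmn : m ≤ n) (hij : i ≤ j) :
    m.choose j * n.choose i ≤ m.choose i * n.choose j := by
  by_cases hj : j ≤ m
  · have h1 := Nat.choose_mul (n := m) (k := j) (s := i) hij
    have h2 := Nat.choose_mul (n := n) (k := j) (s := i) hij
    have h3 : (m - i).choose (j - i) ≤ (n - i).choose (j - i) :=
      Nat.choose_le_choose _ (by omega)
    have h4 : 0 < j.choose i := Nat.choose_pos hij
    refine Nat.le_of_mul_le_mul_right ?_ h4
    calc m.choose j * n.choose i * j.choose i = (m.choose j * j.choose i) * n.choose i := by ring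
      _ = m.choose i * (m - i).choose (j - i) * n.choose i := by rw [h1]
      _ ≤ m.choose i * (n - i).choose (j - i) * n.choose i := by gcongr
      _ = m.choose i * (n.choose i * (n - i).choose (j - i)) := by ring
      _ = m.choose i * n.choose j * j.choose i := by rw [← h2]; ring
  · rw [Nat.choose_eq_zero_of_lt (by omega)]
    simp

theorem permCount_singletons_mul {k m d : ℕ} (hd : 2 ≤ d) {a b : Fin n} (hab : a ≠ b) :
    permCount (fun σ : Equiv.Perm (Fin n) => ThresholdKept d k m (σ • {a}) ∧
      ThresholdKept d k m (σ • {b})) * n.choose 2 = n.factorial * (n - k).choose 2 := by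
  have := permCount_subset_mul (Finset.univ.filter fun a : Fin n => k ≤ (a : ℕ)) {a, b}
  rw [card_fin_ge, Finset.card_pair hab] at this
  rw [← this]
  congr 1
  refine permCount_congr fun σ => ?_
  simp only [Finset.smul_finset_singleton, thresholdKept_singleton hd, Finset.smul_finset_insert,
    Finset.insert_subset_iff, Finset.singleton_subset_iff, Finset.mem_filter, Finset.mem_univ,
    true_and]

theorem permCount_sets_mul_ge {k m d : ℕ} (hd : 2 ≤ d) (hm : m ≤ n) (hn : 2 * d ≤ n)
    {s t : Finset (Fin n)} (hs : s.card = d) (ht : t.card = d) :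
    (n.factorial : ℝ) * m.choose (2 * d) ≤
    permCount (fun σ : Equiv.Perm (Fin n) => ThresholdKept d k m (σ • s) ∧
      ThresholdKept d k m (σ • t)) * n.choose (2 * d) := by
  have h1 := permCount_subset_mul (Finset.univ.filter fun a : Fin n => (a : ℕ) < m) (s ∪ t)
  rw [card_fin_lt m hm] at h1
  have h2 : permCount (fun σ : Equiv.Perm (Fin n) => ThresholdKept d k m (σ • s) ∧
      ThresholdKept d k m (σ • t)) = permCount fun σ : Equiv.Perm (Fin n) =>
        σ • (s ∪ t) ⊆ Finset.univ.filter fun a : Fin n => (a : ℕ) < m := by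
    refine permCount_congr fun σ => ?_
    rw [thresholdKept_of_card hd (by simpa using hs), thresholdKept_of_card hd (by simpa using ht),
      Finset.smul_finset_union, Finset.union_subset_iff]
    simp [Finset.subset_iff]
  rw [h2]
  -- Disjoint sets are the worst case: a larger union is less likely to fit into the first `m`
  -- positions.
  set c := (s ∪ t).card
  have hc : c ≤ 2 * d := by
    have := Finset.card_union_le s t
    omega
  have h3 : ((m.choose (2 * d) * n.choose c : ℕ) : ℝ) ≤ (m.choose c * n.choose (2 * d) : ℕ) :=
    Nat.cast_le.2 (choose_mul_choose_le hm hc)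
  push_cast at h3
  have h4 : (0 : ℝ) < n.choose c := by exact_mod_cast Nat.choose_pos (hc.trans hn)
  refine le_of_mul_le_mul_right ?_ h4
  calc _ = (n.factorial : ℝ) * (m.choose (2 * d) * n.choose c) := by ring
    _ ≤ (n.factorial : ℝ) * (m.choose c * n.choose (2 * d)) := by gcongr
    _ = (n.factorial * m.choose c) * n.choose (2 * d) := by ring
    _ = _ := by rw [← h1]; ring

theorem permCount_singleton_mul {k m d : ℕ} (hd : 2 ≤ d) (a : Fin n) :
    permCount (fun σ : Equiv.Perm (Fin n) => ThresholdKept d k m (σ • {a})) * n =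
      n.factorial * (n - k : ℕ) := by
  have := permCount_subset_mul (Finset.univ.filter fun a : Fin n => k ≤ (a : ℕ)) {a}
  rw [card_fin_ge, Finset.card_singleton, Nat.choose_one_right, Nat.choose_one_right] at this
  rw [← this]
  congr 1
  refine permCount_congr fun σ => ?_
  simp only [Finset.smul_finset_singleton, thresholdKept_singleton hd,
    Finset.singleton_subset_iff, Finset.mem_filter, Finset.mem_univ, true_and]

theorem permCount_set_mul {k m d : ℕ} (hd : 2 ≤ d) (hm : m ≤ n)
    {s : Finset (Fin n)} (hs : s.card = d) :
    permCount (fun σ : Equiv.Perm (Fin n) => ThresholdKept d k m (σ • s)) * n.choose d =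
      n.factorial * m.choose d := by
  have h1 := permCount_subset_mul (Finset.univ.filter fun a : Fin n => (a : ℕ) < m) s
  rw [card_fin_lt m hm, hs] at h1
  rw [← h1]
  congr 1
  refine permCount_congr fun σ => ?_
  rw [thresholdKept_of_card hd (by simpa using hs)]
  simp [Finset.subset_iff]

end FiniteUpper

/-! ### A realizer for finite n. -/

section FiniteRealizer

open scoped Pointwise

variable {n : ℕ}

theorem reversedCount_full (d n : ℕ) : reversedCount d 0 n n = n.choose (d + 1) := by
  unfold reversedCount
  simp only [zero_le, if_true]
  rw [Finset.sum_congr rfl (g := fun b : Fin n => (b : ℕ).choose d)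
    (fun b _ => by rw [min_eq_left b.2.le]), Fin.sum_univ_eq_sum_range (fun b => b.choose d) n]
  rcases n with _ | n
  · simp
  · rw [← Nat.sum_Icc_choose, Finset.range_eq_Ico]
    symm
    apply Finset.sum_subset
    · intro b hb
      simp at hb ⊢
      omega
    · intro b hb hb'
      simp at hb hb'
      exact Nat.choose_eq_zero_of_lt (by omega)

/-- Weight `W` is spread evenly over all relabelled threshold extensions and `V` over all relabelled
full ones (`k = 0`, `m = n`). By symmetry the four inequalities cover a `d`-set below a point, a
point below a `d`-set, two points, and two `d`-sets. -/
theorem exists_realizer_of_thresholds {d k m : ℕ} (hd : 2 ≤ d) (hdn : 2 * d ≤ n)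
    (hm : m ≤ n) {W V : ℝ} (hW : 0 ≤ W) (hV : 0 ≤ V)
    (hrev : (n - d : ℝ) * n.choose d ≤ W * reversedCount d k m n + V * n.choose (d + 1))
    (hfor : (n - d : ℝ) * n.choose d ≤
      W * (m.choose d * (n - k - d) - reversedCount d k m n) +
        V * ((n - d : ℝ) * n.choose d - n.choose (d + 1)))
    (hpt : 2 * (n.choose 2 : ℝ) ≤ W * (n - k).choose 2 + V * n.choose 2)
    (hset : 2 * (n.choose (2 * d) : ℝ) ≤ W * m.choose (2 * d) + V * n.choose (2 * d)) :
    ∃ w : PartialLinExt (SubsetPoset d n) → ℝ, IsFractionalLocalRealizer w ∧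
      posetMeasure w ≤ max (W * (n - k : ℕ) / n + V) (W * m.choose d / n.choose d + V) := by
  classical
  have hn0 : (0 : ℝ) < n := by exact_mod_cast (by omega : 0 < n)
  have hnd : (0 : ℝ) < n - d := by
    have : (d : ℝ) < n := by exact_mod_cast (by omega : d < n)
    linarith
  have hC : (0 : ℝ) < n.choose d := by exact_mod_cast Nat.choose_pos (by omega)
  have hf : (0 : ℝ) < n.factorial := by exact_mod_cast n.factorial_pos
  have : Nonempty (SubsetPoset d n) := ⟨⟨{⟨0, by omega⟩}, Or.inl (by simp)⟩⟩
  set Mf : Equiv.Perm (Fin n) ⊕ Equiv.Perm (Fin n) → PartialLinExt (SubsetPoset d n) :=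
    Sum.elim (fun σ => thresholdExt d k m σ) (fun σ => thresholdExt d 0 n σ) with hMf
  set c : Equiv.Perm (Fin n) ⊕ Equiv.Perm (Fin n) → ℝ :=
    Sum.elim (fun _ => W / n.factorial) (fun _ => V / n.factorial) with hc
  have hsum : ∀ E : PartialLinExt (SubsetPoset d n) → Prop,
      (∑ i, if E (Mf i) then c i else 0) =
        W / n.factorial * permCount (fun σ : Equiv.Perm (Fin n) => E (thresholdExt d k m σ)) +
        V / n.factorial * permCount (fun σ : Equiv.Perm (Fin n) => E (thresholdExt d 0 n σ)) := by
    intro E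
    rw [Fintype.sum_sum_type]
    simp only [hMf, hc, Sum.elim_inl, Sum.elim_inr]
    rw [permCount_eq_card, permCount_eq_card, ← Finset.sum_boole, ← Finset.sum_boole,
      Finset.mul_sum, Finset.mul_sum]
    simp only [mul_ite, mul_one, mul_zero]
  have hmono : ∀ E F : PartialLinExt (SubsetPoset d n) → Prop,
      (∀ k m (σ : Equiv.Perm (Fin n)), E (thresholdExt d k m σ) → F (thresholdExt d k m σ)) →
      (1 ≤ ∑ i, if E (Mf i) then c i else 0) → 1 ≤ ∑ i, if F (Mf i) then c i else 0 := by
    intro E F h h1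
    rw [hsum] at h1 ⊢
    refine h1.trans ?_
    gcongr
    · exact permCount_mono fun σ => h k m σ
    · exact permCount_mono fun σ => h 0 n σ
  have cover : ∀ x y X Y D : ℝ, 0 < D → n.factorial * X ≤ x * D → n.factorial * Y ≤ y * D →
      D ≤ W * X + V * Y → 1 ≤ W / n.factorial * x + V / n.factorial * y := by
    intro x y X Y D hD hx hy h
    rw [div_mul_eq_mul_div, div_mul_eq_mul_div, ← add_div, le_div_iff₀ hf, one_mul]
    refine le_of_mul_le_mul_right ?_ hD
    calc n.factorial * D ≤ n.factorial * (W * X + V * Y) := by gcongr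
      _ = W * (n.factorial * X) + V * (n.factorial * Y) := by ring
      _ ≤ W * (x * D) + V * (y * D) := by gcongr
      _ = _ := by ring
  have hsing : ∀ u : SubsetPoset d n, u.1.card = 1 → ∃ a, u.1 = {a} :=
    fun u hu => Finset.card_eq_one.1 hu
  -- reversed and forward non-incident pairs
  have cov_rev : ∀ u v : SubsetPoset d n, ∀ a, u.1 = {a} → v.1.card = d → a ∉ v.1 →
      1 ≤ ∑ i, if (Mf i).lt v u then c i else 0 := by
    intro u v a hu hv ha
    rw [hsum (fun M => M.lt v u)]
    simp only [thresholdExt_lt_iff, hu]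
    refine cover _ _ (reversedCount d k m n) (n.choose (d + 1)) _ (mul_pos hnd hC)
      (permCount_reversed_mul hd ha hv).ge ?_ hrev
    rw [← reversedCount_full]
    exact (permCount_reversed_mul hd ha hv).ge
  have cov_for : ∀ u v : SubsetPoset d n, ∀ a, u.1 = {a} → v.1.card = d → a ∉ v.1 →
      1 ≤ ∑ i, if (Mf i).lt u v then c i else 0 := by
    intro u v a hu hv ha
    rw [hsum (fun M => M.lt u v)]
    simp only [thresholdExt_lt_iff, hu]
    refine cover _ _ _ _ _ (mul_pos hnd hC)
      (permCount_forward_mul_ge hd hm ha hv) ?_ hfor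
    have := permCount_forward_mul_ge (k := 0) hd le_rfl ha hv
    rw [reversedCount_full] at this
    convert this using 3
    push_cast
    ring
  -- pairs of the same cardinality
  have cov_same : ∀ u v : SubsetPoset d n, u ≠ v → u.1.card = v.1.card →
      1 ≤ ∑ i, if (Mf i).lt u v then c i else 0 := by
    intro u v huv hcard
    have huv' : u.1 ≠ v.1 := fun h => huv (Subtype.ext h)
    rw [hsum (fun M => M.lt u v)]
    simp only [thresholdExt_lt_iff]
    have h1 := two_mul_permCount_thresholdLT (d := d) (k := k) (m := m) huv' hcard
    have h2 := two_mul_permCount_thresholdLT (d := d) (k := 0) (m := n) huv' hcard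
    have h3 : permCount (fun σ : Equiv.Perm (Fin n) => ThresholdKept d 0 n (σ • u.1) ∧
        ThresholdKept d 0 n (σ • v.1)) = n.factorial := by
      rw [← permCount_true]
      refine permCount_congr fun σ => iff_true_intro ⟨?_, ?_⟩ <;> apply thresholdKept_full
      · simpa using u.2
      · simpa using v.2
    rw [h3] at h2
    rcases u.2 with hu | hu
    · obtain ⟨a, ha⟩ := hsing u hu
      obtain ⟨b, hb⟩ := hsing v (hcard ▸ hu)
      have hab : a ≠ b := by
        rintro rfl
        exact huv' (ha.trans hb.symm)
      have h4 := permCount_singletons_mul (k := k) (m := m) hd hab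
      rw [← ha, ← hb, ← h1] at h4
      refine cover _ _ ((n - k).choose 2 : ℝ) (n.choose 2) (2 * n.choose 2) ?_ ?_ ?_ hpt
      · have : (0 : ℝ) < n.choose 2 := by exact_mod_cast Nat.choose_pos (by omega)
        positivity
      · rw [← h4]; exact le_of_eq (by ring)
      · rw [← h2]; exact le_of_eq (by ring)
    · have h4 := permCount_sets_mul_ge (k := k) hd hm hdn hu (hcard ▸ hu)
      rw [← h1] at h4
      refine cover _ _ (m.choose (2 * d) : ℝ) (n.choose (2 * d)) (2 * n.choose (2 * d)) ?_ ?_ ?_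
        hset
      · have : (0 : ℝ) < n.choose (2 * d) := by exact_mod_cast Nat.choose_pos (by omega)
        positivity
      · exact h4.trans (le_of_eq (by ring))
      · rw [← h2]; exact le_of_eq (by ring)
  have hcases : ∀ u v : SubsetPoset d n, ¬ u ≤ v → ¬ v ≤ u →
      1 ≤ ∑ i, if (Mf i).lt v u then c i else 0 := by
    intro u v huv hvu
    by_cases hcard : v.1.card = u.1.card
    · exact cov_same v u (by rintro rfl; exact huv le_rfl) hcard
    rcases u.2 with hu | hu <;> rcases v.2 with hv | hv
    · exact absurd (hv.trans hu.symm) hcard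
    · obtain ⟨a, ha⟩ := hsing u hu
      refine cov_rev u v a ha hv fun h => huv ?_
      rw [← Subtype.coe_le_coe, ha]
      simpa using h
    · obtain ⟨a, ha⟩ := hsing v hv
      refine cov_for v u a ha hu fun h => hvu ?_
      rw [← Subtype.coe_le_coe, ha]
      simpa using h
    · exact absurd (hv.trans hu.symm) hcard
  have hrefl : ∀ u : SubsetPoset d n, 1 ≤ ∑ i, if (Mf i).le u u then c i else 0 := by
    intro u
    -- An extension that orders `u` against an incomparable `v` contains `u`, so reflexive pairs
    -- inherit their cover.
    obtain ⟨v, h1, h2⟩ : ∃ v : SubsetPoset d n, ¬ u ≤ v ∧ ¬ v ≤ u := by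
      obtain ⟨t, ht1, ht2⟩ : ∃ t : Finset (Fin n), t.card = u.1.card ∧ t ≠ u.1 := by
        obtain ⟨a, ha⟩ : u.1.Nonempty := by
          rw [← Finset.card_pos]
          rcases u.2 with h | h <;> omega
        obtain ⟨b, hb⟩ : ∃ b, b ∉ u.1 := by
          by_contra hcon
          push Not at hcon
          have h1 := congrArg Finset.card (Finset.eq_univ_iff_forall.2 hcon)
          rw [Finset.card_univ, Fintype.card_fin] at h1
          rcases u.2 with h | h <;> omega
        refine ⟨insert b (u.1.erase a), ?_, fun h => hb (h ▸ Finset.mem_insert_self _ _)⟩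
        rw [Finset.card_insert_of_notMem fun h => hb (Finset.mem_of_mem_erase h)]
        exact Finset.card_erase_add_one ha
      refine ⟨⟨t, ht1 ▸ u.2⟩, fun h => ht2 ?_, fun h => ht2 ?_⟩
      · exact (Finset.eq_of_subset_of_card_le h ht1.le).symm
      · exact Finset.eq_of_subset_of_card_le h ht1.ge
    refine hmono (fun M => M.lt v u) (fun M => M.le u u) (fun k m σ h => ?_) (hcases u v h1 h2)
    exact PartialLinExt.le_refl _ _ (PartialLinExt.mem_of_le _ _ _ h.1).2
  refine exists_realizer_of_family c ?_ Mf _ ?_ ?_ ?_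
  · rintro (σ | σ) <;> simp only [hc, Sum.elim_inl, Sum.elim_inr] <;> positivity
  · intro u v huv
    by_cases huv' : u = v
    · subst huv'
      exact hrefl u
    have hss : u.1 ⊂ v.1 := lt_of_le_of_ne huv fun h => huv' (Subtype.ext h)
    have hlt := Finset.card_lt_card hss
    have hu : u.1.card = 1 := by
      rcases u.2 with hu | hu
      · exact hu
      · rcases v.2 with hv | hv <;> omega
    have hv : v.1.card = d := by
      rcases v.2 with hv | hv
      · omega
      · exact hv
    obtain ⟨a, ha⟩ := hsing u hu
    have hav : a ∈ v.1 := by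
      have := hss.1
      rw [ha] at this
      simpa using this
    obtain ⟨b, hb⟩ : ∃ b, b ∉ v.1 := by
      by_contra hcon
      push Not at hcon
      have : v.1 = Finset.univ := Finset.eq_univ_iff_forall.2 hcon
      rw [this, Finset.card_univ, Fintype.card_fin] at hv
      omega
    -- Exchanging `a` for an outside point gives a non-incident `t`. If `{a}` is below `t` in a
    -- threshold extension, some element of `t` is in a position at least that of `a`; hence `a` too
    -- lies in the first `m` positions and `v` is kept.
    set t : Finset (Fin n) := insert b (v.1.erase a) with ht
    have hbt : b ∉ v.1.erase a := fun h => hb (Finset.mem_of_mem_erase h)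
    have htc : t.card = d := by
      rw [ht, Finset.card_insert_of_notMem hbt, Finset.card_erase_of_mem hav, hv]
      omega
    have hat : a ∉ t := by
      rw [ht, Finset.mem_insert]
      rintro (rfl | h)
      · exact hb hav
      · simp at h
    refine hmono (fun M => M.lt u ⟨t, Or.inr htc⟩) (fun M => M.le u v) (fun k m σ h => ?_)
      (cov_for u ⟨t, Or.inr htc⟩ a ha htc hat)
    rw [thresholdExt_lt_iff] at h
    obtain ⟨h1, h2, h3⟩ := h
    refine PartialLinExt.extends_le _ _ h1 _ ?_ huv
    rw [mem_thresholdExt_iff, thresholdKept_of_card hd (by simpa using hv)]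
    rw [thresholdKept_of_card hd (by simpa using htc)] at h2
    simp only [ha, Finset.smul_finset_singleton] at h3
    obtain ⟨y, hy, hy'⟩ := Finset.Colex.singleton_le_toColex.1 h3.le
    intro x hx
    obtain ⟨z, hz, rfl⟩ := Finset.mem_smul_finset.1 hx
    by_cases hza : z = a
    · subst hza
      exact lt_of_le_of_lt (Fin.le_def.1 hy') (h2 y hy)
    · exact h2 _ (Finset.smul_mem_smul_finset (by simp [ht, hz, hza]))
  · exact hcases
  · intro u
    rw [hsum (fun M => u ∈ M.support)]
    simp only [mem_thresholdExt_iff]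
    have h3 : permCount (fun σ : Equiv.Perm (Fin n) => ThresholdKept d 0 n (σ • u.1)) =
        n.factorial := by
      rw [← permCount_true]
      exact permCount_congr fun σ => iff_true_intro (thresholdKept_full (by simpa using u.2))
    rw [h3, div_mul_cancel₀ _ hf.ne']
    rcases u.2 with hu | hu
    · refine le_max_of_le_left ?_
      obtain ⟨a, ha⟩ := hsing u hu
      rw [ha]
      have := permCount_singleton_mul (k := k) (m := m) hd a
      rw [← eq_div_iff hn0.ne'] at this
      rw [this]
      apply le_of_eq
      field_simp
    · refine le_max_of_le_right ?_
      have := permCount_set_mul (k := k) hd hm hu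
      rw [← eq_div_iff hC.ne'] at this
      rw [this]
      apply le_of_eq
      field_simp

end FiniteRealizer

/-! ### The upper bound in the limit. -/

section AsymptoticUpper

theorem sum_range_choose_right (d n : ℕ) : ∑ b ∈ Finset.range n, b.choose d = n.choose (d + 1) := by
  rw [← reversedCount_full, reversedCount, ← Fin.sum_univ_eq_sum_range (fun b => b.choose d) n]
  exact Finset.sum_congr rfl fun b _ => by rw [if_pos (Nat.zero_le _), min_eq_left b.2.le]

theorem reversedCount_eq {d k m n : ℕ} (hkm : k ≤ m) (hmn : m ≤ n) :
    (reversedCount d k m n : ℝ) =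
      m.choose (d + 1) - k.choose (d + 1) + (n - m) * m.choose d := by
  have h : reversedCount d k m n + k.choose (d + 1) = m.choose (d + 1) + (n - m) * m.choose d := by
    unfold reversedCount
    rw [Fin.sum_univ_eq_sum_range (fun b => if k ≤ b then (min b m).choose d else 0) n,
      ← Finset.sum_range_add_sum_Ico _ hmn, ← Finset.sum_range_add_sum_Ico _ hkm,
      ← sum_range_choose_right, ← sum_range_choose_right, ← Finset.sum_range_add_sum_Ico _ hkm]
    have e1 : ∑ b ∈ Finset.range k, (if k ≤ b then (min b m).choose d else 0) = 0 :=
      Finset.sum_eq_zero fun b hb => if_neg (by simpa using hb)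
    have e2 : ∑ b ∈ Finset.Ico k m, (if k ≤ b then (min b m).choose d else 0) =
        ∑ b ∈ Finset.Ico k m, b.choose d := Finset.sum_congr rfl fun b hb => by
      rw [Finset.mem_Ico] at hb
      rw [if_pos hb.1, min_eq_left hb.2.le]
    have e3 : ∑ b ∈ Finset.Ico m n, (if k ≤ b then (min b m).choose d else 0) =
        (n - m) * m.choose d := by
      rw [Finset.sum_congr rfl (g := fun _ => m.choose d)]
      · simp
      · intro b hb
        rw [Finset.mem_Ico] at hb
        rw [if_pos (hkm.trans hb.1), min_eq_right hb.1]
    rw [e1, e2, e3]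
    ring
  have h' : (reversedCount d k m n : ℝ) + k.choose (d + 1) =
      m.choose (d + 1) + ((n - m : ℕ) : ℝ) * m.choose d := by exact_mod_cast h
  rw [Nat.cast_sub hmn] at h'
  linarith

theorem tendsto_choose_div_pow {k : ℕ → ℕ} {t : ℝ}
    (hk : Tendsto (fun n : ℕ => (k n : ℝ) / n) atTop (𝓝 t)) (j : ℕ) :
    Tendsto (fun n : ℕ => ((k n).choose j : ℝ) / (n : ℝ) ^ j) atTop
      (𝓝 (t ^ j / j.factorial)) := by
  induction j with
  | zero => simp
  | succ j ih =>
    have h1 : Tendsto (fun n : ℕ => (k n : ℝ) / n - j / (n : ℝ)) atTop (𝓝 (t - 0)) :=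
      hk.sub (tendsto_const_div_atTop_nhds_zero_nat (j : ℝ))
    have h2 := (ih.mul h1).div_const ((j : ℝ) + 1)
    have e : t ^ j / j.factorial * (t - 0) / ((j : ℝ) + 1) = t ^ (j + 1) / (j + 1).factorial := by
      rw [Nat.factorial_succ]
      push_cast
      have : (0 : ℝ) < j.factorial := by exact_mod_cast j.factorial_pos
      field_simp
      ring
    rw [e] at h2
    refine h2.congr' ?_
    filter_upwards [eventually_gt_atTop 0] with n hn
    have hn' : (0 : ℝ) < n := by exact_mod_cast hn
    have h3 : ((k n).choose (j + 1) : ℝ) * (j + 1) = (k n).choose j * (k n - j) := by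
      by_cases hjk : j ≤ k n
      · have := Nat.choose_succ_right_eq (k n) j
        rw [← Nat.cast_sub hjk]
        exact_mod_cast this
      · rw [Nat.choose_eq_zero_of_lt (by omega : k n < j),
          Nat.choose_eq_zero_of_lt (by omega : k n < j + 1)]
        simp
    rw [eq_div_iff_mul_eq (by positivity)]
    have h4 : ((k n).choose (j + 1) : ℝ) = (k n).choose j * (k n - j) / (j + 1) := by
      rw [eq_div_iff (by positivity), h3]
    rw [h4, pow_succ]
    field_simp

theorem tendsto_floor_mul_div {t : ℝ} (ht : 0 ≤ t) :
    Tendsto (fun n : ℕ => (⌊t * n⌋₊ : ℝ) / n) atTop (𝓝 t) :=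
  (tendsto_nat_floor_mul_div_atTop ht).comp tendsto_natCast_atTop_atTop

theorem rpow_succ_div {d : ℕ} (hd : 0 < d) {x : ℝ} (hx : 0 ≤ x) :
    x ^ (((d : ℝ) + 1) / d) = x * x ^ ((1 : ℝ) / d) := by
  have hd' : (0 : ℝ) < d := by exact_mod_cast hd
  have : ((d : ℝ) + 1) / d = 1 + 1 / d := by field_simp
  rw [this, Real.rpow_add_of_nonneg hx zero_le_one (by positivity), Real.rpow_one]

theorem rFun_eq {d : ℕ} (hd : 0 < d) {x : ℝ} (hx : 0 ≤ x) :
    rFun d x = x - d / (d + 1) * (x * x ^ ((1 : ℝ) / d)) - (1 - x) ^ (d + 1) / (d + 1) := by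
  unfold rFun
  rw [rpow_succ_div hd hx]
  have : (0 : ℝ) < (d : ℝ) + 1 := by positivity
  field_simp

theorem rpow_one_div_pow {d : ℕ} (hd : 0 < d) {x : ℝ} (hx : 0 ≤ x) :
    (x ^ ((1 : ℝ) / d)) ^ d = x := by
  rw [one_div]
  exact Real.rpow_inv_natCast_pow hx hd.ne'

/-- The thresholds `k ≈ (1 - x) n` and `m ≈ x^(1/d) n` keep a proportion `x` of the points and of
the `d`-sets, and `rFun d x` is the limiting proportion of reversed pairs. The condition `hxs` puts
`k` before `m`. -/
theorem eventually_exists_realizer {d : ℕ} (hd : 2 ≤ d) {x W V c : ℝ} (hx0 : 0 ≤ x) (hx1 : x ≤ 1)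
    (hxs : 1 - x ≤ x ^ ((1 : ℝ) / d)) (hW : 0 ≤ W) (hV : 0 ≤ V)
    (h1 : W * rFun d x + V / (d + 1) = 1) (h2 : W * x ^ 2 + V = 2) (hc : W * x + V < c) :
    ∀ᶠ n : ℕ in atTop, ∃ w : PartialLinExt (SubsetPoset d n) → ℝ,
      IsFractionalLocalRealizer w ∧ posetMeasure w ≤ c := by
  set s : ℝ := x ^ ((1 : ℝ) / d) with hs
  have hs0 : 0 ≤ s := Real.rpow_nonneg hx0 _
  have hs1 : s ≤ 1 := Real.rpow_le_one hx0 hx1 (by positivity)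
  have hsd : s ^ d = x := rpow_one_div_pow (by omega) hx0
  have hr : rFun d x = s ^ d - d / (d + 1) * s ^ (d + 1) - (1 - x) ^ (d + 1) / (d + 1) := by
    rw [rFun_eq (by omega) hx0, pow_succ s, hsd]
  -- Scaling both weights by `1 + ε` makes the limiting inequalities strict, which absorbs the
  -- errors at finite `n`.
  obtain ⟨ε, hε, hεc⟩ : ∃ ε : ℝ, 0 < ε ∧ (1 + ε) * (W * x + V) < c := by
    have hL : 0 ≤ W * x + V := by positivity
    refine ⟨(c - (W * x + V)) / (2 * (W * x + V + 1)), by apply div_pos <;> linarith, ?_⟩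
    have h3 : (c - (W * x + V)) / (2 * (W * x + V + 1)) * (W * x + V) < c - (W * x + V) := by
      rw [div_mul_eq_mul_div, div_lt_iff₀ (by linarith)]
      nlinarith
    linarith
  have hW' : 0 ≤ (1 + ε) * W := by positivity
  have hV' : 0 ≤ (1 + ε) * V := by positivity
  have hd0 : (0 : ℝ) < d.factorial := by exact_mod_cast d.factorial_pos
  have hfac : ((d + 1).factorial : ℝ) = (d + 1) * d.factorial := by
    rw [Nat.factorial_succ]; push_cast; ring
  have hk : Tendsto (fun n : ℕ => (⌊(1 - x) * n⌋₊ : ℝ) / n) atTop (𝓝 (1 - x)) :=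
    tendsto_floor_mul_div (by linarith)
  have hm : Tendsto (fun n : ℕ => (⌊s * n⌋₊ : ℝ) / n) atTop (𝓝 s) := tendsto_floor_mul_div hs0
  have hn : Tendsto (fun n : ℕ => (n : ℝ) / n) atTop (𝓝 1) := by
    refine tendsto_const_nhds.congr' ?_
    filter_upwards [eventually_gt_atTop 0] with n hn
    rw [div_self (by exact_mod_cast hn.ne')]
  have hd' : Tendsto (fun n : ℕ => (d : ℝ) / n) atTop (𝓝 0) :=
    tendsto_const_div_atTop_nhds_zero_nat (d : ℝ)
  have hnk : Tendsto (fun n : ℕ => ((n - ⌊(1 - x) * n⌋₊ : ℕ) : ℝ) / n) atTop (𝓝 (1 - (1 - x))) := by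
    refine (hn.sub hk).congr fun n => ?_
    rw [Nat.cast_sub, sub_div]
    exact Nat.floor_le_of_le (by nlinarith [Nat.cast_nonneg (α := ℝ) n])
  have hkm : ∀ n : ℕ, ⌊(1 - x) * n⌋₊ ≤ ⌊s * n⌋₊ := fun n => Nat.floor_mono (by gcongr)
  have hmn : ∀ n : ℕ, ⌊s * n⌋₊ ≤ n := fun n =>
    Nat.floor_le_of_le (by nlinarith [Nat.cast_nonneg (α := ℝ) n])
  -- limits of the normalised counts
  have lN : Tendsto (fun n : ℕ => (n - d : ℝ) * n.choose d / (n : ℝ) ^ (d + 1)) atTop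
      (𝓝 (1 / d.factorial)) := by
    have := (hn.sub hd').mul (tendsto_choose_div_pow hn d)
    rw [one_pow, sub_zero, one_mul] at this
    refine this.congr fun n => ?_
    rw [pow_succ']
    field_simp
  have lrev : Tendsto (fun n : ℕ => (reversedCount d ⌊(1 - x) * n⌋₊ ⌊s * n⌋₊ n : ℝ) /
      (n : ℝ) ^ (d + 1)) atTop (𝓝 (rFun d x / d.factorial)) := by
    have := ((tendsto_choose_div_pow hm (d + 1)).sub (tendsto_choose_div_pow hk (d + 1))).add
      ((hn.sub hm).mul (tendsto_choose_div_pow hm d))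
    have e : s ^ (d + 1) / (d + 1).factorial - (1 - x) ^ (d + 1) / (d + 1).factorial +
        (1 - s) * (s ^ d / d.factorial) = rFun d x / d.factorial := by
      rw [hfac, hr]
      have : (0 : ℝ) < (d : ℝ) + 1 := by positivity
      field_simp
      ring
    rw [e] at this
    refine this.congr fun n => ?_
    rw [reversedCount_eq (hkm n) (hmn n), pow_succ']
    field_simp
  have lfull : Tendsto (fun n : ℕ => (n.choose (d + 1) : ℝ) / (n : ℝ) ^ (d + 1)) atTop
      (𝓝 (1 / (d + 1).factorial)) := by
    have := tendsto_choose_div_pow hn (d + 1)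
    rwa [one_pow] at this
  have lboth : Tendsto (fun n : ℕ => ((⌊s * n⌋₊.choose d : ℝ) * (n - ⌊(1 - x) * n⌋₊ - d)) /
      (n : ℝ) ^ (d + 1)) atTop (𝓝 (x ^ 2 / d.factorial)) := by
    have := (tendsto_choose_div_pow hm d).mul ((hn.sub hk).sub hd')
    rw [hsd] at this
    have e : x / d.factorial * (1 - (1 - x) - 0) = x ^ 2 / d.factorial := by ring
    rw [e] at this
    refine this.congr fun n => ?_
    rw [pow_succ]
    field_simp
  have e1 : (1 : ℝ) / d.factorial < (1 + ε) * W * (rFun d x / d.factorial) +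
      (1 + ε) * V * (1 / (d + 1).factorial) := by
    have : (1 + ε) * W * (rFun d x / d.factorial) + (1 + ε) * V * (1 / (d + 1).factorial) =
        (1 + ε) * (W * rFun d x + V / (d + 1)) / d.factorial := by
      rw [hfac]; field_simp
    rw [this, h1]
    gcongr
    linarith
  -- Pairs with the point below the `d`-set need no condition of their own: theirs is `h2` minus
  -- `h1`.
  have e2 : (1 : ℝ) / d.factorial < (1 + ε) * W * (x ^ 2 / d.factorial - rFun d x / d.factorial) +
      (1 + ε) * V * (1 / d.factorial - 1 / (d + 1).factorial) := by
    have : (1 + ε) * W * (x ^ 2 / d.factorial - rFun d x / d.factorial) +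
        (1 + ε) * V * (1 / d.factorial - 1 / (d + 1).factorial) =
        (1 + ε) * ((W * x ^ 2 + V) - (W * rFun d x + V / (d + 1))) / d.factorial := by
      rw [hfac]; field_simp; ring
    rw [this, h1, h2]
    gcongr
    linarith
  have ev1 := (lN.eventually_lt ((lrev.const_mul ((1 + ε) * W)).add
    (lfull.const_mul ((1 + ε) * V))) e1)
  have ev2 := (lN.eventually_lt (((lboth.sub lrev).const_mul ((1 + ε) * W)).add
    ((lN.sub lfull).const_mul ((1 + ε) * V))) e2)
  have ev3 := ((tendsto_choose_div_pow hn 2).const_mul 2).eventually_lt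
    (((tendsto_choose_div_pow hnk 2).const_mul ((1 + ε) * W)).add
      ((tendsto_choose_div_pow hn 2).const_mul ((1 + ε) * V))) (by
      have : (1 + ε) * W * ((1 - (1 - x)) ^ 2 / ((2 : ℕ).factorial : ℝ)) +
        (1 + ε) * V * (1 ^ 2 / ((2 : ℕ).factorial : ℝ)) = (1 + ε) * (W * x ^ 2 + V) / 2 := by
        norm_num [Nat.factorial]; ring
      rw [this, h2]
      norm_num [Nat.factorial]
      linarith)
  have ev4 := ((tendsto_choose_div_pow hn (2 * d)).const_mul 2).eventually_lt
    (((tendsto_choose_div_pow hm (2 * d)).const_mul ((1 + ε) * W)).add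
      ((tendsto_choose_div_pow hn (2 * d)).const_mul ((1 + ε) * V))) (by
      have hf : (0 : ℝ) < (2 * d).factorial := by exact_mod_cast (2 * d).factorial_pos
      have : (1 + ε) * W * (s ^ (2 * d) / ((2 * d).factorial : ℝ)) +
        (1 + ε) * V * (1 ^ (2 * d) / ((2 * d).factorial : ℝ)) =
          (1 + ε) * (W * x ^ 2 + V) / (2 * d).factorial := by
        rw [mul_comm 2 d, pow_mul, hsd]; ring
      rw [this, h2, one_pow, ← mul_div_assoc]
      exact div_lt_div_of_pos_right (by linarith) hf)
  have ev5 := ((hnk.const_mul ((1 + ε) * W)).add_const ((1 + ε) * V)).eventually_lt_const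
    (u := c) (by linarith)
  have lq : Tendsto (fun n : ℕ => (⌊s * n⌋₊.choose d : ℝ) / n.choose d) atTop (𝓝 x) := by
    have := (tendsto_choose_div_pow hm d).div (tendsto_choose_div_pow hn d) (by
      rw [one_pow]; positivity)
    rw [hsd] at this
    have e : x / d.factorial / (1 ^ d / d.factorial) = x := by
      rw [one_pow]; field_simp
    rw [e] at this
    refine this.congr' ?_
    filter_upwards [eventually_gt_atTop 0] with n hn
    have hn' : (0 : ℝ) < n := by exact_mod_cast hn
    exact div_div_div_cancel_right₀ (by positivity) _ _
  have ev6 := ((lq.const_mul ((1 + ε) * W)).add_const ((1 + ε) * V)).eventually_lt_const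
    (u := c) (by linarith)
  filter_upwards [ev1, ev2, ev3, ev4, ev5, ev6, eventually_ge_atTop (2 * d)] with
    n h1 h2 h3 h4 h5 h6 hnd
  have hn0 : (0 : ℝ) < n := by exact_mod_cast (by omega : 0 < n)
  have clear : ∀ (j : ℕ) (a b : ℝ), a / (n : ℝ) ^ j < b / (n : ℝ) ^ j → a ≤ b := fun j a b h =>
    ((div_lt_div_iff_of_pos_right (by positivity)).1 h).le
  obtain ⟨w, hw, hwm⟩ := exists_realizer_of_thresholds (k := ⌊(1 - x) * n⌋₊) (m := ⌊s * n⌋₊) hd hnd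
    (hmn n) hW' hV' (clear (d + 1) _ _ (h1.trans_eq (by ring)))
    (clear (d + 1) _ _ (h2.trans_eq (by ring)))
    (clear 2 _ _ (lt_of_eq_of_lt (by ring) (h3.trans_eq (by ring))))
    (clear (2 * d) _ _ (lt_of_eq_of_lt (by ring) (h4.trans_eq (by ring))))
  refine ⟨w, hw, hwm.trans (max_le ?_ ?_)⟩
  · rw [mul_div_assoc]; exact h5.le
  · rw [mul_div_assoc]; exact h6.le

end AsymptoticUpper

/-! ### Second moments of a realizer. -/

section WeightSums

variable {α : Type*} [PartialOrder α] [Finite α]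

/-- The indicator of a proposition, as a real number. -/
noncomputable def indReal (p : Prop) : ℝ := open Classical in if p then 1 else 0

theorem indReal_nonneg (p : Prop) : 0 ≤ indReal p := by
  unfold indReal; split_ifs <;> norm_num

theorem weightSum_eq_sum (w : PartialLinExt α → ℝ) (p : PartialLinExt α → Prop) :
    weightSum w p = ∑ M, w M * indReal (p M) := by
  classical
  unfold weightSum indReal
  rw [Finset.sum_filter]
  refine Finset.sum_congr rfl fun M _ => ?_
  by_cases h : p M <;> simp [h]

theorem sum_weightSum {ι : Type*} (s : Finset ι) (w : PartialLinExt α → ℝ)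
    (p : ι → PartialLinExt α → Prop) :
    ∑ i ∈ s, weightSum w (p i) = ∑ M, w M * ∑ i ∈ s, indReal (p i M) := by
  simp_rw [weightSum_eq_sum, Finset.mul_sum]
  exact Finset.sum_comm

/-- Two members of an antichain must appear in both orders, so the extensions containing both have
total weight at least 2. Summing over ordered pairs is bounded by the square of the count. -/
theorem sum_sq_weight_ge {w : PartialLinExt α → ℝ} (hw : IsFractionalLocalRealizer w)
    {ι : Type*} [Fintype ι] (e : ι → α) (he : ∀ i j, i ≠ j → ¬ e i ≤ e j) :
    2 * ((Fintype.card ι : ℝ) * (Fintype.card ι - 1)) ≤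
      ∑ M, w M * (∑ i, indReal (e i ∈ M.support)) ^ 2 := by
  classical
  have h1 : ∀ i j, i ≠ j →
      2 ≤ weightSum w (fun M => e i ∈ M.support ∧ e j ∈ M.support) := by
    intro i j hij
    have h2 := hw.2.2 (e i) (e j) (he i j hij) (he j i hij.symm)
    have h3 := hw.2.2 (e j) (e i) (he j i hij.symm) (he i j hij)
    rw [weightSum_eq_sum] at h2 h3 ⊢
    have : (2 : ℝ) = 1 + 1 := by norm_num
    rw [this]
    refine (add_le_add h2 h3).trans ?_
    rw [← Finset.sum_add_distrib]
    refine Finset.sum_le_sum fun M _ => ?_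
    rw [← mul_add]
    refine mul_le_mul_of_nonneg_left ?_ (hw.1 M).1
    have hdis : M.lt (e j) (e i) → M.lt (e i) (e j) → False := fun h h' =>
      h.2 (M.le_antisymm _ _ h.1 h'.1)
    have ha : M.lt (e j) (e i) → e i ∈ M.support ∧ e j ∈ M.support := fun h =>
      (M.mem_of_le _ _ h.1).symm
    have hb : M.lt (e i) (e j) → e i ∈ M.support ∧ e j ∈ M.support := fun h =>
      M.mem_of_le _ _ h.1
    unfold indReal
    by_cases h : M.lt (e j) (e i) <;> by_cases h' : M.lt (e i) (e j)
    · exact (hdis h h').elim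
    · rw [if_pos h, if_neg h', if_pos (ha h)]; norm_num
    · rw [if_neg h, if_pos h', if_pos (hb h')]; norm_num
    · rw [if_neg h, if_neg h']; split_ifs <;> norm_num
  have h2 : ∑ x ∈ (Finset.univ : Finset ι).offDiag,
      weightSum w (fun M => e x.1 ∈ M.support ∧ e x.2 ∈ M.support) ≤
      ∑ M, w M * (∑ i, indReal (e i ∈ M.support)) ^ 2 := by
    rw [sum_weightSum _ w fun (x : ι × ι) M => e x.1 ∈ M.support ∧ e x.2 ∈ M.support]
    refine Finset.sum_le_sum fun M _ => mul_le_mul_of_nonneg_left ?_ (hw.1 M).1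
    rw [sq, Fintype.sum_mul_sum, ← Fintype.sum_prod_type']
    refine (Finset.sum_le_sum_of_subset_of_nonneg (Finset.subset_univ _)
      fun _ _ _ => indReal_nonneg _).trans (Finset.sum_le_sum fun x _ => ?_)
    unfold indReal
    by_cases h : e x.1 ∈ M.support <;> by_cases h' : e x.2 ∈ M.support <;> simp [h, h']
  refine le_trans ?_ h2
  have h3 := Finset.card_nsmul_le_sum (Finset.univ : Finset ι).offDiag
    (fun x => weightSum w (fun M => e x.1 ∈ M.support ∧ e x.2 ∈ M.support)) 2
    (fun x hx => h1 _ _ (Finset.mem_offDiag.1 hx).2.2)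
  refine le_trans (le_of_eq ?_) h3
  rw [Finset.offDiag_card, Finset.card_univ, nsmul_eq_mul, Nat.cast_sub]
  · push_cast; ring
  · exact Nat.le_mul_self _

end WeightSums

/-! ### Bounding the reversed pairs of one extension. -/

section RankBound

/-- Induction on `d`: the new factor satisfies (m - d)/(n - d) ≤ m/n. -/
theorem choose_mul_pow_le {m n : ℕ} (h : m ≤ n) (d : ℕ) :
    (m.choose d : ℝ) * n ^ d ≤ m ^ d * n.choose d := by
  induction d with
  | zero => simp
  | succ d ih =>
    have key : ∀ k : ℕ, (k.choose (d + 1) : ℝ) * (d + 1) = k.choose d * (k - d : ℕ) := fun k => by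
      exact_mod_cast Nat.choose_succ_right_eq k d
    have h1 : ((m - d : ℕ) : ℝ) * n ≤ m * (n - d : ℕ) := by
      rcases le_total m d with hmd | hmd
      · rw [Nat.sub_eq_zero_of_le hmd]; simp; positivity
      · rw [Nat.cast_sub hmd, Nat.cast_sub (hmd.trans h)]
        have : (m : ℝ) ≤ n := by exact_mod_cast h
        nlinarith [Nat.cast_nonneg (α := ℝ) d]
    have hd : (0 : ℝ) < d + 1 := by positivity
    refine le_of_mul_le_mul_right ?_ hd
    calc (m.choose (d + 1) : ℝ) * n ^ (d + 1) * (d + 1)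
        = (m.choose d * n ^ d) * ((m - d : ℕ) * n) := by rw [pow_succ]; linear_combination (n ^ d * n : ℝ) * key m
      _ ≤ (m ^ d * n.choose d) * (m * (n - d : ℕ)) := by gcongr
      _ = m ^ (d + 1) * n.choose (d + 1) * (d + 1) := by
        rw [pow_succ]; linear_combination -(m ^ d * m : ℝ) * key n

variable {d n : ℕ}

/-- A point of `Fin n` as an element of the poset. -/
def ptElem (d : ℕ) (a : Fin n) : SubsetPoset d n := ⟨{a}, Or.inl (by simp)⟩

/-- A `d`-set as an element of the poset. -/
def setElem (t : {t : Finset (Fin n) // t.card = d}) : SubsetPoset d n := ⟨t.1, Or.inr t.2⟩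

theorem ptElem_le_setElem {a : Fin n} {t : {t : Finset (Fin n) // t.card = d}} :
    ptElem d a ≤ setElem t ↔ a ∈ t.1 := by
  rw [← Subtype.coe_le_coe]
  simp [ptElem, setElem]

theorem card_sets : Fintype.card {t : Finset (Fin n) // t.card = d} = n.choose d := by
  rw [Fintype.card_finset_len, Fintype.card_fin]

/-- The number of points of `M`. -/
noncomputable def ptCount (M : PartialLinExt (SubsetPoset d n)) : ℕ :=
  open Classical in (Finset.univ.filter fun a : Fin n => ptElem d a ∈ M.support).card

/-- The number of `d`-sets of `M`. -/
noncomputable def setCount (M : PartialLinExt (SubsetPoset d n)) : ℕ :=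
  open Classical in (Finset.univ.filter
    fun t : {t : Finset (Fin n) // t.card = d} => setElem t ∈ M.support).card

/-- The number of pairs (`d`-set, point) with the `d`-set below the point in `M`. -/
noncomputable def revCount (M : PartialLinExt (SubsetPoset d n)) : ℕ :=
  open Classical in ∑ a : Fin n, (Finset.univ.filter
    fun t : {t : Finset (Fin n) // t.card = d} => M.lt (setElem t) (ptElem d a)).card

theorem sum_rank_eq {α : Type*} [DecidableEq α] (S : Finset α) (rank : α → ℕ)
    (hinj : Set.InjOn rank S) (hrank : ∀ a ∈ S, 1 ≤ rank a ∧ rank a ≤ S.card) (f : ℕ → ℝ) :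
    ∑ a ∈ S, f (rank a) = ∑ i ∈ Finset.range S.card, f (i + 1) := by
  have himg : S.image rank = Finset.Icc 1 S.card := by
    apply Finset.eq_of_subset_of_card_le
    · intro i hi
      obtain ⟨a, ha, rfl⟩ := Finset.mem_image.1 hi
      exact Finset.mem_Icc.2 (hrank a ha)
    · rw [Finset.card_image_of_injOn hinj]; simp
  rw [← Finset.sum_image hinj, himg, Finset.range_eq_Ico, Finset.sum_Ico_add' f 0 S.card 1]
  rfl

/-- Points are ranked from the top of `M`. A `d`-set below `a` contains no point of `M` at or above
`a`, since it would then lie above that point; so it avoids as many points as the rank of `a`. -/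
theorem revCount_le_sum (M : PartialLinExt (SubsetPoset d n)) :
    (revCount M : ℝ) ≤ ∑ i ∈ Finset.range (ptCount M),
      min (setCount M : ℝ) ((n - (i + 1)).choose d : ℝ) := by
  classical
  set S : Finset (Fin n) := Finset.univ.filter fun a : Fin n => ptElem d a ∈ M.support with hS
  have hPS : ptCount M = S.card := by rw [hS]; unfold ptCount; congr
  set up : Fin n → Finset (Fin n) := fun a => S.filter fun b => M.le (ptElem d a) (ptElem d b)
    with hup
  set rank : Fin n → ℕ := fun a => (up a).card with hrank
  have hmemS : ∀ a, a ∈ S ↔ ptElem d a ∈ M.support := fun a => by simp [hS]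
  have hinj' : Function.Injective (ptElem d (n := n)) := fun a b h => by
    simpa [ptElem] using h
  have hstrict : ∀ a ∈ S, ∀ b ∈ S, a ≠ b → M.le (ptElem d a) (ptElem d b) → rank b < rank a := by
    intro a ha b hb hab h
    apply Finset.card_lt_card
    refine ⟨fun c hc => ?_, fun hsub => ?_⟩
    · simp only [hup, Finset.mem_filter] at hc ⊢
      exact ⟨hc.1, M.le_trans _ _ _ h hc.2⟩
    · have : a ∈ up b := hsub (by simp [hup, ha, M.le_refl _ ((hmemS a).1 ha)])
      simp only [hup, Finset.mem_filter] at this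
      exact hab (hinj' (M.le_antisymm _ _ h this.2))
  have hinj : Set.InjOn rank S := by
    intro a ha b hb hab
    by_contra hne
    rcases M.le_total _ ((hmemS a).1 ha) _ ((hmemS b).1 hb) with h | h
    · exact absurd hab (hstrict a ha b hb hne h).ne'
    · exact absurd hab (hstrict b hb a ha (Ne.symm hne) h).ne
  have hR : ∀ a ∈ S, 1 ≤ rank a ∧ rank a ≤ S.card := by
    intro a ha
    refine ⟨Finset.card_pos.2 ⟨a, ?_⟩, Finset.card_le_card (Finset.filter_subset _ _)⟩
    simp [hup, ha, M.le_refl _ ((hmemS a).1 ha)]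
  rw [hPS, ← sum_rank_eq S rank hinj hR
    (fun i => min (setCount M : ℝ) ((n - i).choose d : ℝ))]
  unfold revCount
  push_cast
  rw [← Finset.sum_subset (Finset.subset_univ S)]
  · refine Finset.sum_le_sum fun a ha => le_min ?_ ?_
    · unfold setCount
      refine Nat.cast_le.2 (Finset.card_le_card fun t ht => ?_)
      rw [Finset.mem_filter] at ht ⊢
      exact ⟨Finset.mem_univ _, (M.mem_of_le _ _ ht.2.1).1⟩
    · rw [Nat.cast_le]
      have hc : (up a)ᶜ.card = n - rank a := by simp [Finset.card_compl, hrank]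
      rw [← hc, ← Finset.card_powersetCard, ← Finset.card_map (Function.Embedding.subtype _)]
      refine Finset.card_le_card fun t ht => ?_
      obtain ⟨t, ht', rfl⟩ := Finset.mem_map.1 ht
      replace ht := (Finset.mem_filter.1 ht').2
      rw [Finset.mem_powersetCard]
      refine ⟨fun b hb => ?_, t.2⟩
      rw [Finset.mem_compl]
      intro hbu
      simp only [hup, Finset.mem_filter] at hbu
      have h1 := M.extends_le _ ((hmemS b).1 hbu.1) _ (M.mem_of_le _ _ ht.1).1
        (ptElem_le_setElem.2 hb)
      exact ht.2 (M.le_antisymm _ _ ht.1 (M.le_trans _ _ _ hbu.2 h1))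
  · intro a _ ha
    rw [Nat.cast_eq_zero, Finset.card_eq_zero, Finset.filter_eq_empty_iff]
    intro t _ ht
    exact ha ((hmemS a).2 (M.mem_of_le _ _ ht.1).2)

theorem sum_indReal_ptElem (M : PartialLinExt (SubsetPoset d n)) :
    ∑ a : Fin n, indReal (ptElem d a ∈ M.support) = ptCount M := by
  classical
  unfold indReal ptCount
  rw [Finset.sum_boole]

theorem sum_indReal_setElem (M : PartialLinExt (SubsetPoset d n)) :
    ∑ t : {t : Finset (Fin n) // t.card = d}, indReal (setElem t ∈ M.support) = setCount M := by
  classical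
  unfold indReal setCount
  rw [Finset.sum_boole]

theorem ptCount_le (M : PartialLinExt (SubsetPoset d n)) : ptCount M ≤ n := by
  unfold ptCount
  exact (Finset.card_le_univ _).trans_eq (by simp)

theorem setCount_le (M : PartialLinExt (SubsetPoset d n)) : setCount M ≤ n.choose d := by
  unfold setCount
  exact (Finset.card_le_univ _).trans_eq card_sets

end RankBound

/-! ### Weak duality for finite n. -/

section FiniteLower

/-- An upper bound for the proportion of reversed pairs in a partial linear extension with a
proportion `p` of the points and a proportion `q` of the `d`-sets. -/
theorem sum_min_le_integral_bound {d : ℕ} (hd : 0 < d) {n P : ℕ} (hn : 0 < n) (hP : P ≤ n)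
    {q : ℝ} (hq0 : 0 ≤ q) (hq1 : q ≤ 1) (hpq : (1 - (P : ℝ) / n) ^ d ≤ q) :
    (∑ i ∈ Finset.range P, min q ((1 - ((i + 1 : ℕ) : ℝ) / n) ^ d)) / n ≤
      q - d / (d + 1) * (q * q ^ ((1 : ℝ) / d)) - (1 - (P : ℝ) / n) ^ (d + 1) / (d + 1) := by
  have hn' : (0 : ℝ) < n := by exact_mod_cast hn
  have hP' : (P : ℝ) ≤ n := by exact_mod_cast hP
  set s : ℝ := q ^ ((1 : ℝ) / d) with hs
  have hs0 : 0 ≤ s := Real.rpow_nonneg hq0 _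
  have hs1 : s ≤ 1 := Real.rpow_le_one hq0 hq1 (by positivity)
  have hsd : s ^ d = q := rpow_one_div_pow hd hq0
  set p : ℝ := (P : ℝ) / n with hp
  have hp1 : p ≤ 1 := by rw [hp, div_le_one hn']; exact hP'
  have hps : 1 - p ≤ s := by
    refine le_of_pow_le_pow_left₀ hd.ne' hs0 ?_
    rw [hsd]; exact hpq
  set f : ℝ → ℝ := fun t => min q ((1 - t / n) ^ d) with hf
  have hfc : Continuous f := by fun_prop
  -- The summand decreases, so the sum over right endpoints is at most the integral.
  have hanti : AntitoneOn f (Icc (0 : ℝ) (0 + P)) := by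
    intro x hx y hy hxy
    have hy1 : y / n ≤ 1 := by
      rw [div_le_one hn']; rw [zero_add] at hy; exact hy.2.trans hP'
    simp only [hf]
    have : x / n ≤ y / n := by gcongr
    gcongr
  have h1 := hanti.sum_le_integral
  simp only [zero_add] at h1
  have hun0 : 0 ≤ (1 - s) * n := by
    have : 0 ≤ 1 - s := by linarith
    positivity
  have hunP : (1 - s) * n ≤ P := by
    have : P = p * n := by rw [hp]; field_simp
    rw [this]; gcongr; linarith
  have h2 : ∫ t in (0 : ℝ)..P, f t ≤ (1 - s) * n * q +
      n * ((s ^ (d + 1) - (1 - p) ^ (d + 1)) / (d + 1)) := by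
    -- The two terms of the minimum cross at `(1 - s) * n`, which `hpq` places before `P`.
    rw [← intervalIntegral.integral_add_adjacent_intervals (b := (1 - s) * n)
      (hfc.intervalIntegrable _ _) (hfc.intervalIntegrable _ _)]
    have i1 : ∫ t in (0 : ℝ)..(1 - s) * n, f t ≤ ∫ t in (0 : ℝ)..(1 - s) * n, q :=
      intervalIntegral.integral_mono hun0 (hfc.intervalIntegrable _ _)
        (by simp) fun t => min_le_left _ _
    have i2 : ∫ t in (1 - s) * n..P, f t ≤ ∫ t in (1 - s) * n..P, (1 - t / n) ^ d :=
      intervalIntegral.integral_mono hunP (hfc.intervalIntegrable _ _)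
        (Continuous.intervalIntegrable (by fun_prop) _ _) fun t => min_le_right _ _
    have i3 : ∫ t in (1 - s) * n..P, (1 - t / n) ^ d =
        n * ((s ^ (d + 1) - (1 - p) ^ (d + 1)) / (d + 1)) := by
      have hder : ∀ t : ℝ, HasDerivAt (fun t : ℝ => -(n * (1 - t / n) ^ (d + 1) / (d + 1)))
          ((1 - t / n) ^ d) t := by
        intro t
        have h := (((((hasDerivAt_id t).div_const (n : ℝ)).const_sub 1).pow (d + 1)).const_mul
          (n : ℝ)).div_const ((d : ℝ) + 1) |>.neg
        refine HasDerivAt.congr_deriv h ?_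
        have : (0 : ℝ) < (d : ℝ) + 1 := by positivity
        rw [Nat.add_sub_cancel]
        push_cast
        field_simp
        simp
      rw [intervalIntegral.integral_eq_sub_of_hasDerivAt (fun t _ => hder t)
        (Continuous.intervalIntegrable (by fun_prop) _ _)]
      have e1 : 1 - (1 - s) * n / (n : ℝ) = s := by field_simp; ring
      rw [e1]
      ring
    rw [intervalIntegral.integral_const, smul_eq_mul, sub_zero] at i1
    linarith
  rw [div_le_iff₀ hn']
  refine (h1.trans h2).trans (le_of_eq ?_)
  rw [pow_succ s, hsd]
  have : (0 : ℝ) < (d : ℝ) + 1 := by positivity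
  field_simp
  ring

theorem revCount_div_le_mul {d n : ℕ} (hd : 0 < d) (hdn : d < n)
    (M : PartialLinExt (SubsetPoset d n)) :
    (revCount M : ℝ) / (n * n.choose d) ≤ (ptCount M : ℝ) / n * (setCount M / n.choose d) := by
  have hn : (0 : ℝ) < n := by exact_mod_cast (by omega : 0 < n)
  have hC : (0 : ℝ) < n.choose d := by exact_mod_cast Nat.choose_pos hdn.le
  rw [div_mul_div_comm]
  gcongr
  refine (revCount_le_sum M).trans ?_
  refine (Finset.sum_le_sum fun i _ => min_le_left _ _).trans ?_
  simp

theorem revCount_div_le {d n : ℕ} (hd : 0 < d) (hdn : d < n)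
    (M : PartialLinExt (SubsetPoset d n)) {p q : ℝ} (hp : p = (ptCount M : ℝ) / n)
    (hq : q = (setCount M : ℝ) / n.choose d) (hpq : (1 - p) ^ d ≤ q) :
    (revCount M : ℝ) / (n * n.choose d) ≤
      q - d / (d + 1) * (q * q ^ ((1 : ℝ) / d)) - (1 - p) ^ (d + 1) / (d + 1) := by
  have hn : (0 : ℝ) < n := by exact_mod_cast (by omega : 0 < n)
  have hC : (0 : ℝ) < n.choose d := by exact_mod_cast Nat.choose_pos hdn.le
  have hq0 : 0 ≤ q := by rw [hq]; positivity
  have hq1 : q ≤ 1 := by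
    rw [hq, div_le_one hC]; exact_mod_cast setCount_le M
  subst hp
  refine le_trans ?_ (sum_min_le_integral_bound hd (by omega) (ptCount_le M) hq0 hq1 hpq)
  rw [mul_comm, ← div_div]
  gcongr
  rw [div_le_iff₀ hC, Finset.sum_mul]
  refine (revCount_le_sum M).trans (Finset.sum_le_sum fun i hi => ?_)
  rw [min_mul_of_nonneg _ _ hC.le, hq, div_mul_cancel₀ _ hC.ne']
  refine min_le_min le_rfl ?_
  have hin : i + 1 ≤ n := (Finset.mem_range.1 hi).trans_le (ptCount_le M)
  have h := choose_mul_pow_le (Nat.sub_le n (i + 1)) d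
  rw [← le_div_iff₀ (by positivity)] at h
  refine h.trans (le_of_eq ?_)
  rw [Nat.cast_sub hin, mul_div_right_comm, ← div_pow, sub_div, div_self hn.ne']

/-- Lets the error 1 / `n.choose d` from pairs of `d`-sets be absorbed into d / n. -/
theorem le_choose_of_lt {n d : ℕ} (hd : 0 < d) (hdn : d < n) : n ≤ n.choose d := by
  induction n generalizing d with
  | zero => omega
  | succ n ih =>
    rcases Nat.lt_succ_iff_lt_or_eq.1 hdn with h | rfl
    · obtain ⟨e, rfl⟩ : ∃ e, d = e + 1 := ⟨d - 1, by omega⟩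
      rw [Nat.choose_succ_succ']
      have h1 := ih hd h
      have h2 : 0 < n.choose e := Nat.choose_pos (by omega)
      omega
    · simp

/-- Applying `hdual` to the statistics of each extension and summing with weights `w` plays the
covering constraints against the measure. The factor 1 - d/n accounts for incident pairs and for the
diagonal terms of the squares. -/
theorem le_posetMeasure_of_dual {d n : ℕ} (hd : 2 ≤ d) (hdn : d < n) {l a b α α' : ℝ}
    (hl : 0 ≤ l) (ha : 0 ≤ a) (hb : 0 ≤ b) (hα : 0 ≤ α) (hα' : 0 ≤ α') (hαα : α + α' = 1)
    (hdual : ∀ p q ρ : ℝ, 0 ≤ p → p ≤ 1 → 0 ≤ q → q ≤ 1 → ρ ≤ p * q →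
      ((1 - p) ^ d ≤ q →
        ρ ≤ q - d / (d + 1) * (q * q ^ ((1 : ℝ) / d)) - (1 - p) ^ (d + 1) / (d + 1)) →
      l * ρ + a / 2 * p ^ 2 + b / 2 * q ^ 2 ≤ α * p + α' * q)
    {w : PartialLinExt (SubsetPoset d n) → ℝ} (hw : IsFractionalLocalRealizer w) :
    (1 - (d : ℝ) / n) * (l + a + b) ≤ posetMeasure w := by
  classical
  have hn : (0 : ℝ) < n := by exact_mod_cast (by omega : 0 < n)
  have hCn : n ≤ n.choose d := le_choose_of_lt (by omega) hdn
  have hC : (0 : ℝ) < n.choose d := by exact_mod_cast Nat.choose_pos hdn.le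
  have hCn' : (n : ℝ) ≤ n.choose d := by exact_mod_cast hCn
  set c := posetMeasure w with hc
  -- the measure constraint
  have m1 : ∑ M, w M * (ptCount M : ℝ) ≤ c * n := by
    have h := sum_weightSum Finset.univ w (fun (a : Fin n) M => ptElem d a ∈ M.support)
    simp only [sum_indReal_ptElem] at h
    rw [← h]
    refine (Finset.sum_le_sum fun a _ => pointMeasure_le_posetMeasure w (ptElem d a)).trans ?_
    simp [hc, mul_comm]
  have m2 : ∑ M, w M * (setCount M : ℝ) ≤ c * n.choose d := by
    have h := sum_weightSum Finset.univ w
      (fun (t : {t : Finset (Fin n) // t.card = d}) M => setElem t ∈ M.support)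
    simp only [sum_indReal_setElem] at h
    rw [← h]
    refine (Finset.sum_le_sum fun a _ => pointMeasure_le_posetMeasure w (setElem a)).trans ?_
    simp [hc, mul_comm, Fintype.card_finset_len]
  -- the covering constraints
  have c1 : ((n : ℝ) - d) * n.choose d ≤ ∑ M, w M * (revCount M : ℝ) := by
    have e : ∀ M : PartialLinExt (SubsetPoset d n), (revCount M : ℝ) =
        ∑ x : {t : Finset (Fin n) // t.card = d} × Fin n,
          indReal (M.lt (setElem x.1) (ptElem d x.2)) := by
      intro M
      rw [Fintype.sum_prod_type_right]
      unfold revCount indReal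
      push_cast
      exact Finset.sum_congr rfl fun a _ => by rw [Finset.sum_boole]
    simp only [e]
    rw [← sum_weightSum Finset.univ w
      (fun (x : {t : Finset (Fin n) // t.card = d} × Fin n) M =>
        M.lt (setElem x.1) (ptElem d x.2)), Fintype.sum_prod_type]
    have h : ∀ t : {t : Finset (Fin n) // t.card = d}, ((n : ℝ) - d) ≤
        ∑ a : Fin n, weightSum w fun M => M.lt (setElem t) (ptElem d a) := by
      intro t
      have h1 : ((t.1ᶜ).card : ℝ) = n - d := by
        rw [Finset.card_compl, t.2, Fintype.card_fin, Nat.cast_sub hdn.le]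
      rw [← h1, ← nsmul_one, ← Finset.sum_const]
      refine (Finset.sum_le_sum fun a ha => ?_).trans (Finset.sum_le_sum_of_subset_of_nonneg
        (Finset.subset_univ _) fun a _ _ => weightSum_nonneg (fun M => (hw.1 M).1) _)
      refine hw.2.2 _ _ (fun h => ?_) fun h => ?_
      · rw [ptElem_le_setElem] at h
        simp [h] at ha
      · have h2 := Finset.card_le_card (Subtype.coe_le_coe.2 h)
        simp only [setElem, ptElem, t.2, Finset.card_singleton] at h2
        omega
    refine le_trans (le_of_eq ?_) (Finset.sum_le_sum fun t _ => h t)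
    rw [Finset.sum_const, Finset.card_univ, card_sets, nsmul_eq_mul, mul_comm]
  have c2 : 2 * ((n : ℝ) * (n - 1)) ≤ ∑ M, w M * (ptCount M : ℝ) ^ 2 := by
    have h := sum_sq_weight_ge hw (ptElem d (n := n)) (fun i j hij h => hij (by
      simpa [ptElem] using (Subtype.coe_le_coe.2 h)))
    simpa only [sum_indReal_ptElem, Fintype.card_fin] using h
  have c3 : 2 * ((n.choose d : ℝ) * (n.choose d - 1)) ≤ ∑ M, w M * (setCount M : ℝ) ^ 2 := by
    have h := sum_sq_weight_ge hw (setElem (d := d) (n := n)) (fun i j hij h => hij (by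
      have h1 : i.1 ⊆ j.1 := Subtype.coe_le_coe.2 h
      exact Subtype.ext (Finset.eq_of_subset_of_card_le h1 (j.2.trans i.2.symm).le)))
    simpa only [sum_indReal_setElem, card_sets] using h
  -- the dual inequality, summed up
  have main : ∑ M, w M * (l * ((revCount M : ℝ) / (n * n.choose d)) +
      a / 2 * ((ptCount M : ℝ) / n) ^ 2 + b / 2 * ((setCount M : ℝ) / n.choose d) ^ 2) ≤
      ∑ M, w M * (α * ((ptCount M : ℝ) / n) + α' * ((setCount M : ℝ) / n.choose d)) := by
    refine Finset.sum_le_sum fun M _ => mul_le_mul_of_nonneg_left ?_ (hw.1 M).1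
    refine hdual _ _ _ (by positivity) ?_ (by positivity) ?_
      (revCount_div_le_mul (by omega) hdn M) (revCount_div_le (by omega) hdn M rfl rfl)
    · rw [div_le_one hn]; exact_mod_cast ptCount_le M
    · rw [div_le_one hC]; exact_mod_cast setCount_le M
  have e1 : ∑ M, w M * (l * ((revCount M : ℝ) / (n * n.choose d)) +
      a / 2 * ((ptCount M : ℝ) / n) ^ 2 + b / 2 * ((setCount M : ℝ) / n.choose d) ^ 2) =
      l / (n * n.choose d) * ∑ M, w M * (revCount M : ℝ) +
      a / 2 / n ^ 2 * ∑ M, w M * (ptCount M : ℝ) ^ 2 +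
      b / 2 / (n.choose d : ℝ) ^ 2 * ∑ M, w M * (setCount M : ℝ) ^ 2 := by
    simp only [Finset.mul_sum, ← Finset.sum_add_distrib]
    exact Finset.sum_congr rfl fun M _ => by ring
  have e2 : ∑ M, w M * (α * ((ptCount M : ℝ) / n) + α' * ((setCount M : ℝ) / n.choose d)) =
      α / n * ∑ M, w M * (ptCount M : ℝ) + α' / n.choose d * ∑ M, w M * (setCount M : ℝ) := by
    simp only [Finset.mul_sum, ← Finset.sum_add_distrib]
    exact Finset.sum_congr rfl fun M _ => by ring
  rw [e1, e2] at main
  have u1 : α / n * ∑ M, w M * (ptCount M : ℝ) ≤ α * c := by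
    refine (mul_le_mul_of_nonneg_left m1 (by positivity)).trans (le_of_eq ?_)
    field_simp
  have u2 : α' / n.choose d * ∑ M, w M * (setCount M : ℝ) ≤ α' * c := by
    refine (mul_le_mul_of_nonneg_left m2 (by positivity)).trans (le_of_eq ?_)
    field_simp
  have l1 : (1 - (d : ℝ) / n) * l ≤ l / (n * n.choose d) * ∑ M, w M * (revCount M : ℝ) := by
    refine le_trans (le_of_eq ?_) (mul_le_mul_of_nonneg_left c1 (by positivity))
    field_simp
  have hd1 : (1 : ℝ) ≤ d := by exact_mod_cast (by omega : 1 ≤ d)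
  have l2 : (1 - (d : ℝ) / n) * a ≤ a / 2 / n ^ 2 * ∑ M, w M * (ptCount M : ℝ) ^ 2 := by
    refine le_trans ?_ (mul_le_mul_of_nonneg_left c2 (by positivity))
    have : a / 2 / n ^ 2 * (2 * ((n : ℝ) * (n - 1))) = (1 - 1 / n) * a := by field_simp
    rw [this]
    gcongr
  have l3 : (1 - (d : ℝ) / n) * b ≤
      b / 2 / (n.choose d : ℝ) ^ 2 * ∑ M, w M * (setCount M : ℝ) ^ 2 := by
    refine le_trans ?_ (mul_le_mul_of_nonneg_left c3 (by positivity))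
    have : b / 2 / (n.choose d : ℝ) ^ 2 * (2 * ((n.choose d : ℝ) * (n.choose d - 1))) =
      (1 - 1 / n.choose d) * b := by field_simp
    rw [this]
    gcongr
  have : α * c + α' * c = c := by rw [← add_mul, hαα, one_mul]
  linarith

end FiniteLower

/-! ### The dual solution, and the limit from matching solutions. -/

section DualInequality

/-- A function on `[0,1]` with convex derivative has its maximum at a critical point `x` as soon
as its value at `1` is no larger. -/
theorem le_of_convexOn_deriv {f f' : ℝ → ℝ} (hf : ∀ t ∈ Icc (0 : ℝ) 1, HasDerivAt f (f' t) t)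
    (hconv : ConvexOn ℝ (Icc 0 1) f') {x : ℝ} (hx : x ∈ Ioo (0 : ℝ) 1) (h0 : f' x = 0)
    (h1 : f 1 ≤ f x) {p : ℝ} (hp : p ∈ Icc (0 : ℝ) 1) : f p ≤ f x := by
  have mvt : ∀ u v : ℝ, 0 ≤ u → u < v → v ≤ 1 → ∃ c ∈ Ioo u v, f' c = (f v - f u) / (v - u) :=
    fun u v hu huv hv => exists_hasDerivAt_eq_slope f f' huv
      (fun t ht => (hf t ⟨hu.trans ht.1, ht.2.trans hv⟩).continuousAt.continuousWithinAt)
      fun t ht => hf t ⟨hu.trans ht.1.le, ht.2.le.trans hv⟩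
  -- A larger value at `p` would make `f'` negative before `x` and nonpositive somewhere after it,
  -- or positive and then negative after `x`. As `f' x = 0`, convexity forbids both.
  by_contra! hlt
  rcases lt_trichotomy p x with hpx | rfl | hpx
  · obtain ⟨c, hc, hfc⟩ := mvt p x hp.1 hpx hx.2.le
    obtain ⟨y, hy, hfy⟩ := mvt x 1 hx.1.le hx.2 le_rfl
    have hc0 : f' c < 0 := by
      rw [hfc]; exact div_neg_of_neg_of_pos (by linarith) (by linarith)
    have hy0 : f' y ≤ 0 := by
      rw [hfy]; exact div_nonpos_of_nonpos_of_nonneg (by linarith) (by linarith [hx.2])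
    have := hconv.slope_mono_adjacent (x := c) (y := x) (z := y)
      ⟨hp.1.trans hc.1.le, (hc.2.trans hx.2).le⟩ ⟨hx.1.le.trans hy.1.le, hy.2.le⟩ hc.2 hy.1
    rw [h0] at this
    have h2 : 0 < (0 - f' c) / (x - c) := div_pos (by linarith) (by linarith [hc.2])
    have h3 : (f' y - 0) / (y - x) ≤ 0 :=
      div_nonpos_of_nonpos_of_nonneg (by linarith) (by linarith [hy.1])
    linarith
  · exact lt_irrefl _ hlt
  · have hp1 : p < 1 := lt_of_le_of_ne hp.2 (by rintro rfl; linarith)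
    obtain ⟨c, hc, hfc⟩ := mvt x p hx.1.le hpx hp.2
    obtain ⟨y, hy, hfy⟩ := mvt p 1 hp.1 hp1 le_rfl
    have hc0 : 0 < f' c := by
      rw [hfc]; exact div_pos (by linarith) (by linarith)
    have hy0 : f' y < 0 := by
      rw [hfy]; exact div_neg_of_neg_of_pos (by linarith) (by linarith)
    have := hconv.le_max_of_mem_Icc (x := x) (y := y) (z := c)
      ⟨hx.1.le, hx.2.le⟩ ⟨hp.1.trans hy.1.le, hy.2.le⟩ ⟨hc.1.le, (hc.2.trans hy.1).le⟩
    rw [h0, max_eq_left hy0.le] at this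
    linarith

/-- Left side minus right side is convex in `p`, so the ends 0 and `P` suffice. -/
theorem le_of_segment_ends {a q l c k m P p : ℝ} (ha : 0 ≤ a) (hP : 0 < P) (hp : 0 ≤ p)
    (hpP : p ≤ P) (hstart : c ≤ m) (hend : l * (P * q) + a / 2 * P ^ 2 + c ≤ k * P + m) :
    l * (p * q) + a / 2 * p ^ 2 + c ≤ k * p + m := by
  obtain ⟨θ, hθ0, hθ1, rfl⟩ : ∃ θ : ℝ, 0 ≤ θ ∧ θ ≤ 1 ∧ p = θ * P :=
    ⟨p / P, by positivity, (div_le_one hP).2 hpP, by field_simp⟩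
  have k1 := mul_le_mul_of_nonneg_left hend hθ0
  have k2 := mul_le_mul_of_nonneg_left hstart (sub_nonneg.2 hθ1)
  have k3 : 0 ≤ a / 2 * P ^ 2 * (θ * (1 - θ)) :=
    mul_nonneg (by positivity) (mul_nonneg hθ0 (by linarith))
  linear_combination k1 + k2 + k3

/-- The dual inequality separates as A(p) + B(q) ≤ 0, and α, α' are chosen to make p = q = x
critical. Since A' and B' are convex, only the values at 1 remain to be checked, and the split T = a
+ b is made to fit them. On the diagonal, `h0` and `h1` say that l r(t) + T t²/2 - t vanishes to
second order at x, and `h2` that it is nonpositive at 1. -/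
theorem exists_dual {d : ℕ} (hd : 2 ≤ d) {x l T : ℝ} (hx : x ∈ Ioo (0 : ℝ) 1) (hl : 0 ≤ l)
    (hT : 0 ≤ T) (h0 : l * rFun d x + T * x ^ 2 / 2 = x)
    (h1 : l * ((1 - x) ^ d + 1 - x ^ ((1 : ℝ) / d)) + T * x = 1)
    (h2 : l / (d + 1) + T / 2 ≤ 1) :
    ∃ a b α α' : ℝ, 0 ≤ a ∧ 0 ≤ b ∧ 0 ≤ α ∧ 0 ≤ α' ∧ α + α' = 1 ∧ a + b = T ∧
      ∀ p q ρ : ℝ, 0 ≤ p → p ≤ 1 → 0 ≤ q → q ≤ 1 → ρ ≤ p * q →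
      ((1 - p) ^ d ≤ q →
        ρ ≤ q - d / (d + 1) * (q * q ^ ((1 : ℝ) / d)) - (1 - p) ^ (d + 1) / (d + 1)) →
      l * ρ + a / 2 * p ^ 2 + b / 2 * q ^ 2 ≤ α * p + α' * q := by
  have hd0 : 0 < d := by omega
  have hd' : (0 : ℝ) < d := by exact_mod_cast hd0
  have hd1 : (0 : ℝ) < (d : ℝ) + 1 := by positivity
  obtain ⟨hx0, hx1⟩ := hx
  set s : ℝ := x ^ ((1 : ℝ) / d) with hs
  have hs0 : 0 ≤ s := Real.rpow_nonneg hx0.le _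
  have hs1 : s ≤ 1 := Real.rpow_le_one hx0.le hx1.le (by positivity)
  have hsd : s ^ d = x := rpow_one_div_pow hd0 hx0.le
  rw [rFun_eq hd0 hx0.le, ← hs] at h0
  set A : ℝ → ℝ → ℝ := fun a p =>
    -(l * (1 - p) ^ (d + 1) / (d + 1)) + a / 2 * p ^ 2 - (a * x + l * (1 - x) ^ d) * p with hA
  set B : ℝ → ℝ → ℝ := fun b q =>
    l * (q - d / (d + 1) * q ^ (((d : ℝ) + 1) / d)) + b / 2 * q ^ 2 - (b * x + l * (1 - s)) * q
    with hB
  have hAder : ∀ a t : ℝ, HasDerivAt (A a)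
      (l * (1 - t) ^ d + a * t - (a * x + l * (1 - x) ^ d)) t := by
    intro a t
    have e1 := ((((hasDerivAt_id t).const_sub 1).pow (d + 1)).const_mul l).div_const
      ((d : ℝ) + 1) |>.neg
    have e2 := ((hasDerivAt_id t).pow 2).const_mul (a / 2)
    have e3 := (hasDerivAt_id t).const_mul (a * x + l * (1 - x) ^ d)
    refine HasDerivAt.congr_deriv ((e1.add e2).sub e3) ?_
    push_cast
    simp only [id]
    field_simp
  have hBder : ∀ b t : ℝ, HasDerivAt (B b)
      (l * (1 - t ^ ((1 : ℝ) / d)) + b * t - (b * x + l * (1 - s))) t := by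
    intro b t
    have e1 : HasDerivAt (fun q : ℝ => q ^ (((d : ℝ) + 1) / d)) _ t :=
      Real.hasDerivAt_rpow_const (Or.inr (by rw [le_div_iff₀ hd']; linarith))
    have e2 := ((hasDerivAt_id t).sub (e1.const_mul ((d : ℝ) / (d + 1)))).const_mul l
    have e3 := ((hasDerivAt_id t).pow 2).const_mul (b / 2)
    have e4 := (hasDerivAt_id t).const_mul (b * x + l * (1 - s))
    refine HasDerivAt.congr_deriv ((e2.add e3).sub e4) ?_
    have e5 : ((d : ℝ) + 1) / d - 1 = 1 / d := by field_simp; ring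
    rw [e5]
    field_simp
    simp
    ring
  have hAconv : ∀ a : ℝ,
      ConvexOn ℝ (Icc 0 1) fun t : ℝ => l * (1 - t) ^ d + a * t - (a * x + l * (1 - x) ^ d) := by
    intro a
    have c1 : ConvexOn ℝ (Icc (0 : ℝ) 1) fun t : ℝ => 1 - t :=
      (convexOn_const 1 (convex_Icc _ _)).sub (concaveOn_id (convex_Icc _ _))
    have c2 := (c1.pow (fun t ht => by linarith [ht.2]) d).smul hl
    have c3 : ConvexOn ℝ (Icc (0 : ℝ) 1) fun t : ℝ => a * t :=
      (LinearMap.mulLeft ℝ a).convexOn (convex_Icc _ _)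
    exact ((c2.add c3).sub (concaveOn_const _ (convex_Icc _ _)))
  have hBconv : ∀ b : ℝ,
      ConvexOn ℝ (Icc 0 1) fun t : ℝ => l * (1 - t ^ ((1 : ℝ) / d)) + b * t -
        (b * x + l * (1 - s)) := by
    intro b
    have c0 : ConcaveOn ℝ (Icc (0 : ℝ) 1) fun t : ℝ => t ^ ((1 : ℝ) / d) :=
      (Real.concaveOn_rpow (by positivity) (by
        rw [div_le_one hd']; exact_mod_cast hd0)).subset Icc_subset_Ici_self (convex_Icc _ _)
    have c1 := (convexOn_const (1 : ℝ) (convex_Icc (0 : ℝ) 1)).sub c0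
    have c2 := c1.smul hl
    have c3 : ConvexOn ℝ (Icc (0 : ℝ) 1) fun t : ℝ => b * t :=
      (LinearMap.mulLeft ℝ b).convexOn (convex_Icc _ _)
    exact ((c2.add c3).sub (concaveOn_const _ (convex_Icc _ _)))
  have hAmax : ∀ a : ℝ, A a 1 ≤ A a x → ∀ p ∈ Icc (0 : ℝ) 1, A a p ≤ A a x := fun a ha p hp =>
    le_of_convexOn_deriv (fun t _ => hAder a t) (hAconv a) ⟨hx0, hx1⟩ (by ring) ha hp
  have hBmax : ∀ b : ℝ, B b 1 ≤ B b x → ∀ q ∈ Icc (0 : ℝ) 1, B b q ≤ B b x := fun b hb q hq =>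
    le_of_convexOn_deriv (fun t _ => hBder b t) (hBconv b) ⟨hx0, hx1⟩ (by simp only [hs]; ring) hb hq
  -- The value of `a` for which `A a` is equal at `x` and at 1.
  set a₀ : ℝ := 2 * l * (1 - x) ^ (d - 1) * (d / (d + 1)) with ha₀
  have h1x : 0 < 1 - x := by linarith
  have hpow : (1 - x) ^ d = (1 - x) ^ (d - 1) * (1 - x) := by
    rw [← pow_succ, Nat.sub_add_cancel hd0]
  have ha₀0 : 0 ≤ a₀ := by positivity
  have hAdiff : ∀ a : ℝ, A a x - A a 1 = (1 - x) ^ 2 / 2 * (a₀ - a) := by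
    intro a
    simp only [hA, ha₀]
    rw [sub_self, zero_pow (by omega), pow_succ (1 - x) d, hpow]
    field_simp
    ring
  have hsum : ∀ a b : ℝ, a + b = T → A a x + B b x = 0 := by
    intro a b hab
    simp only [hA, hB]
    rw [rpow_succ_div hd0 hx0.le, ← hs]
    linear_combination h0 - x * h1 + (x ^ 2 - x ^ 2 / 2) * hab - x ^ 2 * hab
  obtain ⟨a, b, ha, hb, hab, hA1, hB1⟩ : ∃ a b : ℝ, 0 ≤ a ∧ 0 ≤ b ∧ a + b = T ∧
      A a 1 ≤ A a x ∧ B b 1 ≤ B b x := by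
    -- All of `T` goes to `a` as long as that keeps `A a 1 ≤ A a x`, and Bernoulli's inequality then
    -- settles `B`. Otherwise `a = a₀` equalizes `A`, and what `B` needs is exactly `h2`.
    rcases le_total T a₀ with hTa | hTa
    · refine ⟨T, 0, hT, le_rfl, add_zero _, ?_, ?_⟩
      · have := hAdiff T
        have : 0 ≤ (1 - x) ^ 2 / 2 * (a₀ - T) := mul_nonneg (by positivity) (by linarith)
        linarith
      · simp only [hB]
        rw [rpow_succ_div hd0 hx0.le, ← hs, Real.one_rpow]
        have hbern := one_add_mul_sub_le_pow (a := s) (by linarith) (d + 1)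
        rw [pow_succ, hsd] at hbern
        push_cast at hbern
        have : 0 ≤ l * ((x * s - (1 + (d + 1) * (s - 1))) / (d + 1)) :=
          mul_nonneg hl (div_nonneg (by linarith) hd1.le)
        have e : l * ((x * s - (1 + (d + 1) * (s - 1))) / (d + 1)) =
          (l * (x - d / (d + 1) * (x * s)) + 0 / 2 * x ^ 2 - (0 * x + l * (1 - s)) * x) -
          (l * (1 - d / (d + 1) * 1) + 0 / 2 * 1 ^ 2 - (0 * x + l * (1 - s)) * 1) := by
          field_simp
          ring
        linarith
    · refine ⟨a₀, T - a₀, ha₀0, by linarith, by ring, ?_, ?_⟩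
      · have := hAdiff a₀
        rw [sub_self, mul_zero] at this
        linarith
      · have e1 := hAdiff a₀
        rw [sub_self, mul_zero] at e1
        have e2 := hsum a₀ (T - a₀) (by ring)
        have e3 : A a₀ 1 + B (T - a₀) 1 = l / (d + 1) + T / 2 - 1 := by
          simp only [hA, hB]
          have hdd : (d : ℝ) / (d + 1) = 1 - 1 / (d + 1) := by field_simp; ring
          rw [sub_self, zero_pow (by omega), Real.one_rpow, hdd]
          linear_combination (-1) * h1
        linarith
  have hAB : ∀ p ∈ Icc (0 : ℝ) 1, ∀ q ∈ Icc (0 : ℝ) 1, A a p + B b q ≤ 0 := by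
    intro p hp q hq
    have e1 := hAmax a hA1 p hp
    have e2 := hBmax b hB1 q hq
    have e3 := hsum a b hab
    linarith
  have hα : 0 ≤ a * x + l * (1 - x) ^ d := by positivity
  have hα' : 0 ≤ b * x + l * (1 - s) := by
    have : 0 ≤ 1 - s := by linarith
    positivity
  refine ⟨a, b, a * x + l * (1 - x) ^ d, b * x + l * (1 - s), ha, hb, hα, hα', ?_, hab, ?_⟩
  · linear_combination h1 + x * hab
  intro p q ρ hp0 hp1 hq0 hq1 hρ1 hρ2
  have hsep : ∀ p ∈ Icc (0 : ℝ) 1,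
      l * (q - d / (d + 1) * (q * q ^ ((1 : ℝ) / d)) - (1 - p) ^ (d + 1) / (d + 1)) +
      a / 2 * p ^ 2 + b / 2 * q ^ 2 ≤ (a * x + l * (1 - x) ^ d) * p + (b * x + l * (1 - s)) * q := by
    intro p hp
    have := hAB p hp q ⟨hq0, hq1⟩
    simp only [hA, hB] at this
    rw [rpow_succ_div hd0 hq0] at this
    linarith [mul_div_assoc l ((1 - p) ^ (d + 1)) ((d : ℝ) + 1)]
  rcases le_or_gt ((1 - p) ^ d) q with hpq | hpq
  · have := mul_le_mul_of_nonneg_left (hρ2 hpq) hl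
    linarith [hsep p ⟨hp0, hp1⟩]
  -- Here only `ρ ≤ p * q` is available, and convexity in `p` reduces to the ends of `[0, 1 - u]`.
  -- At `1 - u` the two bounds on `ρ` agree; the end 0 follows from `A a 0 + B b 1 ≤ 0`.
  · set u : ℝ := q ^ ((1 : ℝ) / d) with hu
    have hu0 : 0 ≤ u := Real.rpow_nonneg hq0 _
    have hu1 : u ≤ 1 := Real.rpow_le_one hq0 hq1 (by positivity)
    have hud : u ^ d = q := rpow_one_div_pow hd0 hq0
    have hpu : p < 1 - u := by
      have : u < 1 - p := lt_of_pow_lt_pow_left₀ d (by linarith) (by rw [hud]; exact hpq)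
      linarith
    have hend := hsep (1 - u) ⟨by linarith, by linarith⟩
    rw [sub_sub_cancel, pow_succ u, hud] at hend
    have hstart : b / 2 * q ^ 2 ≤ (b * x + l * (1 - s)) * q := by
      have h3 := hAB 0 ⟨le_rfl, zero_le_one⟩ 1 ⟨zero_le_one, le_rfl⟩
      simp only [hA, hB] at h3
      rw [Real.one_rpow, sub_zero, one_pow] at h3
      have e : -(l * 1 / ((d : ℝ) + 1)) + a / 2 * 0 ^ 2 - (a * x + l * (1 - x) ^ d) * 0 +
        (l * (1 - d / (d + 1) * 1) + b / 2 * 1 ^ 2 - (b * x + l * (1 - s)) * 1) =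
        b / 2 - (b * x + l * (1 - s)) := by field_simp; ring
      rw [e] at h3
      have h4 : b / 2 * q ^ 2 ≤ b / 2 * q := mul_le_mul_of_nonneg_left (by nlinarith) (by positivity)
      have h5 : b / 2 * q ≤ (b * x + l * (1 - s)) * q := mul_le_mul_of_nonneg_right (by linarith) hq0
      linarith
    have hend' : l * ((1 - u) * q) + a / 2 * (1 - u) ^ 2 + b / 2 * q ^ 2 ≤
        (a * x + l * (1 - x) ^ d) * (1 - u) + (b * x + l * (1 - s)) * q := by
      refine le_trans (le_of_eq ?_) hend
      field_simp
      ring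
    have := le_of_segment_ends ha (by linarith) hp0 hpu.le
      hstart hend'
    have := mul_le_mul_of_nonneg_left hρ1 hl
    linarith

/-- Matching primal and dual solutions of the limiting linear program determine the limit. -/
theorem tendsto_fldim {d : ℕ} (hd : 2 ≤ d) {x W V y l T c : ℝ}
    (hx0 : 0 ≤ x) (hx1 : x ≤ 1) (hxs : 1 - x ≤ x ^ ((1 : ℝ) / d)) (hW : 0 ≤ W) (hV : 0 ≤ V)
    (p1 : W * rFun d x + V / (d + 1) = 1) (p2 : W * x ^ 2 + V = 2) (pc : W * x + V = c)
    (hy : y ∈ Ioo (0 : ℝ) 1) (hl : 0 ≤ l) (hT : 0 ≤ T) (h0 : l * rFun d y + T * y ^ 2 / 2 = y)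
    (h1 : l * ((1 - y) ^ d + 1 - y ^ ((1 : ℝ) / d)) + T * y = 1)
    (h2 : l / (d + 1) + T / 2 ≤ 1) (dc : l + T = c) :
    Tendsto (fun n : ℕ => fldim (SubsetPoset d n)) atTop (𝓝 c) := by
  obtain ⟨a, b, α, α', ha, hb, hα, hα', hαα, hab, hdual⟩ := exists_dual hd hy hl hT h0 h1 h2
  have lower : ∀ n : ℕ, d < n → ∀ w : PartialLinExt (SubsetPoset d n) → ℝ,
      IsFractionalLocalRealizer w → (1 - (d : ℝ) / n) * c ≤ posetMeasure w := by
    intro n hn w hw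
    have := le_posetMeasure_of_dual hd hn hl ha hb hα hα' hαα hdual hw
    rwa [add_assoc, hab, dc] at this
  have hlim : Tendsto (fun n : ℕ => (1 - (d : ℝ) / n) * c) atTop (𝓝 c) := by
    have := ((tendsto_const_div_atTop_nhds_zero_nat (d : ℝ)).const_sub 1).mul_const c
    simpa using this
  refine tendsto_order.2 ⟨fun e he => ?_, fun e he => ?_⟩
  -- The third event only supplies some realizer: the infimum of an empty set would be 0.
  · filter_upwards [hlim.eventually_const_lt he, eventually_gt_atTop d,
      eventually_exists_realizer hd hx0 hx1 hxs hW hV p1 p2 (c := c + 1) (by linarith)]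
      with n h1 h2 h3
    refine h1.trans_le (le_csInf ?_ ?_)
    · obtain ⟨w, hw, -⟩ := h3
      exact ⟨_, w, hw, rfl⟩
    · rintro _ ⟨w, hw, rfl⟩
      exact lower n h2 w hw
  · obtain ⟨e', he1, he2⟩ := exists_between he
    filter_upwards [eventually_gt_atTop 0,
      eventually_exists_realizer hd hx0 hx1 hxs hW hV p1 p2 (c := e') (by linarith)] with n hn h3
    obtain ⟨w, hw, hwe⟩ := h3
    have : Nonempty (SubsetPoset d n) := ⟨ptElem d ⟨0, hn⟩⟩
    exact ((fldim_le_of_realizer hw).trans hwe).trans_lt he2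

end DualInequality

/-! ### Derivatives, concavity and β. -/

section Calculus

/-- The derivative of `rFun`. -/
noncomputable def rDeriv (d : ℕ) (x : ℝ) : ℝ := (1 - x) ^ d + 1 - x ^ ((1 : ℝ) / d)

theorem hasDerivAt_rFun {d : ℕ} (hd : 0 < d) (x : ℝ) : HasDerivAt (rFun d) (rDeriv d x) x := by
  have hd' : (0 : ℝ) < d := by exact_mod_cast hd
  have hd1 : (0 : ℝ) < (d : ℝ) + 1 := by positivity
  have e1 : HasDerivAt (fun q : ℝ => q ^ (((d : ℝ) + 1) / d)) _ x :=
    Real.hasDerivAt_rpow_const (Or.inr (by rw [le_div_iff₀ hd']; linarith))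
  have e2 := ((hasDerivAt_id x).const_sub 1).pow (d + 1)
  have e3 := (((hasDerivAt_id x).const_mul ((d : ℝ) + 1)).sub (e1.const_mul (d : ℝ))).sub e2
  refine HasDerivAt.congr_deriv (e3.const_mul (1 / ((d : ℝ) + 1))) ?_
  have e5 : ((d : ℝ) + 1) / d - 1 = 1 / d := by field_simp; ring
  rw [e5, rDeriv]
  push_cast
  simp only [id]
  field_simp
  simp
  ring

theorem strictConvexOn_rDeriv {d : ℕ} (hd : 2 ≤ d) : StrictConvexOn ℝ (Icc 0 1) (rDeriv d) := by
  have hd' : (1 : ℝ) < d := by exact_mod_cast hd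
  have c0 : StrictConcaveOn ℝ (Icc (0 : ℝ) 1) fun t : ℝ => t ^ ((1 : ℝ) / d) :=
    (Real.strictConcaveOn_rpow (by positivity) (by
      rw [div_lt_one (by linarith)]; exact hd')).subset Icc_subset_Ici_self (convex_Icc _ _)
  have c1 : ConvexOn ℝ (Icc (0 : ℝ) 1) fun t : ℝ => 1 - t :=
    (convexOn_const 1 (convex_Icc _ _)).sub (concaveOn_id (convex_Icc _ _))
  have c2 := (c1.pow (fun t ht => by linarith [ht.2]) d).add
    (convexOn_const (1 : ℝ) (convex_Icc (0 : ℝ) 1))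
  exact c2.sub_strictConcaveOn c0

theorem strictAntiOn_rDeriv {d : ℕ} (hd : 0 < d) : StrictAntiOn (rDeriv d) (Icc 0 1) := by
  intro x hx y hy hxy
  unfold rDeriv
  have h1 : (1 - y) ^ d ≤ (1 - x) ^ d := pow_le_pow_left₀ (by linarith [hy.2]) (by linarith) d
  have h2 : x ^ ((1 : ℝ) / d) < y ^ ((1 : ℝ) / d) :=
    Real.rpow_lt_rpow hx.1 hxy (by positivity)
  linarith

theorem exists_isBeta {d : ℕ} (hd : 2 ≤ d) : ∃ β, IsBeta d β ∧ ∀ b, IsBeta d b → b = β := by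
  have hc : ContinuousOn (fun x : ℝ => x - (1 - x) ^ d) (Icc 0 1) := by fun_prop
  have hmem : (0 : ℝ) ∈ Ioo ((0 : ℝ) - (1 - 0) ^ d) (1 - (1 - 1) ^ d) := by
    constructor
    · simp
    · rw [sub_self, zero_pow (by omega)]; norm_num
  obtain ⟨β, hβ, hβe⟩ := intermediate_value_Ioo zero_le_one hc hmem
  refine ⟨β, ⟨hβ.1, hβ.2, ?_⟩, ?_⟩
  · simp only at hβe; linarith
  · rintro b ⟨hb0, hb1, hbe⟩
    simp only at hβe
    rcases lt_trichotomy b β with h | h | h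
    · have : (1 - β) ^ d ≤ (1 - b) ^ d := pow_le_pow_left₀ (by linarith [hβ.2]) (by linarith) d
      linarith
    · exact h
    · have : (1 - b) ^ d ≤ (1 - β) ^ d := pow_le_pow_left₀ (by linarith) (by linarith) d
      linarith

namespace IsBeta

variable {d : ℕ} {β : ℝ}

theorem rpow_eq (hd : 2 ≤ d) (h : IsBeta d β) : β ^ ((1 : ℝ) / d) = 1 - β := by
  nth_rewrite 1 [← h.2.2]
  rw [one_div]
  exact Real.pow_rpow_inv_natCast (by linarith [h.2.1]) (by omega)

/-- At β the two thresholds of the extension coincide, so every kept pair is reversed and r = p q.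
-/
theorem rFun_eq_sq (hd : 2 ≤ d) (h : IsBeta d β) : rFun d β = β ^ 2 := by
  rw [rFun_eq (by omega) h.1.le, h.rpow_eq hd, pow_succ, h.2.2]
  have : (0 : ℝ) < (d : ℝ) + 1 := by positivity
  field_simp
  ring

theorem rDeriv_eq (hd : 2 ≤ d) (h : IsBeta d β) : rDeriv d β = 2 * β := by
  rw [rDeriv, h.rpow_eq hd, h.2.2]; ring

theorem one_sub_le (hd : 2 ≤ d) (h : IsBeta d β) {x : ℝ} (hx : x ∈ Icc β 1) :
    1 - x ≤ x ^ ((1 : ℝ) / d) := by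
  have hx0 : 0 ≤ x := h.1.le.trans hx.1
  refine le_of_pow_le_pow_left₀ (by omega : d ≠ 0) (Real.rpow_nonneg hx0 _) ?_
  rw [rpow_one_div_pow (by omega) hx0]
  refine (pow_le_pow_left₀ (by linarith [hx.2]) (by linarith [hx.1] : 1 - x ≤ 1 - β) d).trans ?_
  rw [h.2.2]
  exact hx.1

end IsBeta

theorem rFun_one {d : ℕ} (hd : 0 < d) : rFun d 1 = 1 / (d + 1) := by
  rw [rFun_eq hd zero_le_one, Real.one_rpow, sub_self, zero_pow (by omega)]
  have : (0 : ℝ) < (d : ℝ) + 1 := by positivity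
  field_simp
  ring

theorem rDeriv_one {d : ℕ} (hd : 0 < d) : rDeriv d 1 = 0 := by
  rw [rDeriv, sub_self, zero_pow (by omega), Real.one_rpow]
  ring

theorem strictConcaveOn_of_strictAntiOn {f f' : ℝ → ℝ} (hf : ∀ x, HasDerivAt f (f' x) x)
    (h : StrictAntiOn f' (Icc 0 1)) : StrictConcaveOn ℝ (Icc 0 1) f := by
  refine StrictAntiOn.strictConcaveOn_of_deriv (convex_Icc _ _)
    (fun x _ => (hf x).continuousAt.continuousWithinAt) ?_
  have : deriv f = f' := funext fun x => (hf x).deriv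
  rw [this, interior_Icc]
  exact h.mono Ioo_subset_Icc_self

/-- The function whose zero in `[β, 1]` is `x_bal`. -/
noncomputable def balFun (d : ℕ) (x : ℝ) : ℝ := rFun d x - x ^ 2 / 2

theorem hasDerivAt_balFun {d : ℕ} (hd : 0 < d) (x : ℝ) :
    HasDerivAt (balFun d) (rDeriv d x - x) x := by
  refine HasDerivAt.congr_deriv
    ((hasDerivAt_rFun hd x).sub (((hasDerivAt_id x).pow 2).div_const 2)) ?_
  simp

theorem strictAntiOn_balFun_deriv {d : ℕ} (hd : 0 < d) :
    StrictAntiOn (fun x => rDeriv d x - x) (Icc 0 1) := fun x hx y hy hxy => by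
  have := strictAntiOn_rDeriv hd hx hy hxy
  simp only
  linarith

theorem strictConcaveOn_balFun {d : ℕ} (hd : 0 < d) : StrictConcaveOn ℝ (Icc 0 1) (balFun d) :=
  strictConcaveOn_of_strictAntiOn (hasDerivAt_balFun hd) (strictAntiOn_balFun_deriv hd)

theorem balFun_one_neg {d : ℕ} (hd : 2 ≤ d) : balFun d 1 < 0 := by
  unfold balFun
  rw [rFun_one (by omega)]
  have : (2 : ℝ) ≤ d := by exact_mod_cast hd
  have : (1 : ℝ) / (d + 1) < 1 / 2 := one_div_lt_one_div_of_lt two_pos (by linarith)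
  linarith

theorem StrictConcaveOn.pos_of_between {f : ℝ → ℝ} {s : Set ℝ} (hf : StrictConcaveOn ℝ s f)
    {a b x : ℝ} (ha : a ∈ s) (hb : b ∈ s) (hax : a < x) (hxb : x < b) (h0 : 0 ≤ f a)
    (h1 : 0 ≤ f b) : 0 < f x := by
  have := hf.lt_on_openSegment ha hb (hax.trans hxb).ne
    (by rw [openSegment_eq_Ioo (hax.trans hxb)]; exact ⟨hax, hxb⟩)
  exact (le_min h0 h1).trans_lt this

theorem isXBal_iff {d : ℕ} {β x : ℝ} : IsXBal d β x ↔ x ∈ Icc β 1 ∧ balFun d x = 0 := by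
  unfold IsXBal balFun
  rw [sub_eq_zero]

/-! ### Existence, uniqueness and location of x_bal. -/

section Bal

variable {d : ℕ} {β : ℝ}

theorem IsBeta.balFun_pos (hd : 2 ≤ d) (h : IsBeta d β) : 0 < balFun d β := by
  unfold balFun
  rw [h.rFun_eq_sq hd]
  have := h.1
  linarith [pow_pos this 2]

theorem IsXBal.mem_Ioo (hd : 2 ≤ d) (h : IsBeta d β) {x : ℝ} (hx : IsXBal d β x) :
    x ∈ Ioo β 1 := by
  rw [isXBal_iff] at hx
  refine ⟨lt_of_le_of_ne hx.1.1 ?_, lt_of_le_of_ne hx.1.2 ?_⟩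
  · rintro rfl
    exact (h.balFun_pos hd).ne' hx.2
  · rintro rfl
    exact (balFun_one_neg hd).ne hx.2

/-- `balFun` is strictly concave, positive at β and negative at 1. -/
theorem exists_isXBal (hd : 2 ≤ d) (h : IsBeta d β) :
    ∃ x, IsXBal d β x ∧ ∀ y, IsXBal d β y → y = x := by
  have hc : ContinuousOn (balFun d) (Icc β 1) := fun x _ =>
    (hasDerivAt_balFun (by omega) x).continuousAt.continuousWithinAt
  obtain ⟨x, hx, hx0⟩ := intermediate_value_Icc' h.2.1.le hc
    (⟨(balFun_one_neg hd).le, (h.balFun_pos hd).le⟩ : (0 : ℝ) ∈ Icc _ _)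
  have aux : ∀ x y, IsXBal d β x → IsXBal d β y → ¬ x < y := by
    intro x y hx hy hxy
    have h1 := hx.mem_Ioo hd h
    have h2 := hy.mem_Ioo hd h
    rw [isXBal_iff] at hx hy
    exact ((strictConcaveOn_balFun (by omega)).pos_of_between (a := β) (b := y)
      ⟨h.1.le, h.2.1.le⟩ ⟨(h.1.trans h2.1).le, h2.2.le⟩ h1.1 hxy (h.balFun_pos hd).le
      hy.2.ge).ne' hx.2
  refine ⟨x, isXBal_iff.2 ⟨hx, hx0⟩, fun y hy => ?_⟩
  have hx' : IsXBal d β x := isXBal_iff.2 ⟨hx, hx0⟩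
  exact le_antisymm (not_lt.1 (aux x y hx' hy)) (not_lt.1 (aux y x hy hx'))

theorem IsXBal.balFun_nonneg (hd : 2 ≤ d) (h : IsBeta d β) {x y : ℝ} (hx : IsXBal d β x)
    (hy : y ∈ Icc β x) : 0 ≤ balFun d y := by
  have hx1 := hx.mem_Ioo hd h
  rw [isXBal_iff] at hx
  rcases eq_or_lt_of_le hy.1 with rfl | h1
  · exact (h.balFun_pos hd).le
  rcases eq_or_lt_of_le hy.2 with rfl | h2
  · exact hx.2.ge
  · exact ((strictConcaveOn_balFun (by omega)).pos_of_between (a := β) (b := x)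
      ⟨h.1.le, h.2.1.le⟩ ⟨(h.1.trans hx1.1).le, hx1.2.le⟩ h1 h2 (h.balFun_pos hd).le hx.2.ge).le

theorem IsXBal.le_of_balFun_nonneg (hd : 2 ≤ d) (h : IsBeta d β) {x y : ℝ} (hx : IsXBal d β x)
    (hy : y ≤ 1) (hy0 : 0 ≤ balFun d y) : y ≤ x := by
  have hx1 := hx.mem_Ioo hd h
  by_contra! hlt
  have hx2 := (isXBal_iff.1 hx).2
  exact ((strictConcaveOn_balFun (by omega)).pos_of_between (a := β) (b := y)
      ⟨h.1.le, h.2.1.le⟩ ⟨by linarith [h.1, hx1.1], hy⟩ hx1.1 hlt (h.balFun_pos hd).le hy0).ne' hx2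

theorem IsXBal.ge_of_balFun_nonpos (hd : 2 ≤ d) (h : IsBeta d β) {x y z : ℝ} (hx : IsXBal d β x)
    (hz : 0 ≤ z) (hzy : z < y) (hz0 : 0 ≤ balFun d z) (hy0 : balFun d y ≤ 0) : x ≤ y := by
  have hx1 := hx.mem_Ioo hd h
  by_contra! hlt
  have hx2 := (isXBal_iff.1 hx).2
  have := (strictConcaveOn_balFun (d := d) (by omega)).pos_of_between (a := z) (b := x)
      ⟨hz, by linarith [hx1.2]⟩ ⟨by linarith, hx1.2.le⟩ hzy hlt hz0 hx2.ge
  linarith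

end Bal

/-! ### Existence and uniqueness of x_bst. -/

section Bst

variable {d : ℕ} {β : ℝ}

/-- `gFun d x ≤ γ` iff `levelFun d γ x ≤ 0`. -/
noncomputable def levelFun (d : ℕ) (γ x : ℝ) : ℝ :=
  (1 - γ) * (d + 1) * rFun d x + γ * x ^ 2 - x

/-- The derivative of `levelFun`. -/
noncomputable def levelDeriv (d : ℕ) (γ x : ℝ) : ℝ :=
  (1 - γ) * (d + 1) * rDeriv d x + 2 * γ * x - 1

theorem hasDerivAt_levelFun (hd : 0 < d) (γ x : ℝ) :
    HasDerivAt (levelFun d γ) (levelDeriv d γ x) x := by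
  refine HasDerivAt.congr_deriv ((((hasDerivAt_rFun hd x).const_mul ((1 - γ) * (d + 1))).add
    (((hasDerivAt_id x).pow 2).const_mul γ)).sub (hasDerivAt_id x)) ?_
  unfold levelDeriv
  simp
  ring

/-- The level function is the diagonal dual function l r + T x²/2 - x with l = (1-γ)(d+1) and T =
2γ, the multipliers that are tight on full extensions. -/
theorem levelFun_one (hd : 0 < d) (γ : ℝ) : levelFun d γ 1 = 0 := by
  unfold levelFun
  rw [rFun_one hd]
  have : (0 : ℝ) < (d : ℝ) + 1 := by positivity
  field_simp
  ring

theorem levelDeriv_one (hd : 0 < d) (γ : ℝ) : levelDeriv d γ 1 = 2 * γ - 1 := by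
  unfold levelDeriv
  rw [rDeriv_one hd]
  ring

theorem strictConvexOn_levelDeriv (hd : 2 ≤ d) {γ : ℝ} (hγ : γ < 1) :
    StrictConvexOn ℝ (Icc 0 1) (levelDeriv d γ) := by
  have hpos : 0 < (1 - γ) * ((d : ℝ) + 1) := mul_pos (by linarith) (by positivity)
  refine ⟨convex_Icc _ _, fun x hx y hy hxy a b ha hb hab => ?_⟩
  have := (strictConvexOn_rDeriv hd).2 hx hy hxy ha hb hab
  simp only [smul_eq_mul] at this ⊢
  unfold levelDeriv
  have h := mul_lt_mul_of_pos_left this hpos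
  linear_combination h + hab

/-- The denominator is strictly concave, positive at β and zero at 1. -/
theorem denom_pos (hd : 2 ≤ d) (h : IsBeta d β) {x : ℝ} (hx : x ∈ Ico β 1) :
    0 < ((d : ℝ) + 1) * rFun d x - x ^ 2 := by
  have hd1 : (0 : ℝ) < (d : ℝ) + 1 := by positivity
  have hβ : 0 < ((d : ℝ) + 1) * rFun d β - β ^ 2 := by
    rw [h.rFun_eq_sq hd]
    have h1 : (0 : ℝ) < d := by exact_mod_cast (by omega : 0 < d)
    have h2 := pow_pos h.1 2
    have : ((d : ℝ) + 1) * β ^ 2 - β ^ 2 = d * β ^ 2 := by ring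
    rw [this]
    positivity
  rcases eq_or_lt_of_le hx.1 with rfl | hlt
  · exact hβ
  · have hder : ∀ x, HasDerivAt (fun x => ((d : ℝ) + 1) * rFun d x - x ^ 2)
        (((d : ℝ) + 1) * rDeriv d x - 2 * x) x := fun x => by
      refine HasDerivAt.congr_deriv (((hasDerivAt_rFun (by omega) x).const_mul ((d : ℝ) + 1)).sub
        ((hasDerivAt_id x).pow 2)) ?_
      simp
    have hanti : StrictAntiOn (fun x => ((d : ℝ) + 1) * rDeriv d x - 2 * x) (Icc 0 1) := by
      intro x hx y hy hxy
      have := mul_lt_mul_of_pos_left (strictAntiOn_rDeriv (d := d) (by omega) hx hy hxy) hd1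
      simp only
      linarith
    refine (strictConcaveOn_of_strictAntiOn hder hanti).pos_of_between (a := β) (b := 1)
      ⟨h.1.le, h.2.1.le⟩ ⟨zero_le_one, le_rfl⟩ hlt hx.2 hβ.le ?_
    rw [rFun_one (by omega)]
    apply le_of_eq
    field_simp
    ring

theorem gFun_le_iff (hd : 2 ≤ d) (h : IsBeta d β) {x : ℝ} (hx : x ∈ Ico β 1) (γ : ℝ) :
    gFun d x ≤ γ ↔ levelFun d γ x ≤ 0 := by
  unfold gFun levelFun
  rw [div_le_iff₀ (denom_pos hd h hx)]
  constructor <;> intro h <;> linarith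

theorem gFun_lt_iff (hd : 2 ≤ d) (h : IsBeta d β) {x : ℝ} (hx : x ∈ Ico β 1) (γ : ℝ) :
    gFun d x < γ ↔ levelFun d γ x < 0 := by
  unfold gFun levelFun
  rw [div_lt_iff₀ (denom_pos hd h hx)]
  constructor <;> intro h <;> linarith

theorem levelFun_gFun (hd : 2 ≤ d) (h : IsBeta d β) {x : ℝ} (hx : x ∈ Ico β 1) :
    levelFun d (gFun d x) x = 0 := by
  have := denom_pos hd h hx
  unfold gFun levelFun
  field_simp
  ring

theorem gFun_lt_one (hd : 2 ≤ d) (h : IsBeta d β) {x : ℝ} (hx : x ∈ Ico β 1) : gFun d x < 1 := by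
  rw [gFun_lt_iff hd h hx]
  unfold levelFun
  have h0 : 0 < x := h.1.trans_le hx.1
  nlinarith [hx.2]

theorem eventually_neg_of_deriv_pos {f : ℝ → ℝ} {m a : ℝ} (hf : HasDerivAt f m a) (h0 : f a = 0)
    (hm : 0 < m) : ∀ᶠ x in 𝓝[<] a, f x < 0 := by
  have h1 := (hf.tendsto_slope.eventually_const_lt hm).filter_mono
    (nhdsWithin_mono a (fun x (hx : x ∈ Iio a) => (ne_of_lt hx : x ≠ a)))
  filter_upwards [h1, self_mem_nhdsWithin] with x hx hxa
  rw [slope_def_field, h0, sub_zero] at hx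
  have hxa' : x - a < 0 := sub_neg.2 hxa
  by_contra! hneg
  exact hx.not_ge (div_nonpos_of_nonneg_of_nonpos hneg hxa'.le)

/-- At γ = 1/2 the level function has a double zero at 1 with second derivative 1 - (d+1)/(2d) > 0,
so it is positive just left of 1. -/
theorem exists_half_lt_gFun (hd : 2 ≤ d) (h : IsBeta d β) :
    ∃ x ∈ Ico β 1, 1 / 2 < gFun d x := by
  have hd0 : (0 : ℝ) < d := by exact_mod_cast (by omega : 0 < d)
  have hder : HasDerivAt (levelDeriv d (1 / 2)) (1 - (d + 1) / (2 * d)) 1 := by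
    have e1 := ((hasDerivAt_id (1 : ℝ)).const_sub 1).pow d
    have e2 : HasDerivAt (fun x : ℝ => x ^ ((1 : ℝ) / d)) _ 1 :=
      Real.hasDerivAt_rpow_const (Or.inl one_ne_zero)
    have e3 := ((((e1.add_const 1).sub e2).const_mul ((1 - 1 / 2 : ℝ) * (d + 1))).add
      ((hasDerivAt_id (1 : ℝ)).const_mul (2 * (1 / 2) : ℝ))).sub_const 1
    refine HasDerivAt.congr_deriv e3 ?_
    simp only [id, sub_self, Real.one_rpow]
    rw [zero_pow (by omega)]
    field_simp
    ring
  have hm : (0 : ℝ) < 1 - (d + 1) / (2 * d) := by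
    rw [sub_pos, div_lt_one (by positivity)]
    have : (2 : ℝ) ≤ d := by exact_mod_cast hd
    linarith
  have hev := eventually_neg_of_deriv_pos hder (by rw [levelDeriv_one (by omega)]; norm_num) hm
  rw [eventually_nhdsWithin_iff] at hev
  obtain ⟨ε, hε, hball⟩ := Metric.eventually_nhds_iff.1 hev
  set x := max β (1 - ε / 2) with hx
  have hx1 : x < 1 := max_lt h.2.1 (by linarith)
  refine ⟨x, ⟨le_max_left _ _, hx1⟩, ?_⟩
  rw [← not_le, gFun_le_iff hd h ⟨le_max_left _ _, hx1⟩, not_le]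
  obtain ⟨c, hc, hce⟩ := exists_hasDerivAt_eq_slope (levelFun d (1 / 2)) _ hx1
    (fun t _ => (hasDerivAt_levelFun (by omega) _ t).continuousAt.continuousWithinAt)
    fun t _ => hasDerivAt_levelFun (by omega) _ t
  have hcneg : levelDeriv d (1 / 2) c < 0 := by
    refine hball ?_ hc.2
    rw [Real.dist_eq, abs_of_neg (by linarith [hc.2])]
    have : 1 - ε / 2 ≤ x := le_max_right _ _
    linarith [hc.1]
  rw [hce, levelFun_one (by omega), zero_sub] at hcneg
  by_contra! hneg
  have : 0 ≤ -levelFun d (1 / 2) x / (1 - x) := div_nonneg (by linarith) (by linarith)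
  linarith

/-- For a value γ > 1/2 of g the level function has positive slope at its zero 1, so g < γ near 1.
The maximum over a compact interval `[β, b]` is therefore global. -/
theorem exists_isMaxOn_gFun (hd : 2 ≤ d) (h : IsBeta d β) : ∃ x, IsXBst d β x := by
  obtain ⟨x₀, hx₀, hg⟩ := exists_half_lt_gFun hd h
  have hev := eventually_neg_of_deriv_pos (hasDerivAt_levelFun (d := d) (by omega) (gFun d x₀) 1)
    (levelFun_one (by omega) _) (by rw [levelDeriv_one (by omega)]; linarith)
  rw [eventually_nhdsWithin_iff] at hev
  obtain ⟨ε, hε, hball⟩ := Metric.eventually_nhds_iff.1 hev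
  set b := max x₀ (1 - ε / 2) with hb
  have hb1 : b < 1 := max_lt hx₀.2 (by linarith)
  have hcont : ContinuousOn (gFun d) (Icc β b) := by
    intro x hx
    have hx' : x ∈ Ico β 1 := ⟨hx.1, hx.2.trans_lt hb1⟩
    have hr := (hasDerivAt_rFun (d := d) (by omega) x).continuousAt
    refine ContinuousAt.continuousWithinAt ?_
    unfold gFun
    exact ((continuousAt_const.mul hr).sub continuousAt_id).div
      ((continuousAt_const.mul hr).sub (continuousAt_id.pow 2)) (denom_pos hd h hx').ne'
  obtain ⟨x, hx, hmax⟩ := isCompact_Icc.exists_isMaxOn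
    ⟨x₀, hx₀.1, le_max_left _ _⟩ hcont
  refine ⟨x, ⟨hx.1, hx.2.trans_lt hb1⟩, fun y hy => ?_⟩
  by_cases hyb : y ≤ b
  · exact hmax ⟨hy.1, hyb⟩
  · push Not at hyb
    have h1 : levelFun d (gFun d x₀) y < 0 := by
      refine hball ?_ hy.2
      rw [Real.dist_eq, abs_of_neg (by linarith [hy.2])]
      have : 1 - ε / 2 ≤ b := le_max_right _ _
      linarith
    rw [← gFun_lt_iff hd h hy] at h1
    exact h1.le.trans (hmax ⟨hx₀.1, le_max_left _ _⟩)

theorem IsXBst.half_lt (hd : 2 ≤ d) (h : IsBeta d β) {x : ℝ} (hx : IsXBst d β x) :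
    1 / 2 < gFun d x := by
  obtain ⟨y, hy, hg⟩ := exists_half_lt_gFun hd h
  exact hg.trans_le (hx.2 hy)

theorem IsXBst.levelFun_nonpos (hd : 2 ≤ d) (h : IsBeta d β) {x y : ℝ} (hx : IsXBst d β x)
    (hy : y ∈ Ico β 1) : levelFun d (gFun d x) y ≤ 0 :=
  (gFun_le_iff hd h hy _).1 (hx.2 hy)

/-- Since r(β) = β² and r'(β) = 2β, the level function that vanishes at β has slope 1 there; so β is
no maximiser and x_bst is interior. -/
theorem IsXBst.beta_lt (hd : 2 ≤ d) (h : IsBeta d β) {x : ℝ} (hx : IsXBst d β x) : β < x := by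
  refine lt_of_le_of_ne hx.1.1 ?_
  rintro rfl
  set γ := gFun d β
  have h0 : levelFun d γ β = 0 := levelFun_gFun hd h hx.1
  have hD := hasDerivAt_levelFun (d := d) (by omega) γ β
  have hD1 : levelDeriv d γ β = 1 := by
    unfold levelDeriv
    unfold levelFun at h0
    rw [h.rFun_eq_sq hd] at h0
    rw [h.rDeriv_eq hd]
    have : β * ((1 - γ) * (d + 1) * β + γ * β - 1) = 0 := by linarith
    rcases mul_eq_zero.1 this with h1 | h1
    · exact absurd h1 h.1.ne'
    · linarith
  rw [hD1] at hD
  have h1 := (hD.tendsto_slope.eventually_const_lt zero_lt_one).filter_mono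
    (nhdsWithin_mono β (fun x (hx : x ∈ Ioi β) => (ne_of_gt hx : x ≠ β)))
  have h2 : ∀ᶠ x in 𝓝[>] β, x < 1 := mem_nhdsWithin_of_mem_nhds (Iio_mem_nhds h.2.1)
  obtain ⟨y, hy1, hy2, hy3⟩ := (h1.and (h2.and self_mem_nhdsWithin)).exists
  rw [slope_def_field, h0, sub_zero] at hy1
  have hy3' : 0 < y - β := sub_pos.2 hy3
  have h4 := hx.levelFun_nonpos hd h ⟨(le_of_lt hy3 : β ≤ y), hy2⟩
  have h5 : levelFun d γ y / (y - β) ≤ 0 := div_nonpos_of_nonpos_of_nonneg h4 hy3'.le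
  linarith

theorem IsXBst.levelDeriv_eq_zero (hd : 2 ≤ d) (h : IsBeta d β) {x : ℝ} (hx : IsXBst d β x) :
    levelDeriv d (gFun d x) x = 0 := by
  refine IsLocalMax.hasDerivAt_eq_zero (f := levelFun d (gFun d x)) ?_
    (hasDerivAt_levelFun (by omega) _ x)
  filter_upwards [Ioo_mem_nhds (hx.beta_lt hd h) hx.1.2] with y hy
  rw [levelFun_gFun hd h hx.1]
  exact hx.levelFun_nonpos hd h ⟨hy.1.le, hy.2⟩

/-- Two maximisers are critical zeros of one level function, and Rolle between the later one and 1
gives a third critical point. A strictly convex derivative has at most two zeros. -/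
theorem IsXBst.unique (hd : 2 ≤ d) (h : IsBeta d β) {x y : ℝ} (hx : IsXBst d β x)
    (hy : IsXBst d β y) : x = y := by
  have aux : ∀ x y, IsXBst d β x → IsXBst d β y → ¬ x < y := by
    intro x y hx hy hxy
    have hg : gFun d x = gFun d y := le_antisymm (hy.2 hx.1) (hx.2 hy.1)
    have hy0 := levelFun_gFun hd h hy.1
    obtain ⟨c, hc, hce⟩ := exists_hasDerivAt_eq_zero hy.1.2
      (fun t _ => (hasDerivAt_levelFun (d := d) (by omega) (gFun d y)
        t).continuousAt.continuousWithinAt)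
      (hy0.trans (levelFun_one (by omega) _).symm)
      fun t _ => hasDerivAt_levelFun (by omega) _ t
    have e1 := hx.levelDeriv_eq_zero hd h
    have e2 := hy.levelDeriv_eq_zero hd h
    rw [hg] at e1
    have := (strictConvexOn_levelDeriv hd (gFun_lt_one hd h hy.1)).slope_strict_mono_adjacent
      (x := x) (y := y) (z := c) ⟨h.1.le.trans hx.1.1, hx.1.2.le⟩
      ⟨h.1.le.trans (hy.1.1.trans hc.1.le), hc.2.le⟩ hxy hc.1
    rw [e1, e2, hce] at this
    simp at this
  exact le_antisymm (not_lt.1 (aux y x hy hx)) (not_lt.1 (aux x y hx hy))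

end Bst

end Calculus

/-! ### A rational criterion for the sign of g' at x_bal. -/

section Comparison

/-- At `x = x_bal` this has the sign of the derivative of `gFun`. -/
noncomputable def signFun (d : ℕ) (x : ℝ) : ℝ :=
  ((d : ℝ) ^ 2 - 1) * x ^ 2 + (d + 3) * x - 2 * (d + 1) +
    2 * (d + 1) * ((1 - x) ^ (d + 1) * (d - 1 + x⁻¹))

/-- A product of nonnegative decreasing convex functions is convex, and the rest is a quadratic with
nonnegative leading coefficient. -/
theorem convexOn_signFun {d : ℕ} (hd : 2 ≤ d) : ConvexOn ℝ (Ioc 0 1) (signFun d) := by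
  have hd' : (2 : ℝ) ≤ d := by exact_mod_cast hd
  have hs : Convex ℝ (Ioc (0 : ℝ) 1) := convex_Ioc _ _
  have c1 : ConvexOn ℝ (Ioc (0 : ℝ) 1) fun t : ℝ => 1 - t :=
    (convexOn_const 1 hs).sub (concaveOn_id hs)
  have c2 := c1.pow (fun t ht => by linarith [ht.2]) (d + 1)
  have c3 : ConvexOn ℝ (Ioc (0 : ℝ) 1) fun t : ℝ => (d : ℝ) - 1 + t⁻¹ := by
    have h := (convexOn_zpow (-1)).subset (fun x (hx : x ∈ Ioc (0 : ℝ) 1) => hx.1) hs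
    simp only [zpow_neg_one] at h
    exact (convexOn_const ((d : ℝ) - 1) hs).add h
  have c4 := c2.mul c3 (fun x hx => pow_nonneg (by linarith [hx.2]) _)
    (fun x hx => by have := inv_pos.2 hx.1; linarith) (by
      refine AntitoneOn.monovaryOn ?_ ?_
      · intro x hx y hy hxy
        change (1 - y) ^ (d + 1) ≤ (1 - x) ^ (d + 1)
        exact pow_le_pow_left₀ (by linarith [hy.2]) (by linarith) _
      · intro x hx y hy hxy
        have := inv_anti₀ hx.1 hxy
        simp only
        linarith)
  have c5 := c4.smul (by positivity : (0 : ℝ) ≤ 2 * (d + 1))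
  have c6 : ConvexOn ℝ (Ioc (0 : ℝ) 1) fun t : ℝ => t ^ 2 :=
    (convexOn_id hs).pow (fun t ht => ht.1.le) 2
  have c7 := c6.smul (by nlinarith : (0 : ℝ) ≤ (d : ℝ) ^ 2 - 1)
  have c8 : ConvexOn ℝ (Ioc (0 : ℝ) 1) fun t : ℝ => ((d : ℝ) + 3) * t :=
    (LinearMap.mulLeft ℝ ((d : ℝ) + 3)).convexOn hs
  exact ((c7.add c8).sub (concaveOn_const _ hs)).add c5

/-- The balance equation eliminates the root x^(1/d); this is what makes `signFun` rational in x. -/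
theorem signFun_eq {d : ℕ} (hd : 2 ≤ d) {x : ℝ} (hx : 0 < x) (hbal : balFun d x = 0) :
    signFun d x =
      d * (2 * (d + 1) * rDeriv d x * (1 - x) - (d + 3) * x + 2 * (d + 1) * x ^ 2) := by
  have hd1 : (0 : ℝ) < (d : ℝ) + 1 := by positivity
  unfold balFun at hbal
  rw [rFun_eq (by omega) hx.le] at hbal
  unfold signFun rDeriv
  set s := x ^ ((1 : ℝ) / d)
  have h1 : (d : ℝ) * s = (d + 1) - (1 - x) ^ (d + 1) * x⁻¹ - (d + 1) * x / 2 := by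
    field_simp at hbal ⊢
    linarith
  have hxx : x * x⁻¹ = 1 := mul_inv_cancel₀ hx.ne'
  rw [pow_succ] at h1 ⊢
  linear_combination (2 * ((d : ℝ) + 1) * (1 - x)) * h1 +
    (2 * ((d : ℝ) + 1) * (1 - x) ^ d * (1 - x)) * hxx

/-- `balFun` in terms of an auxiliary expression whose sign is easy to certify. -/
theorem balFun_eq {d : ℕ} (hd : 2 ≤ d) {x : ℝ} (hx : 0 < x) :
    balFun d x = x / (d + 1) * ((d + 1) - d * x ^ ((1 : ℝ) / d) - (1 - x) ^ (d + 1) * x⁻¹ -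
      (d + 1) * x / 2) := by
  have hd1 : (0 : ℝ) < (d : ℝ) + 1 := by positivity
  unfold balFun
  rw [rFun_eq (by omega) hx.le]
  field_simp

theorem balFun_nonneg_of {d : ℕ} (hd : 2 ≤ d) {x σ : ℝ} (hx : 0 < x)
    (hσ : x ^ ((1 : ℝ) / d) ≤ σ)
    (h : (d : ℝ) * σ + (1 - x) ^ (d + 1) * x⁻¹ + (d + 1) * x / 2 ≤ d + 1) : 0 ≤ balFun d x := by
  rw [balFun_eq hd hx]
  refine mul_nonneg (by positivity) ?_
  have : (d : ℝ) * x ^ ((1 : ℝ) / d) ≤ d * σ := by gcongr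
  linarith

theorem balFun_nonpos_of {d : ℕ} (hd : 2 ≤ d) {x σ : ℝ} (hx : 0 < x)
    (hσ : σ ≤ x ^ ((1 : ℝ) / d))
    (h : d + 1 ≤ (d : ℝ) * σ + (1 - x) ^ (d + 1) * x⁻¹ + (d + 1) * x / 2) : balFun d x ≤ 0 := by
  rw [balFun_eq hd hx]
  refine mul_nonpos_of_nonneg_of_nonpos (by positivity) ?_
  have : (d : ℝ) * σ ≤ d * x ^ ((1 : ℝ) / d) := by gcongr
  linarith

theorem rpow_one_div_le {d : ℕ} (hd : 0 < d) {x σ : ℝ} (hx : 0 ≤ x) (hσ : 0 ≤ σ)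
    (h : x ≤ σ ^ d) : x ^ ((1 : ℝ) / d) ≤ σ :=
  le_of_pow_le_pow_left₀ hd.ne' hσ (by rwa [rpow_one_div_pow hd hx])

theorem le_rpow_one_div {d : ℕ} (hd : 0 < d) {x σ : ℝ} (hx : 0 ≤ x)
    (h : σ ^ d ≤ x) : σ ≤ x ^ ((1 : ℝ) / d) :=
  le_of_pow_le_pow_left₀ hd.ne' (Real.rpow_nonneg hx _) (by rwa [rpow_one_div_pow hd hx])

/-- The signs of `balFun` enclose x_bal between `lo` and `hi`, and a convex function is bounded by
its end values. -/
theorem signFun_nonpos_of_bracket {d : ℕ} (hd : 2 ≤ d) {β x lo hi : ℝ} (h : IsBeta d β)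
    (hx : IsXBal d β x) (hlo : 0 < lo) (hlohi : lo < hi) (hhi : hi ≤ 1)
    (blo : 0 ≤ balFun d lo) (bhi : balFun d hi ≤ 0) (slo : signFun d lo ≤ 0)
    (shi : signFun d hi ≤ 0) : signFun d x ≤ 0 := by
  have h1 := hx.le_of_balFun_nonneg hd h (by linarith) blo
  have h2 := hx.ge_of_balFun_nonpos hd h hlo.le hlohi blo bhi
  exact ((convexOn_signFun hd).le_max_of_mem_Icc ⟨hlo, by linarith⟩ ⟨by linarith, hhi⟩
    ⟨h1, h2⟩).trans (max_le slo shi)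

/-- `σ` bounds lo^(1/d) from above and `τ` bounds hi^(1/d) from below, so that rational arithmetic
suffices. -/
theorem signFun_nonpos_of_rational {d : ℕ} (hd : 2 ≤ d) {β x : ℝ} (h : IsBeta d β)
    (hx : IsXBal d β x) (lo hi σ τ : ℝ) (hlo : 0 < lo) (hlohi : lo < hi) (hhi : hi ≤ 1)
    (hσ : 0 ≤ σ) (lo1 : lo ≤ σ ^ d)
    (lo2 : (d : ℝ) * σ + (1 - lo) ^ (d + 1) * lo⁻¹ + (d + 1) * lo / 2 ≤ d + 1)
    (hi1 : τ ^ d ≤ hi)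
    (hi2 : d + 1 ≤ (d : ℝ) * τ + (1 - hi) ^ (d + 1) * hi⁻¹ + (d + 1) * hi / 2)
    (slo : signFun d lo ≤ 0) (shi : signFun d hi ≤ 0) : signFun d x ≤ 0 :=
  signFun_nonpos_of_bracket hd h hx hlo hlohi hhi
    (balFun_nonneg_of hd hlo (rpow_one_div_le (by omega) hlo.le hσ lo1) lo2)
    (balFun_nonpos_of hd (hlo.trans hlohi) (le_rpow_one_div (by omega) (by linarith) hi1) hi2)
    slo shi

end Comparison

/-! ### The sign of g' at x_bal for d ≥ 4. -/

section SignAtBal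

theorem signFun_nonpos_of_lt_twenty {d : ℕ} (hd4 : 4 ≤ d) (hd20 : d < 20) {β x : ℝ}
    (h : IsBeta d β) (hx : IsXBal d β x) : signFun d x ≤ 0 := by
  have small : ∀ lo hi σ τ : ℝ, (0 < lo ∧ lo < hi ∧ hi ≤ 1 ∧ 0 ≤ σ ∧ lo ≤ σ ^ d ∧
      (d : ℝ) * σ + (1 - lo) ^ (d + 1) * lo⁻¹ + (d + 1) * lo / 2 ≤ d + 1 ∧ τ ^ d ≤ hi ∧
      d + 1 ≤ (d : ℝ) * τ + (1 - hi) ^ (d + 1) * hi⁻¹ + (d + 1) * hi / 2 ∧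
      signFun d lo ≤ 0 ∧ signFun d hi ≤ 0) → signFun d x ≤ 0 := by
    rintro lo hi σ τ ⟨h1, h2, h3, h4, h5, h6, h7, h8, h9, h10⟩
    exact signFun_nonpos_of_rational (by omega) h hx lo hi σ τ h1 h2 h3 h4 h5 h6 h7 h8 h9 h10
  unfold signFun at small
  interval_cases d
  · exact small (2/5) (59/100) (4/5) (2191/2500) (by norm_num)
  · exact small (2/5) (27/50) (9/10) (22/25) (by norm_num)
  · exact small (2/5) (49/100) (9/10) (22/25) (by norm_num)
  · exact small (3/10) (23/50) (9/10) (89/100) (by norm_num)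
  · exact small (3/10) (11/25) (9/10) (9/10) (by norm_num)
  · exact small (3/10) (2/5) (9/10) (9/10) (by norm_num)
  · exact small (3/10) (2/5) (9/10) (9/10) (by norm_num)
  · exact small (3/10) (19/50) (9/10) (9/10) (by norm_num)
  · exact small (3/10) (9/25) (91/100) (9/10) (by norm_num)
  · exact small (3/10) (7/20) (114/125) (9/10) (by norm_num)
  · exact small (21/100) (3/10) (9/10) (91/100) (by norm_num)
  · exact small (1/5) (3/10) (9/10) (23/25) (by norm_num)
  · exact small (1/5) (3/10) (91/100) (23/25) (by norm_num)
  · exact small (1/5) (3/10) (91/100) (9/10) (by norm_num)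
  · exact small (1/5) (3/10) (23/25) (9/10) (by norm_num)
  · exact small (1/5) (3/10) (23/25) (9/10) (by norm_num)

theorem exp_three_gt : (20.08 : ℝ) < Real.exp 3 := by
  have h1 := Real.exp_one_gt_d9
  have h2 : Real.exp 3 = Real.exp 1 ^ 3 := by rw [← Real.exp_nat_mul]; norm_num
  rw [h2]
  calc (20.08 : ℝ) < 2.7182 ^ 3 := by norm_num
    _ ≤ Real.exp 1 ^ 3 := by gcongr; linarith

theorem exp_three_lt : Real.exp 3 < 21 := by
  have h1 := Real.exp_one_lt_d9
  have h2 : Real.exp 3 = Real.exp 1 ^ 3 := by rw [← Real.exp_nat_mul]; norm_num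
  rw [h2]
  calc Real.exp 1 ^ 3 ≤ 2.719 ^ 3 := by gcongr; linarith
    _ < 21 := by norm_num

/-- Bounding `signFun` when `x = y / (d+1)`. -/
theorem signFun_le {d : ℕ} (hd : 2 ≤ d) {y e : ℝ} (hy1 : 1 ≤ y) (hyN : y ≤ d + 1)
    (he : Real.exp (-y) ≤ e) :
    signFun d (y / (d + 1)) ≤ y ^ 2 + y - 2 * (d + 1) + 2 * (d + 1) ^ 2 * e * (1 + 1 / y) := by
  have hd' : (2 : ℝ) ≤ d := by exact_mod_cast hd
  have hN : (0 : ℝ) < d + 1 := by linarith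
  have hx1 : y / ((d : ℝ) + 1) ≤ 1 := by rw [div_le_one hN]; exact hyN
  have h1 : (1 - y / ((d : ℝ) + 1)) ^ (d + 1) ≤ e := by
    refine le_trans ?_ he
    have := Real.one_sub_div_pow_le_exp_neg (n := d + 1) (t := y) (by push_cast; exact hyN)
    push_cast at this
    exact this
  have he0 : 0 ≤ e := (Real.exp_pos _).le.trans he
  have h2 : (d : ℝ) - 1 + (y / ((d : ℝ) + 1))⁻¹ ≤ (d + 1) * (1 + 1 / y) := by
    rw [inv_div, mul_add, mul_one, mul_one_div]; linarith
  have h3 : (1 - y / ((d : ℝ) + 1)) ^ (d + 1) * ((d : ℝ) - 1 + (y / ((d : ℝ) + 1))⁻¹) ≤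
      e * ((d + 1) * (1 + 1 / y)) := by
    refine mul_le_mul h1 h2 ?_ he0
    have : 0 ≤ (y / ((d : ℝ) + 1))⁻¹ := by positivity
    linarith
  have h4 : ((d : ℝ) ^ 2 - 1) * (y / (d + 1)) ^ 2 + (d + 3) * (y / (d + 1)) =
      y ^ 2 + y - 2 * (y ^ 2 - y) / (d + 1) := by
    field_simp
    ring
  have h5 : 0 ≤ 2 * (y ^ 2 - y) / ((d : ℝ) + 1) :=
    div_nonneg (by nlinarith) hN.le
  unfold signFun
  rw [h4]
  have h6 := mul_le_mul_of_nonneg_left h3 (by positivity : (0 : ℝ) ≤ 2 * (d + 1))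
  linarith

/-- With N = d + 1 and x = y/N, the linear term -2N dominates once N² e^(-y) is small. The bracket
for y is log N + 1 to 2 log N - 1/2, that is 4 + t to 11/2 + 2t when log N = 3 + t; N ≥ 21 > e³
gives t ≥ 0. The constants 0.368 and 1.65 bound 1/e and √e from above. -/
theorem signFun_nonpos_of_twenty_le {d : ℕ} (hd : 20 ≤ d) {β x : ℝ}
    (h : IsBeta d β) (hx : IsXBal d β x) : signFun d x ≤ 0 := by
  have hd' : (20 : ℝ) ≤ d := by exact_mod_cast hd
  set N : ℝ := (d : ℝ) + 1 with hN
  have hN0 : 0 < N := by linarith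
  set t : ℝ := Real.log N - 3 with ht
  have hlog : Real.log N = 3 + t := by rw [ht]; ring
  have ht0 : 0 ≤ t := by
    rw [ht, sub_nonneg, Real.le_log_iff_exp_le hN0]
    linarith [exp_three_lt]
  have hNexp : N = Real.exp 3 * Real.exp t := by
    rw [← Real.exp_add, ← hlog, Real.exp_log hN0]
  have hNge : 20.08 * (1 + t + t ^ 2 / 2) ≤ N := by
    rw [hNexp]
    exact mul_le_mul exp_three_gt.le (Real.quadratic_le_exp_of_nonneg ht0) (by positivity)
      (Real.exp_pos _).le
  have he1 := Real.exp_one_gt_d9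
  have he1' : Real.exp (-1) ≤ 0.368 := by
    rw [Real.exp_neg, inv_le_comm₀ (Real.exp_pos _) (by norm_num)]
    refine le_trans ?_ he1.le
    norm_num
  -- lower end of the bracket
  have hylo : Real.exp (-(4 + t)) ≤ 0.368 / N := by
    have : -(4 + t) = -1 - Real.log N := by rw [hlog]; ring
    rw [this, Real.exp_sub, Real.exp_log hN0]
    gcongr
  have hyN : 4 + t ≤ N := by nlinarith
  have slo : signFun d ((4 + t) / N) ≤ 0 := by
    refine (signFun_le (by omega) (by linarith) hyN hylo).trans ?_
    have h1 : 1 / (4 + t) ≤ 1 / 4 := one_div_le_one_div_of_le (by norm_num) (by linarith)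
    have h2 : 2 * N ^ 2 * (0.368 / N) * (1 + 1 / (4 + t)) ≤ 2 * N ^ 2 * (0.368 / N) * (1 + 1 / 4) := by
      gcongr
    have h3 : 2 * N ^ 2 * (0.368 / N) * (1 + 1 / 4) = 0.92 * N := by field_simp; norm_num
    nlinarith
  -- upper end of the bracket
  have hyhi : Real.exp (-(11 / 2 + 2 * t)) ≤ 1.65 / N ^ 2 := by
    have : -(11 / 2 + 2 * t) = 1 / 2 - (Real.log N + Real.log N) := by rw [hlog]; ring
    rw [this, Real.exp_sub, Real.exp_add, Real.exp_log hN0, ← sq]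
    gcongr
    have h1 := Real.exp_one_lt_d9
    have h2 : Real.exp 1 = Real.exp (1 / 2) ^ 2 := by rw [← Real.exp_nat_mul]; norm_num
    nlinarith [Real.exp_pos (1 / 2)]
  have hyN' : 11 / 2 + 2 * t ≤ N := by nlinarith
  have shi : signFun d ((11 / 2 + 2 * t) / N) ≤ 0 := by
    refine (signFun_le (by omega) (by linarith) hyN' hyhi).trans ?_
    have h1 : 1 / (11 / 2 + 2 * t) ≤ 1 / (11 / 2) :=
      one_div_le_one_div_of_le (by norm_num) (by linarith)
    have h2 : 2 * N ^ 2 * (1.65 / N ^ 2) * (1 + 1 / (11 / 2 + 2 * t)) ≤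
        2 * N ^ 2 * (1.65 / N ^ 2) * (1 + 1 / (11 / 2)) := by
      gcongr
    have h3 : 2 * N ^ 2 * (1.65 / N ^ 2) * (1 + 1 / (11 / 2)) = 3.9 := by field_simp; norm_num
    nlinarith
  have hrpow : ∀ y : ℝ, 0 < y → (y / N) ^ ((1 : ℝ) / d) =
      Real.exp (-((Real.log N - Real.log y) / d)) := by
    intro y hy
    rw [Real.rpow_def_of_pos (by positivity), Real.log_div hy.ne' hN0.ne']
    congr 1
    ring
  have hd0 : (0 : ℝ) < d := by linarith
  have blo : 0 ≤ balFun d ((4 + t) / N) := by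
    set L := Real.log N - Real.log (4 + t) with hL
    have hlog4 : Real.log (4 + t) ≤ 1.387 + t / 4 := by
      have e : 4 + t = 4 * (1 + t / 4) := by ring
      rw [e, Real.log_mul (by norm_num) (by positivity)]
      have e2 : Real.log 4 = 2 * Real.log 2 := by
        rw [show (4 : ℝ) = 2 ^ 2 by norm_num, Real.log_pow]; norm_num
      have e3 := Real.log_two_lt_d9
      have e4 := Real.log_le_sub_one_of_pos (by positivity : 0 < 1 + t / 4)
      linarith
    have hlog4' : 0 ≤ Real.log (4 + t) := Real.log_nonneg (by linarith)
    have hL0 : 0 ≤ L := by rw [hL, hlog]; linarith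
    have hLd : L ≤ d / 4 := by
      have : (d : ℝ) = N - 1 := by rw [hN]; ring
      rw [hL, hlog, this]
      nlinarith
    -- This `σ` comes from exp(L/d) ≥ 1 + L/d, and `hLd` turns it into d σ ≤ d - 0.8 L.
    refine balFun_nonneg_of (by omega) (σ := d / (d + L)) (by positivity) ?_ ?_
    · rw [hrpow _ (by positivity), Real.exp_neg, inv_le_comm₀ (Real.exp_pos _) (by positivity),
        inv_div]
      have := Real.add_one_le_exp (L / d)
      refine le_trans (le_of_eq ?_) this
      field_simp
      ring
    · have h1 : (1 - (4 + t) / N) ^ (d + 1) ≤ 0.368 / N := by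
        refine le_trans ?_ hylo
        have := Real.one_sub_div_pow_le_exp_neg (n := d + 1) (t := 4 + t) (by push_cast; exact hyN)
        push_cast at this
        exact this
      have h2 : (1 - (4 + t) / N) ^ (d + 1) * ((4 + t) / N)⁻¹ ≤ 0.092 := by
        calc _ ≤ 0.368 / N * ((4 + t) / N)⁻¹ := by gcongr
          _ = 0.368 / (4 + t) := by field_simp
          _ ≤ 0.368 / 4 := by gcongr; linarith
          _ = 0.092 := by norm_num
      have h3 : (d : ℝ) * (d / (d + L)) ≤ d - 0.8 * L := by
        rw [← mul_div_assoc, div_le_iff₀ (by positivity)]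
        nlinarith
      have h4 : N * ((4 + t) / N) / 2 = (4 + t) / 2 := by field_simp
      rw [h4]
      have : L = 3 + t - Real.log (4 + t) := by rw [hL, hlog]
      linarith
  have bhi : balFun d ((11 / 2 + 2 * t) / N) ≤ 0 := by
    set L := Real.log N - Real.log (11 / 2 + 2 * t) with hL
    have hlog5 : 5 / 4 ≤ Real.log (11 / 2 + 2 * t) := by
      rw [Real.le_log_iff_exp_le (by positivity)]
      have h1 := Real.exp_one_lt_d9
      have h2 : Real.exp (5 / 4) ^ 4 = Real.exp 1 ^ 5 := by
        rw [← Real.exp_nat_mul, ← Real.exp_nat_mul]; norm_num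
      have h3 : Real.exp (5 / 4) ≤ 11 / 2 := by
        refine le_of_pow_le_pow_left₀ (n := 4) (by norm_num) (by norm_num) ?_
        rw [h2]
        calc Real.exp 1 ^ 5 ≤ 2.72 ^ 5 := by gcongr; linarith
          _ ≤ (11 / 2) ^ 4 := by norm_num
      linarith
    refine balFun_nonpos_of (by omega) (σ := 1 - L / d) (by positivity) ?_ ?_
    · rw [hrpow _ (by positivity)]
      have := Real.add_one_le_exp (-(L / d))
      linarith
    · have h1 : 0 ≤ (1 - (11 / 2 + 2 * t) / N) ^ (d + 1) * ((11 / 2 + 2 * t) / N)⁻¹ := by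
        have : 0 ≤ 1 - (11 / 2 + 2 * t) / N := by
          rw [sub_nonneg, div_le_one hN0]; exact hyN'
        positivity
      have h4 : N * ((11 / 2 + 2 * t) / N) / 2 = (11 / 2 + 2 * t) / 2 := by field_simp
      have h5 : (d : ℝ) * (1 - L / d) = d - L := by field_simp
      rw [h4, h5]
      have : L = 3 + t - Real.log (11 / 2 + 2 * t) := by rw [hL, hlog]
      linarith
  refine signFun_nonpos_of_bracket (by omega) h hx (by positivity) ?_ ?_ blo bhi slo shi
  · exact div_lt_div_of_pos_right (by linarith) hN0
  · rw [div_le_one hN0]; exact hyN'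

theorem signFun_nonpos {d : ℕ} (hd : 4 ≤ d) {β x : ℝ} (h : IsBeta d β) (hx : IsXBal d β x) :
    signFun d x ≤ 0 := by
  rcases lt_or_ge d 20 with h20 | h20
  · exact signFun_nonpos_of_lt_twenty hd h20 h hx
  · exact signFun_nonpos_of_twenty_le h20 h hx

end SignAtBal

/-! ### Matching primal and dual solutions. -/

section Value

variable {d : ℕ} {β x : ℝ}

/-- A positive value at `y` would make the derivative positive before `y` and negative after it,
although it is convex and nonpositive at `x`. -/
theorem levelFun_nonpos_of_levelDeriv_nonpos (hd : 2 ≤ d) {γ x y : ℝ} (hγ : γ < 1) (hx : 0 ≤ x)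
    (h0 : levelFun d γ x = 0) (h1 : levelDeriv d γ x ≤ 0) (hy : y ∈ Ioo x 1) :
    levelFun d γ y ≤ 0 := by
  by_contra! hpos
  have hder := fun t => hasDerivAt_levelFun (by omega : 0 < d) γ t
  have hcont : Continuous (levelFun d γ) :=
    continuous_iff_continuousAt.2 fun t => (hder t).continuousAt
  obtain ⟨a, ha, ha'⟩ := exists_hasDerivAt_eq_slope (levelFun d γ) (levelDeriv d γ) hy.1
    hcont.continuousOn fun t _ => hder t
  obtain ⟨b, hb, hb'⟩ := exists_hasDerivAt_eq_slope (levelFun d γ) (levelDeriv d γ) hy.2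
    hcont.continuousOn fun t _ => hder t
  rw [h0, sub_zero] at ha'
  rw [levelFun_one (by omega), zero_sub] at hb'
  have pa : 0 < levelDeriv d γ a := by
    rw [ha']; exact div_pos hpos (by linarith [hy.1])
  have pb : levelDeriv d γ b < 0 := by
    rw [hb']; exact div_neg_of_neg_of_pos (by linarith) (by linarith [hy.2])
  have := (strictConvexOn_levelDeriv hd hγ).convexOn.le_max_of_mem_Icc
    (x := x) (y := b) (z := a) ⟨hx, by linarith [hy.1, hy.2]⟩
    ⟨by linarith [hb.1, hy.1], hb.2.le⟩ ⟨ha.1.le, by linarith [ha.2, hb.1]⟩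
  exact absurd (this.trans (max_le h1 pb.le)) (not_le.2 pa)

theorem IsXBal.levelDeriv_gFun (hd : 2 ≤ d) (h : IsBeta d β) (hx : IsXBal d β x) :
    d * (((d : ℝ) - 1) * x) * levelDeriv d (gFun d x) x = signFun d x := by
  have hd' : (2 : ℝ) ≤ d := by exact_mod_cast hd
  have hm := hx.mem_Ioo hd h
  have hx0 : 0 < x := h.1.trans hm.1
  have hd1 : (d : ℝ) - 1 ≠ 0 := by linarith
  rw [signFun_eq hd hx0 (isXBal_iff.1 hx).2]
  have hg : 1 - gFun d x = 2 * (1 - x) / ((d - 1) * x) := by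
    have hD := (denom_pos hd h ⟨hm.1.le, hm.2⟩).ne'
    unfold gFun
    rw [hx.2] at hD ⊢
    have e : ((d : ℝ) + 1) * (x ^ 2 / 2) - x ^ 2 = (d - 1) * x * x / 2 := by ring
    rw [e] at hD ⊢
    field_simp
    ring
  have hg' : (((d : ℝ) - 1) * x) * (1 - gFun d x) = 2 * (1 - x) := by
    rw [hg]; field_simp
  unfold levelDeriv
  linear_combination (d * ((d : ℝ) + 1) * rDeriv d x - 2 * d * x) * hg'

/-- As the level function at x_bal does not become positive further right, a maximiser beyond x_bal
would make x_bal a second maximiser. -/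
theorem IsXBst.le_isXBal (hd : 4 ≤ d) (h : IsBeta d β) {y : ℝ} (hx : IsXBst d β x)
    (hy : IsXBal d β y) : x ≤ y := by
  have hd2 : 2 ≤ d := by omega
  have hd' : (4 : ℝ) ≤ d := by exact_mod_cast hd
  by_contra! hlt
  have hm := hy.mem_Ioo hd2 h
  have hym : y ∈ Ico β 1 := ⟨hm.1.le, hm.2⟩
  have hy0 : 0 < y := h.1.trans hm.1
  have hs := signFun_nonpos hd h hy
  rw [← hy.levelDeriv_gFun hd2 h] at hs
  have hder : levelDeriv d (gFun d y) y ≤ 0 := by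
    have : 0 < d * (((d : ℝ) - 1) * y) := by
      have : 0 < (d : ℝ) - 1 := by linarith
      positivity
    exact nonpos_of_mul_nonpos_right hs this
  have hl := levelFun_nonpos_of_levelDeriv_nonpos hd2 (gFun_lt_one hd2 h hym) hy0.le
    (levelFun_gFun hd2 h hym) hder ⟨hlt, hx.1.2⟩
  have hle := (gFun_le_iff hd2 h hx.1 _).2 hl
  have hy' : IsXBst d β y := ⟨hym, fun z hz => (hx.2 hz).trans hle⟩
  exact hlt.ne' (IsXBst.unique hd2 h hx hy')

theorem IsXBst.one_sub_gFun (hd : 2 ≤ d) (h : IsBeta d β) (hx : IsXBst d β x) :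
    1 - gFun d x = (x - x ^ 2) / (((d : ℝ) + 1) * rFun d x - x ^ 2) := by
  have hD := (denom_pos hd h hx.1).ne'
  unfold gFun
  field_simp
  ring

theorem IsXBst.cBstAt_eq (hd : 2 ≤ d) (h : IsBeta d β) (hx : IsXBst d β x) :
    cBstAt d x = 2 + (d - 1) * (1 - gFun d x) := by
  rw [hx.one_sub_gFun hd h, cBstAt, mul_div_assoc]

theorem IsXBal.cBalAt_eq (hd : 2 ≤ d) (h : IsBeta d β) (hx : IsXBal d β x) :
    cBalAt d x = 2 / x := by
  have hx0 : 0 < x := h.1.trans (hx.mem_Ioo hd h).1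
  rw [cBalAt, hx.2]
  field_simp

/-- Primal and dual solution both sit at x_bst. The dual is the tangent level function; x_bst ≤
x_bal is what gives V ≥ 0. -/
theorem tendsto_fldim_cBstAt (hd : 4 ≤ d) (h : IsBeta d β) {y : ℝ} (hx : IsXBst d β x)
    (hy : IsXBal d β y) :
    Tendsto (fun n : ℕ => fldim (SubsetPoset d n)) atTop (𝓝 (cBstAt d x)) := by
  have hd2 : 2 ≤ d := by omega
  have hd' : (4 : ℝ) ≤ d := by exact_mod_cast hd
  have hd1 : (d : ℝ) + 1 ≠ 0 := by positivity
  have hD := denom_pos hd2 h hx.1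
  have hbx := hx.beta_lt hd2 h
  have hx0 : 0 < x := h.1.trans hbx
  have hbal : 0 ≤ balFun d x := hy.balFun_nonneg hd2 h ⟨hbx.le, hx.le_isXBal hd h hy⟩
  unfold balFun at hbal
  have hγ := hx.half_lt hd2 h
  have hγ1 := gFun_lt_one hd2 h hx.1
  have l0 := levelFun_gFun hd2 h hx.1
  have l1 := hx.levelDeriv_eq_zero hd2 h
  unfold levelFun at l0
  unfold levelDeriv rDeriv at l1
  set D := ((d : ℝ) + 1) * rFun d x - x ^ 2 with hDdef
  set γ := gFun d x
  have hW : (((d : ℝ) - 1) / D) * D = d - 1 := by field_simp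
  refine tendsto_fldim hd2 (x := x) (y := x) (W := (d - 1) / D)
    (V := 2 - (d - 1) / D * x ^ 2) (l := (1 - γ) * (d + 1)) (T := 2 * γ)
    hx0.le hx.1.2.le (h.one_sub_le hd2 ⟨hx.1.1, hx.1.2.le⟩) (div_nonneg (by linarith) hD.le)
    ?_ ?_ (by ring) ?_ ⟨hx0, hx.1.2⟩ ?_ (by linarith) ?_ ?_ ?_ ?_
  · rw [sub_nonneg, div_mul_eq_mul_div, div_le_iff₀ hD]
    nlinarith
  · field_simp
    linear_combination -((d : ℝ) - 1) * hDdef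
  · rw [cBstAt, ← hDdef]; ring
  · exact mul_nonneg (by linarith) (by positivity)
  · linarith
  · linarith
  · apply le_of_eq; field_simp; ring
  · rw [hx.cBstAt_eq hd2 h]; ring

/-- At x_bal, where r = x²/2, nonpositivity of the optimal level function reads c_bst x²/2 ≤ x. -/
theorem IsXBst.cBstAt_le_cBalAt (hd : 2 ≤ d) (h : IsBeta d β) {y : ℝ} (hx : IsXBst d β x)
    (hy : IsXBal d β y) : cBstAt d x ≤ cBalAt d y := by
  have hm := hy.mem_Ioo hd h
  have hy0 : 0 < y := h.1.trans hm.1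
  rw [hx.cBstAt_eq hd h, hy.cBalAt_eq hd h, le_div_iff₀ hy0]
  have hl := hx.levelFun_nonpos hd h ⟨hm.1.le, hm.2⟩
  unfold levelFun at hl
  rw [hy.2] at hl
  have : y * ((2 + (d - 1) * (1 - gFun d x)) * y - 2) ≤ 0 := by linarith
  have := nonpos_of_mul_nonpos_right this hy0
  linarith

theorem IsXBst.cBstAt_lt (hd : 4 ≤ d) (h : IsBeta d β) (hx : IsXBst d β x) :
    cBstAt d x < d + 1 := by
  have hd' : (4 : ℝ) ≤ d := by exact_mod_cast hd
  rw [hx.cBstAt_eq (by omega) h]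
  have := hx.half_lt (by omega) h
  nlinarith

/-- No full extensions are used. `l` and `T` solve the two tangency equations; `hr` says T ≥ 0, and
`hs` is the dual condition at 1. -/
theorem tendsto_fldim_cBalAt (hd : 2 ≤ d) (h : IsBeta d β) (hx : IsXBal d β x)
    (hs : 0 ≤ signFun d x) (hr : 2 * rDeriv d x ≤ x) :
    Tendsto (fun n : ℕ => fldim (SubsetPoset d n)) atTop (𝓝 (cBalAt d x)) := by
  have hd' : (2 : ℝ) ≤ d := by exact_mod_cast hd
  have hm := hx.mem_Ioo hd h
  have hx0 : 0 < x := h.1.trans hm.1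
  rw [signFun_eq hd hx0 (isXBal_iff.1 hx).2] at hs
  have hF := nonneg_of_mul_nonneg_right hs (by linarith)
  have hlt : 0 < x - rDeriv d x := by linarith
  rw [hx.cBalAt_eq hd h]
  refine tendsto_fldim hd (x := x) (y := x) (W := 2 / x ^ 2) (V := 0)
    (l := 1 / (x - rDeriv d x)) (T := (x - 2 * rDeriv d x) / (x * (x - rDeriv d x)))
    hx0.le hm.2.le (h.one_sub_le hd hx.1) (by positivity) le_rfl ?_ ?_ ?_ ⟨hx0, hm.2⟩
    (by positivity) (div_nonneg (by linarith) (by positivity)) ?_ ?_ ?_ ?_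
  · rw [hx.2]; field_simp; ring
  · field_simp; ring
  · field_simp; ring
  · rw [hx.2]; field_simp; ring
  · change _ * rDeriv d x + _ = 1
    field_simp; ring
  · have : 1 / (x - rDeriv d x) / (d + 1) +
        (x - 2 * rDeriv d x) / (x * (x - rDeriv d x)) / 2 =
        (2 * x + (d + 1) * (x - 2 * rDeriv d x)) / (2 * (d + 1) * (x * (x - rDeriv d x))) := by
      field_simp
    rw [this, div_le_one (by positivity)]
    linarith
  · field_simp; ring

/-- A convex function that changes sign from `lo` to `mid` stays nonnegative after `mid`. -/
theorem signFun_nonneg_of_le (hd : 2 ≤ d) {lo mid x : ℝ} (hlo : 0 < lo) (hlm : lo < mid)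
    (hmx : mid ≤ x) (hx : x ≤ 1) (slo : signFun d lo ≤ 0) (smid : 0 < signFun d mid) :
    0 ≤ signFun d x := by
  by_contra! hneg
  have := (convexOn_signFun hd).le_max_of_mem_Icc (x := lo) (y := x) (z := mid)
    ⟨hlo, by linarith⟩ ⟨by linarith, hx⟩ ⟨hlm.le, hmx⟩
  exact absurd (this.trans (max_le slo hneg.le)) (not_le.2 smid)

theorem tendsto_fldim_two (h : IsBeta 2 β) (hx : IsXBal 2 β x) :
    Tendsto (fun n : ℕ => fldim (SubsetPoset 2 n)) atTop (𝓝 (cBalAt 2 x)) ∧ cBalAt 2 x < 3 := by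
  have hx1 := (hx.mem_Ioo le_rfl h).2
  have hge : (4 / 5 : ℝ) ≤ x := by
    refine hx.le_of_balFun_nonneg le_rfl h (by norm_num) ?_
    refine balFun_nonneg_of (σ := 0.8945) le_rfl (by norm_num)
      (rpow_one_div_le (by norm_num) (by norm_num) (by norm_num) (by norm_num)) ?_
    norm_num
  refine ⟨tendsto_fldim_cBalAt le_rfl h hx ?_ ?_, ?_⟩
  · refine signFun_nonneg_of_le (lo := 7 / 10) le_rfl (by norm_num) (by norm_num) hge hx1.le ?_ ?_
    all_goals norm_num [signFun]
  · have : x ≤ x ^ ((1 : ℝ) / (2 : ℕ)) :=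
      le_rpow_one_div (by norm_num) (by linarith) (by nlinarith)
    unfold rDeriv
    nlinarith
  · rw [hx.cBalAt_eq le_rfl h, div_lt_iff₀ (by linarith)]
    linarith

theorem tendsto_fldim_three (h : IsBeta 3 β) (hx : IsXBal 3 β x) :
    Tendsto (fun n : ℕ => fldim (SubsetPoset 3 n)) atTop (𝓝 (cBalAt 3 x)) ∧ cBalAt 3 x < 4 := by
  have h3 : 2 ≤ 3 := by norm_num
  have hx1 := (hx.mem_Ioo h3 h).2
  -- For d = 3 the sign change of `signFun` lies only about 0.001 below x_bal, hence the four
  -- decimals.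
  have hge : (0.6751 : ℝ) ≤ x := by
    refine hx.le_of_balFun_nonneg h3 h (by norm_num) ?_
    refine balFun_nonneg_of (σ := 0.87727) h3 (by norm_num)
      (rpow_one_div_le (by norm_num) (by norm_num) (by norm_num) (by norm_num)) ?_
    norm_num
  refine ⟨tendsto_fldim_cBalAt h3 h hx ?_ ?_, ?_⟩
  · refine signFun_nonneg_of_le (lo := 3 / 5) h3 (by norm_num) (by norm_num) hge hx1.le ?_ ?_
    all_goals norm_num [signFun]
  · have h1 : (0.87 : ℝ) ≤ x ^ ((1 : ℝ) / (3 : ℕ)) :=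
      le_rpow_one_div (by norm_num) (by linarith) (by norm_num at hge ⊢; linarith)
    have h2 : (1 - x) ^ 3 ≤ (0.3249 : ℝ) ^ 3 := by
      gcongr; linarith
    unfold rDeriv
    norm_num at hge h1 h2 ⊢
    linarith
  · rw [hx.cBalAt_eq h3 h, div_lt_iff₀ (by linarith)]
    linarith

end Value

theorem theorem2 (d : ℕ) (hd : 2 ≤ d) :
    ∃ β xbst xbal : ℝ,
      -- `β`, `x_bst` and `x_bal` exist and are uniquely determined
      (IsBeta d β ∧ ∀ b, IsBeta d b → b = β) ∧
      (IsXBst d β xbst ∧ ∀ x, IsXBst d β x → x = xbst) ∧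
      (IsXBal d β xbal ∧ ∀ x, IsXBal d β x → x = xbal) ∧
      -- the limit that defines `FLD d` exists
      Tendsto (fun n : ℕ => fldim (SubsetPoset d n)) atTop (𝓝 (FLD d)) ∧
      -- its value
      (d ≤ 3 → FLD d = cBalAt d xbal) ∧
      (4 ≤ d → FLD d = cBstAt d xbst ∧ FLD d = min (cBalAt d xbal) (cBstAt d xbst)) ∧
      FLD d < (d : ℝ) + 1 := by
  obtain ⟨β, hβ, hβu⟩ := exists_isBeta hd
  obtain ⟨xbst, hbst⟩ := exists_isMaxOn_gFun hd hβ
  obtain ⟨xbal, hbal, hbalu⟩ := exists_isXBal hd hβ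
  refine ⟨β, xbst, xbal, ⟨hβ, hβu⟩, ⟨hbst, fun y hy => IsXBst.unique hd hβ hy hbst⟩,
    ⟨hbal, hbalu⟩, ?_⟩
  rcases lt_or_ge d 4 with h4 | h4
  · have key : Tendsto (fun n : ℕ => fldim (SubsetPoset d n)) atTop (𝓝 (cBalAt d xbal)) ∧
        cBalAt d xbal < (d : ℝ) + 1 := by
      obtain rfl | rfl : d = 2 ∨ d = 3 := by omega
      · obtain ⟨h1, h2⟩ := tendsto_fldim_two hβ hbal
        exact ⟨h1, by norm_num; exact h2⟩
      · obtain ⟨h1, h2⟩ := tendsto_fldim_three hβ hbal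
        exact ⟨h1, by norm_num; exact h2⟩
    have hF : FLD d = cBalAt d xbal := key.1.limUnder_eq
    rw [hF]
    exact ⟨key.1, fun _ => rfl, fun h => absurd h (by omega), key.2⟩
  · have key := tendsto_fldim_cBstAt h4 hβ hbst hbal
    have hF : FLD d = cBstAt d xbst := key.limUnder_eq
    rw [hF, min_eq_right (hbst.cBstAt_le_cBalAt hd hβ hbal)]
    exact ⟨key, fun h => absurd h (by omega), fun _ => ⟨rfl, rfl⟩, hbst.cBstAt_lt h4 hβ⟩
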